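/- Let $n\ge 1$ and $m\ge 0$ be integers, let $d\mu$ be Lebesgue measure on $\mathbb C^n=\mathbb R^{2n}$, and let $A_m^2(\mathbb C^n)$ be the generalized Bargmann–Fock space of all $\psi\in L^2(\mathbb C^n,e^{-|z|^2}d\mu)$ with $\widetilde\Delta\psi=m\psi$ (in the sense of distributions), where $$\widetilde\Delta=-\sum_{j=1}^n\frac{\partial^2}{\partial z_j\partial\bar z_j}+\sum_{j=1}^n\bar z_j\frac{\partial}{\partial\bar z_j}.$$ Write $(a)_k=a(a+1)\cdots(a+k-1)$, $(a)_0=1$, and $L_k^{(\alpha)}(x)=\sum_{i=0}^k(-1)^i\binom{k+\alpha}{k-i}\frac{x^i}{i!}$, and put $$b_m(z)=\frac{m!}{(n)_m\,\pi^n}\,e^{-|z|^2}\bigl(L_m^{(n-1)}(|z|^2)\bigr)^2,\qquad z\in\mathbb C^n .$$ 1. $A_m^2(\mathbb C^n)$ consists of (classes of) continuous functions and has a reproducing kernel $K$. Let $e_z=K(z,z)^{-1/2}K(\cdot,z)$ and let $P$ be the orthogonal projection of $L^2(\mathbb C^n,e^{-|z|^2}d\mu)$ onto $A_m^2(\mathbb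 C^n)$. For every $\varphi\in L^\infty(\mathbb C^n)$, the Berezin transform $z\mapsto\langle P(\varphi e_z),e_z\rangle$ attached to $A_m^2(\mathbb C^n)$ is the convolution with $b_m$: $$\langle P(\varphi e_z),e_z\rangle=\int_{\mathbb C^n}b_m(z-w)\,\varphi(w)\,d\mu(w)\qquad\text{for all }z\in\mathbb C^n .$$ 2. The convolution $B_m\varphi=b_m*\varphi$ is a bounded operator on $L^2(\mathbb C^n,d\mu)$, and it is the following function of the Euclidean Laplacian $\Delta=4\sum_j\partial^2/\partial z_j\partial\bar z_j$, in the sense of the functional calculus of the self-adjoint operator $\Delta$ on $L^2(\mathbb C^n,d\mu)$: $$B_m=\frac1{(n)_m}\exp\Bigl(\frac{\Delta}{4}\Bigr)\sum_{k=0}^m\frac{(n-1)_k\,(m-k)!}{k!}\Bigl(-\frac{\Delta}{4}\Bigr)^k L_{m-k}^{(k)}\Bigl(-\frac{\Delta}{4}\Bigr)L_{m-k}^{(n-1+k)}\Bigl(-\frac{\Delta}{4}\Bigr).$$ 3. For $n=1$ this reads $B_m=\exp(\Delta/4)\,\bigl(L_m^{(0)}(-\Delta/4)\bigr)^2$. 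-/

import Mathlib

open MeasureTheory FourierTransform
open scoped ENNReal ContDiff ComplexInnerProductSpace

/-- Complex Euclidean space `ℂⁿ`, with its Euclidean norm, its underlying real inner product
`Re ⟨z, w⟩` (that is, `ℂⁿ = ℝ²ⁿ`), and `volume` the Lebesgue measure. -/
abbrev Cn (n : ℕ) : Type := EuclideanSpace ℂ (Fin n)

/-- The generalized Laguerre polynomial
`L_k^{(α)}(x) = ∑_{i=0}^k (-1)^i binom(k+α, k-i) x^i / i!` (for integers `α ≥ 0`). -/
noncomputable def laguerre (k α : ℕ) (x : ℝ) : ℝ :=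
  ∑ i ∈ Finset.range (k + 1),
    (-1 : ℝ) ^ i * ((k + α).choose (k - i) : ℝ) * x ^ i / (i.factorial : ℝ)

/-- The Pochhammer symbol `(a)_k = a (a + 1) ⋯ (a + k - 1)`, with `(a)_0 = 1`. -/
noncomputable def pochhammer (a : ℝ) (k : ℕ) : ℝ :=
  ∏ i ∈ Finset.range k, (a + (i : ℝ))

section Wirtinger

/-- `∂/∂z_j = (1/2) (∂/∂x_j - i ∂/∂y_j)`. -/
noncomputable def dZ {n : ℕ} (j : Fin n) (u : Cn n → ℂ) (z : Cn n) : ℂ :=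
  (1 / 2 : ℂ) * (fderiv ℝ u z (EuclideanSpace.single j (1 : ℂ))
    - Complex.I * fderiv ℝ u z (EuclideanSpace.single j Complex.I))

/-- `∂/∂z̄_j = (1/2) (∂/∂x_j + i ∂/∂y_j)`. -/
noncomputable def dZbar {n : ℕ} (j : Fin n) (u : Cn n → ℂ) (z : Cn n) : ℂ :=
  (1 / 2 : ℂ) * (fderiv ℝ u z (EuclideanSpace.single j (1 : ℂ))
    + Complex.I * fderiv ℝ u z (EuclideanSpace.single j Complex.I))

/-- The magnetic Schrödinger operator
`Δ̃ = - ∑_j ∂²/∂z_j∂z̄_j + ∑_j z̄_j ∂/∂z̄_j` on `ℂⁿ`. -/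
noncomputable def magneticLaplacian {n : ℕ} (u : Cn n → ℂ) (z : Cn n) : ℂ :=
  - (∑ j, dZ j (dZbar j u) z) + ∑ j, (starRingEnd ℂ) (z j) * dZbar j u z

end Wirtinger

/-- The measure `e^{-|z|²} dμ(z)` on `ℂⁿ`. -/
noncomputable def gaussianWeight (n : ℕ) : Measure (Cn n) :=
  volume.withDensity fun z => ENNReal.ofReal (Real.exp (-‖z‖ ^ 2))

/-- The generalized Bargmann–Fock space
`A²_m(ℂⁿ) = {ψ ∈ L²(ℂⁿ, e^{-|z|²} dμ) : Δ̃ ψ = m ψ}`. The operator `Δ̃` has `C_0^∞(ℂⁿ)` as its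
regular domain, where it is symmetric, so the equation reads `⟨(Δ̃ - m) η, ψ⟩ = 0` for all test
functions `η` (the eigenvalue equation in the sense of distributions); that is, `ψ` is orthogonal
to all the functions `(Δ̃ - m) η`. -/
noncomputable def bargmannFock (n m : ℕ) : Submodule ℂ (Lp ℂ 2 (gaussianWeight n)) :=
  (Submodule.span ℂ {u : Lp ℂ 2 (gaussianWeight n) |
    ∃ η : Cn n → ℂ, ContDiff ℝ ∞ η ∧ HasCompactSupport η ∧
      u =ᵐ[gaussianWeight n] fun z => magneticLaplacian η z - (m : ℂ) * η z})ᗮ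

instance bargmannFock_hasOrthogonalProjection (n m : ℕ) :
    (bargmannFock n m).HasOrthogonalProjection := by
  unfold bargmannFock
  infer_instance

section Berezin

variable {X : Type*} [MeasurableSpace X] {ν : Measure X}

/-- The subspace `H` of `L²(ν)` consists of (classes of) continuous functions and `k z = K(·, z)`
is its reproducing kernel: `k z ∈ H`, and `g(z) = ⟨g, K(·, z)⟩` for all `g ∈ H` and all `z`.
(Mathlib's inner product is conjugate-linear in the first variable.) -/
structure IsReproducingKernel [TopologicalSpace X] (H : Submodule ℂ (Lp ℂ 2 ν))
    (k : X → Lp ℂ 2 ν) : Prop where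
  mem : ∀ z, k z ∈ H
  reproducing : ∀ ψ ∈ H, ∃ g : X → ℂ, Continuous g ∧ ψ =ᵐ[ν] g ∧ ∀ z, g z = ⟪k z, ψ⟫

/-- The Toeplitz operator `T_φ h = P (φ h)` with symbol `φ ∈ L^∞`, `P` being the orthogonal
projection of `L²(ν)` onto `H`. -/
noncomputable def toeplitz (H : Submodule ℂ (Lp ℂ 2 ν)) [H.HasOrthogonalProjection]
    (φ : Lp ℂ ∞ ν) (h : Lp ℂ 2 ν) : Lp ℂ 2 ν :=
  H.starProjection (φ • h : Lp ℂ 2 ν)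

/-- The normalized reproducing kernel `e_z = K(z, z)^{-1/2} K(·, z) = K(·, z) / ‖K(·, z)‖`. -/
noncomputable def normalizedKernel (k : X → Lp ℂ 2 ν) (z : X) : Lp ℂ 2 ν :=
  ((‖k z‖⁻¹ : ℝ) : ℂ) • k z

/-- The Berezin transform of `φ ∈ L^∞(ν)` (which is `L^∞(dμ)` for `ν = e^{-|z|²} dμ`, as the two
measures have the same null sets): the Berezin symbol `z ↦ ⟨T_φ e_z, e_z⟩` of `T_φ`. -/
noncomputable def berezinTransform (H : Submodule ℂ (Lp ℂ 2 ν)) [H.HasOrthogonalProjection]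
    (k : X → Lp ℂ 2 ν) (φ : Lp ℂ ∞ ν) (z : X) : ℂ :=
  ⟪normalizedKernel k z, toeplitz H φ (normalizedKernel k z)⟫

end Berezin

/-- `b_m(z) = m! / ((n)_m πⁿ) · e^{-|z|²} (L_m^{(n-1)}(|z|²))²`, for `n ≥ 1`. -/
noncomputable def berezinDensity (n m : ℕ) (z : Cn n) : ℝ :=
  (m.factorial : ℝ) / (pochhammer n m * Real.pi ^ n) * Real.exp (-‖z‖ ^ 2)
    * (laguerre m (n - 1) (‖z‖ ^ 2)) ^ 2

section LaplacianCalculus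

variable {n : ℕ}

/-- The multiplier by which `g(Δ)` acts on the Fourier side. With the normalization
`𝓕 f (ξ) = ∫ e^{-2πi (ξ | x)} f(x) dx`, the Laplacian becomes multiplication by
`-(2π|ξ|)²`. -/
noncomputable def laplacianMultiplier (g : ℝ → ℝ) (φ : Lp ℂ 2 (volume : Measure (Cn n)))
    (ξ : Cn n) : ℂ :=
  ((g (-(2 * Real.pi * ‖ξ‖) ^ 2) : ℝ) : ℂ) * (𝓕 φ : Lp ℂ 2 (volume : Measure (Cn n))) ξ

theorem laplacianMultiplier_add (g : ℝ → ℝ) (φ ψ : Lp ℂ 2 (volume : Measure (Cn n))) :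
    laplacianMultiplier g (φ + ψ) =ᵐ[volume]
      laplacianMultiplier g φ + laplacianMultiplier g ψ := by
  have h : (𝓕 (φ + ψ) : Lp ℂ 2 (volume : Measure (Cn n))) = 𝓕 φ + 𝓕 ψ :=
    FourierTransform.fourier_add φ ψ
  filter_upwards [Lp.coeFn_add (𝓕 φ : Lp ℂ 2 (volume : Measure (Cn n))) (𝓕 ψ)] with ξ hξ
  simp only [laplacianMultiplier, h, hξ, Pi.add_apply, mul_add]

theorem laplacianMultiplier_smul (g : ℝ → ℝ) (c : ℂ)
    (φ : Lp ℂ 2 (volume : Measure (Cn n))) :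
    laplacianMultiplier g (c • φ) =ᵐ[volume] c • laplacianMultiplier g φ := by
  have h : (𝓕 (c • φ) : Lp ℂ 2 (volume : Measure (Cn n))) = c • 𝓕 φ :=
    FourierTransform.fourier_smul c φ
  filter_upwards [Lp.coeFn_smul c (𝓕 φ : Lp ℂ 2 (volume : Measure (Cn n)))] with ξ hξ
  simp only [laplacianMultiplier, h, hξ, Pi.smul_apply, smul_eq_mul]
  ring

theorem laplacianMultiplier_zero (g : ℝ → ℝ) :
    laplacianMultiplier g (0 : Lp ℂ 2 (volume : Measure (Cn n))) =ᵐ[volume] 0 := by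
  have := laplacianMultiplier_smul g 0 (0 : Lp ℂ 2 (volume : Measure (Cn n)))
  simpa using this

/-- The natural domain of `g(Δ)`: all `φ ∈ L²` for which `g(-(2π|ξ|)²) 𝓕 φ` is again in `L²`. -/
noncomputable def laplacianDomain (n : ℕ) (g : ℝ → ℝ) :
    Submodule ℂ (Lp ℂ 2 (volume : Measure (Cn n))) where
  carrier := {φ | MemLp (laplacianMultiplier g φ) 2 volume}
  add_mem' := fun {φ ψ} hφ hψ =>
    (memLp_congr_ae (laplacianMultiplier_add g φ ψ)).2 (MemLp.add hφ hψ)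
  zero_mem' := (memLp_congr_ae (laplacianMultiplier_zero g)).2 MemLp.zero
  smul_mem' := fun c φ hφ =>
    (memLp_congr_ae (laplacianMultiplier_smul g c φ)).2 (MemLp.const_smul hφ c)

/-- Multiplication by `g(-(2π|ξ|)²)` on the Fourier side, as a linear map
`φ ↦ g(-(2π|ξ|)²) 𝓕 φ` from the domain of `g(Δ)` to `L²`. -/
noncomputable def laplacianMul (n : ℕ) (g : ℝ → ℝ) :
    laplacianDomain n g →ₗ[ℂ] Lp ℂ 2 (volume : Measure (Cn n)) where
  toFun := fun φ => MemLp.toLp (laplacianMultiplier g φ.1) φ.2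
  map_add' := fun φ ψ =>
    (MemLp.toLp_congr (φ + ψ).2 (MemLp.add φ.2 ψ.2) (laplacianMultiplier_add g φ.1 ψ.1)).trans
      (MemLp.toLp_add φ.2 ψ.2)
  map_smul' := fun c φ =>
    (MemLp.toLp_congr (c • φ).2 (MemLp.const_smul φ.2 c)
      (laplacianMultiplier_smul g c φ.1)).trans (MemLp.toLp_const_smul c φ.2)

/-- The function `g(Δ)` of the Euclidean Laplacian `Δ` of `ℂⁿ = ℝ²ⁿ` in the sense of the
functional calculus of the self-adjoint operator `Δ` on `L²(ℂⁿ, dμ)`: the operator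
`φ ↦ 𝓕⁻¹ (g(-(2π|ξ|)²) 𝓕 φ)`, with its maximal domain. -/
noncomputable def laplacianFunction (n : ℕ) (g : ℝ → ℝ) :
    Lp ℂ 2 (volume : Measure (Cn n)) →ₗ.[ℂ] Lp ℂ 2 (volume : Measure (Cn n)) where
  domain := laplacianDomain n g
  toFun := (Lp.fourierTransformₗᵢ (Cn n) ℂ).symm.toLinearEquiv.toLinearMap ∘ₗ laplacianMul n g

end LaplacianCalculus

/-! The reproducing kernel. Put k_{j,a}(w) = π⁻ⁿ e^{⟨w,a⟩} L_j^{(n-1)}(|w-a|²). On functions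
e^{⟨w,a⟩} ρ(|w-a|²) the magnetic Laplacian acts on the profile alone, as ρ ↦ (r-n)ρ' - rρ'', so the
Laguerre equation makes k_{j,a} an eigenfunction with eigenvalue j. By symmetry k_{m,a} lies in A²_m
(`landauKernel_mem`). Smoothly cut-off copies of k_{j,a} are admissible test functions, and removing
the cutoff shows that each ψ in A²_m is orthogonal to k_{j,a} for j ≠ m
(`inner_landauKernel_eq_zero`). In the generating function ∑ t^j k_{j,a}, which is a Gaussian in w-a
times e^{⟨w,a⟩}, the pairing with ψ therefore leaves only t^m ⟨k_{m,a}, ψ⟩ (`integral_mehler`). As t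
→ 1 the Gaussian becomes an approximate identity, and ψ(a) = ⟨k_{m,a}, ψ⟩ results. No completeness
of the system of Landau levels is needed.

The Berezin transform. The projection P drops out because e_z lies in A²_m, and completing the
square gives e^{-|w|²}|e_z(w)|² = b_m(z-w). Uniqueness of the kernel extends the formula to any
reproducing kernel.

The spectral function. Convolution with b_m is the Fourier multiplier with symbol the transform of
b_m. With S = π²|ξ|², two successive generating functions, one for each Laguerre factor, reduce that
transform to Gaussian integrals; extracting coefficients gives a multiple of e^{-S} ∑_i binom(m+n-1,
m-i) (-S)^i/i! L_i^{(i)}(S) (`integral_laguerre_sq_mul_fourierKernel`). The asserted sum of products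
of two Laguerre polynomials equals m! times this sum over i (`sum_choose_mul_laguerre_diagonal`):
both are images of one binomial identity in two variables x, y under the functional x^p y^q ↦
(-S)^{p+q}/(p! q!). -/

/-! ### Laguerre polynomials -/

/-- The coefficients of the generalized Laguerre polynomial. -/
noncomputable def laguerreCoeff (k α i : ℕ) : ℝ :=
  (-1 : ℝ) ^ i * ((k + α).choose (α + i) : ℝ) / (i.factorial : ℝ)

/-- The generalized Laguerre polynomial as an element of `ℝ[X]`. -/
noncomputable def laguerrePoly (k α : ℕ) : Polynomial ℝ :=
  ∑ i ∈ Finset.range (k + 1), Polynomial.monomial i (laguerreCoeff k α i)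

/-- The form on the right vanishes by itself for i > k, whereas k - i is then truncated to 0; this
is why the coefficients are defined with α + i. -/
theorem choose_add_sub_eq {k i : ℕ} (α : ℕ) (h : i ≤ k) :
    (k + α).choose (k - i) = (k + α).choose (α + i) := by
  rw [← Nat.choose_symm (by omega : k - i ≤ k + α)]
  congr 1
  omega

theorem laguerre_eq_sum (k α : ℕ) (x : ℝ) :
    laguerre k α x = ∑ i ∈ Finset.range (k + 1), laguerreCoeff k α i * x ^ i := by
  refine Finset.sum_congr rfl fun i hi => ?_
  rw [laguerreCoeff, choose_add_sub_eq α (Nat.lt_succ_iff.mp (Finset.mem_range.mp hi))]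
  ring

theorem eval_laguerrePoly (k α : ℕ) (x : ℝ) : (laguerrePoly k α).eval x = laguerre k α x := by
  simp [laguerrePoly, Polynomial.eval_finsetSum, laguerre_eq_sum]

theorem laguerreCoeff_eq_zero {k α i : ℕ} (h : k < i) : laguerreCoeff k α i = 0 := by
  simp [laguerreCoeff, Nat.choose_eq_zero_of_lt (by omega : k + α < α + i)]

theorem coeff_laguerrePoly (k α i : ℕ) : (laguerrePoly k α).coeff i = laguerreCoeff k α i := by
  simp only [laguerrePoly, Polynomial.finsetSum_coeff, Polynomial.coeff_monomial,
    Finset.sum_ite_eq', Finset.mem_range]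
  split_ifs with h
  · rfl
  · exact (laguerreCoeff_eq_zero (by omega)).symm

/-- This two-term recurrence is the Laguerre differential equation read off coefficientwise. -/
theorem laguerreCoeff_succ (k α i : ℕ) :
    ((i : ℝ) + 1) * (i + 1 + α) * laguerreCoeff k α (i + 1)
      = ((i : ℝ) - k) * laguerreCoeff k α i := by
  rcases lt_or_ge k i with h | h
  · rw [laguerreCoeff_eq_zero h, laguerreCoeff_eq_zero (by omega)]; simp
  have h1 := Nat.choose_succ_right_eq (k + α) (α + i)
  have h2 : (((k + α).choose (α + (i + 1)) : ℕ) : ℝ) * (i + 1 + α)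
      = (k + α).choose (α + i) * (k - i) := by
    have : k + α - (α + i) = k - i := by omega
    rw [this] at h1
    have h3 := congrArg (Nat.cast : ℕ → ℝ) h1
    push_cast [Nat.cast_sub h] at h3
    rw [← add_assoc α i 1]
    linarith
  have hi : ((i : ℝ) + 1) ≠ 0 := by positivity
  have hf : ((i.factorial : ℕ) : ℝ) ≠ 0 := by positivity
  simp only [laguerreCoeff, Nat.factorial_succ, Nat.cast_mul, Nat.cast_succ, pow_succ]
  field_simp
  linear_combination -h2

/-- The Laguerre differential equation. -/
theorem laguerrePoly_ode (k α : ℕ) :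
    Polynomial.X * Polynomial.derivative (Polynomial.derivative (laguerrePoly k α))
      + (Polynomial.C ((α : ℝ) + 1) - Polynomial.X) * Polynomial.derivative (laguerrePoly k α)
      + Polynomial.C (k : ℝ) * laguerrePoly k α = 0 := by
  ext i
  have h := laguerreCoeff_succ k α i
  rcases i with _ | i
  · simp only [sub_mul, Polynomial.coeff_add, Polynomial.coeff_sub, Polynomial.coeff_X_mul_zero,
      Polynomial.coeff_C_mul, Polynomial.coeff_derivative, coeff_laguerrePoly, Polynomial.coeff_zero]
    simp at h ⊢
    linarith
  · simp only [sub_mul, Polynomial.coeff_add, Polynomial.coeff_sub, Polynomial.coeff_X_mul,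
      Polynomial.coeff_C_mul, Polynomial.coeff_derivative, coeff_laguerrePoly, Polynomial.coeff_zero]
    push_cast at h ⊢
    linear_combination h

/-- The coefficients alternate in sign, so at -x every term is nonnegative. The right side is
summable against t^k by the generating function itself, which makes it the majorant for termwise
integration. -/
theorem abs_laguerre_le (k α : ℕ) {x : ℝ} (hx : 0 ≤ x) : |laguerre k α x| ≤ laguerre k α (-x) := by
  rw [laguerre_eq_sum, laguerre_eq_sum]
  refine (Finset.abs_sum_le_sum_abs _ _).trans (Finset.sum_le_sum fun i _ => ?_)
  rw [abs_mul, laguerreCoeff, abs_div, abs_mul, abs_pow, abs_neg, abs_one, one_pow, abs_pow,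
    abs_of_nonneg hx, Nat.abs_cast, Nat.abs_cast, neg_pow x]
  apply le_of_eq
  have : ((-1 : ℝ) ^ i) * (-1) ^ i = 1 := by rw [← mul_pow]; simp
  field_simp
  linear_combination (-((k + α).choose (α + i) : ℝ) * x ^ i) * this

/-- The generating function of the Laguerre polynomials. -/
theorem hasSum_laguerre (α : ℕ) (x : ℝ) {t : ℝ} (ht : |t| < 1) :
    HasSum (fun k => t ^ k * laguerre k α x)
      (((1 - t) ^ (α + 1))⁻¹ * Real.exp (-(t / (1 - t)) * x)) := by
  -- The double series over (i, d) with k = i + d is summed first over d, a negative binomial series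
  -- (`inner`), then over i, an exponential series (`key`).
  have key : ∀ (x t : ℝ), |t| < 1 → HasSum (fun i : ℕ => (-x * t) ^ i / i.factorial *
      ((1 - t) ^ (α + i + 1))⁻¹) (((1 - t) ^ (α + 1))⁻¹ * Real.exp (-(t / (1 - t)) * x)) := by
    intro x t ht
    have h1 : 0 < 1 - t := by linarith [le_abs_self t]
    have h := (NormedSpace.expSeries_div_hasSum_exp (-(t / (1 - t)) * x)).mul_left
      ((1 - t) ^ (α + 1))⁻¹
    rw [← Real.exp_eq_exp_ℝ] at h
    refine h.congr_fun ?_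
    intro i
    have : (1 - t) ≠ 0 := h1.ne'
    rw [show α + i + 1 = α + 1 + i by ring, pow_add]
    rw [show -(t / (1 - t)) * x = (-x * t) / (1 - t) by field_simp, div_pow]
    field_simp
  have inner : ∀ (x t : ℝ), |t| < 1 → ∀ i : ℕ, HasSum (fun d : ℕ =>
      (-x * t) ^ i / i.factorial * (((d + (α + i)).choose (α + i) : ℕ) * t ^ d))
      ((-x * t) ^ i / i.factorial * ((1 - t) ^ (α + i + 1))⁻¹) := by
    intro x t ht i
    have := (hasSum_choose_mul_geometric_of_norm_lt_one (α + i) (r := t) (by simpa using ht))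
    simpa [one_div] using this.mul_left ((-x * t) ^ i / i.factorial : ℝ)
  let f : ℕ × ℕ → ℝ := fun p =>
    (-x * t) ^ p.1 / p.1.factorial * (((p.2 + (α + p.1)).choose (α + p.1) : ℕ) * t ^ p.2)
  have hsum : Summable f := by
    rw [← summable_norm_iff]
    have ha : |(|t|)| < 1 := by simpa using ht
    -- The absolute values form the same double series at -|x| and |t|, so the two summations above
    -- also give absolute convergence.
    have hn : ∀ p : ℕ × ℕ, ‖f p‖ = (-(-|x|) * |t|) ^ p.1 / p.1.factorial *
        (((p.2 + (α + p.1)).choose (α + p.1) : ℕ) * |t| ^ p.2) := by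
      intro p
      simp [f]
    rw [summable_prod_of_nonneg (fun p => norm_nonneg _)]
    simp only [hn]
    refine ⟨fun i => (inner (-|x|) |t| ha i).summable, ?_⟩
    simp only [fun i => (inner (-|x|) |t| ha i).tsum_eq]
    exact (key (-|x|) |t| ha).summable
  have hf : HasSum f (((1 - t) ^ (α + 1))⁻¹ * Real.exp (-(t / (1 - t)) * x)) := by
    have h2 := hsum.hasSum
    rwa [(hsum.hasSum.prod_fiberwise (inner x t ht)).unique (key x t ht)] at h2
  have h3 := (Finset.HasAntidiagonal.sigmaAntidiagonalEquivProd.hasSum_iff (f := f)).mpr hf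
  have h4 := h3.sigma (fun k => hasSum_fintype _)
  convert h4 using 2 with k
  rw [show (∑ b, (f ∘ ⇑Finset.HasAntidiagonal.sigmaAntidiagonalEquivProd) ⟨k, b⟩)
    = ∑ p ∈ Finset.HasAntidiagonal.antidiagonal k, f p from Finset.sum_coe_sort _ f, laguerre_eq_sum,
    Finset.Nat.sum_antidiagonal_eq_sum_range_succ_mk, Finset.mul_sum]
  refine Finset.sum_congr rfl fun i hi => ?_
  have hi' : i ≤ k := Nat.lt_succ_iff.mp (Finset.mem_range.mp hi)
  simp only [f, laguerreCoeff]
  rw [show k - i + (α + i) = k + α by omega, ← pow_mul_pow_sub t hi', mul_pow, neg_pow x]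
  ring

/-- A polynomial grows slower than any exponential. -/
theorem Polynomial.exists_abs_eval_le_exp (p : Polynomial ℝ) {δ : ℝ} (hδ : 0 < δ) :
    ∃ C, 0 ≤ C ∧ ∀ r, 0 ≤ r → |p.eval r| ≤ C * Real.exp (δ * r) := by
  refine ⟨∑ i ∈ Finset.range (p.natDegree + 1), |p.coeff i| * (i.factorial / δ ^ i),
    Finset.sum_nonneg fun i _ => by positivity, fun r hr => ?_⟩
  rw [Polynomial.eval_eq_sum_range, Finset.sum_mul]
  refine (Finset.abs_sum_le_sum_abs _ _).trans (Finset.sum_le_sum fun i _ => ?_)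
  rw [abs_mul, abs_of_nonneg (pow_nonneg hr i), mul_assoc]
  gcongr
  have h := Real.pow_div_factorial_le_exp (x := δ * r) (by positivity) i
  rw [mul_pow, div_le_iff₀ (by positivity)] at h
  rw [div_mul_eq_mul_div, le_div_iff₀ (by positivity)]
  linarith

/-! ### Uniqueness of power series coefficients -/

/-- Letting a → 0+ isolates the constant term; the absolutely convergent series at ε/2 dominates. -/
theorem eq_zero_of_hasSum_pow_mul_eq_zero_aux {c : ℕ → ℂ} {ε : ℝ} (hε : 0 < ε)
    (h : ∀ a : ℝ, 0 < a → a < ε → HasSum (fun k => ((a ^ k : ℝ) : ℂ) * c k) 0) : c 0 = 0 := by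
  have hs := (h (ε / 2) (by linarith) (by linarith)).summable.norm
  have hlim : Filter.Tendsto (fun a : ℝ => ∑' k, ((a ^ k : ℝ) : ℂ) * c k)
      (nhdsWithin 0 (Set.Ioi 0)) (nhds (∑' k, (((0 : ℝ) ^ k : ℝ) : ℂ) * c k)) := by
    refine tendsto_tsum_of_dominated_convergence hs (fun k => ?_) ?_
    · have : Continuous fun a : ℝ => ((a ^ k : ℝ) : ℂ) * c k := by fun_prop
      exact this.continuousAt.mono_left nhdsWithin_le_nhds
    · filter_upwards [Ioo_mem_nhdsGT (by linarith : (0 : ℝ) < ε / 2)] with a ha k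
      simp only [norm_mul, Complex.norm_real, norm_pow, Real.norm_eq_abs]
      have h1 : |a| ≤ |ε / 2| := by
        rw [abs_of_pos ha.1, abs_of_pos (by linarith)]; exact ha.2.le
      gcongr
  rw [tsum_eq_single 0 (fun k hk => by simp [hk])] at hlim
  have hzero : Filter.Tendsto (fun a : ℝ => ∑' k, ((a ^ k : ℝ) : ℂ) * c k)
      (nhdsWithin 0 (Set.Ioi 0)) (nhds 0) := by
    refine tendsto_const_nhds.congr' ?_
    filter_upwards [Ioo_mem_nhdsGT hε] with a ha
    exact (h a ha.1 ha.2).tsum_eq.symm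
  simpa using tendsto_nhds_unique hlim hzero

/-- Once the coefficients below k vanish, the series may be divided by a^k, and c k becomes a
constant term. Only positive a enter, since the generating functions are used on an interval (0, ε).
-/
theorem eq_zero_of_hasSum_pow_mul_eq_zero {c : ℕ → ℂ} {ε : ℝ} (hε : 0 < ε)
    (h : ∀ a : ℝ, 0 < a → a < ε → HasSum (fun k => ((a ^ k : ℝ) : ℂ) * c k) 0) (k : ℕ) :
    c k = 0 := by
  induction k using Nat.strong_induction_on with
  | _ k ih =>
    have := eq_zero_of_hasSum_pow_mul_eq_zero_aux (c := fun j => c (j + k)) hε fun a h0 h1 => by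
      have h2 := (hasSum_nat_add_iff' k).mpr (h a h0 h1)
      rw [Finset.sum_eq_zero (fun i hi => by rw [ih i (Finset.mem_range.mp hi), mul_zero]),
        sub_zero] at h2
      have h3 := h2.mul_left ((a ^ k : ℝ) : ℂ)⁻¹
      rw [mul_zero] at h3
      refine h3.congr_fun fun j => ?_
      have : ((a ^ k : ℝ) : ℂ) ≠ 0 := by exact_mod_cast (pow_pos h0 k).ne'
      rw [pow_add, Complex.ofReal_mul]
      field_simp
    simpa using this

theorem eq_of_hasSum_pow_mul {c d : ℕ → ℂ} {F : ℝ → ℂ} {ε : ℝ} (hε : 0 < ε)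
    (hc : ∀ a : ℝ, 0 < a → a < ε → HasSum (fun k => ((a ^ k : ℝ) : ℂ) * c k) (F a))
    (hd : ∀ a : ℝ, 0 < a → a < ε → HasSum (fun k => ((a ^ k : ℝ) : ℂ) * d k) (F a)) (k : ℕ) :
    c k = d k := by
  refine sub_eq_zero.mp (eq_zero_of_hasSum_pow_mul_eq_zero (c := fun k => c k - d k) hε
    (fun a h0 h1 => ?_) k)
  simpa [mul_sub] using (hc a h0 h1).sub (hd a h0 h1)

/-- The coefficients of the product of a polynomial and an exponential. -/
theorem hasSum_coeff_polynomial_mul_exp (p : Polynomial ℝ) (s b : ℝ) :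
    HasSum (fun q => PowerSeries.coeff q
      ((p : PowerSeries ℝ) * PowerSeries.rescale s (PowerSeries.exp ℝ)) * b ^ q)
      (p.eval b * Real.exp (s * b)) := by
  induction p using Polynomial.induction_on' with
  | add p q hp hq =>
    simp only [Polynomial.coe_add, add_mul, map_add, Polynomial.eval_add]
    exact hp.add hq
  | monomial n a =>
    have h := (NormedSpace.expSeries_div_hasSum_exp (s * b)).mul_left (a * b ^ n)
    rw [← Real.exp_eq_exp_ℝ] at h
    rw [Polynomial.eval_monomial]
    rw [← hasSum_nat_add_iff' n, Finset.sum_eq_zero, sub_zero]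
    · refine h.congr_fun fun k => ?_
      rw [← Polynomial.C_mul_X_pow_eq_monomial, Polynomial.coe_mul, Polynomial.coe_C,
        Polynomial.coe_pow, Polynomial.coe_X, mul_assoc, PowerSeries.coeff_C_mul,
        mul_comm (PowerSeries.X ^ n), PowerSeries.coeff_mul_X_pow, PowerSeries.coeff_rescale,
        PowerSeries.coeff_exp]
      simp
      ring
    · intro k hk
      rw [← Polynomial.C_mul_X_pow_eq_monomial, Polynomial.coe_mul, Polynomial.coe_C,
        Polynomial.coe_pow, Polynomial.coe_X, mul_assoc, PowerSeries.coeff_C_mul,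
        mul_comm (PowerSeries.X ^ n), PowerSeries.coeff_mul_X_pow']
      simp [not_le.mpr (Finset.mem_range.mp hk)]

/-! ### A binomial identity and the product formula -/

section Binomial

variable {R : Type*} [CommRing R]

/-- The coefficient of `c ^ d` in `(1 + c) ^ M / (1 - y c)`. -/
def binomialTail (M d : ℕ) (y : R) : R :=
  ∑ p ∈ Finset.HasAntidiagonal.antidiagonal d, (M.choose p.1 : R) * y ^ p.2

theorem binomialTail_zero_right (M : ℕ) (y : R) : binomialTail M 0 y = 1 := by
  simp [binomialTail]

theorem binomialTail_self (M : ℕ) (y : R) : binomialTail M M y = (1 + y) ^ M := by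
  rw [add_pow, binomialTail, Finset.Nat.sum_antidiagonal_eq_sum_range_succ_mk]
  simp [mul_comm]

theorem binomialTail_succ (M d : ℕ) (y : R) :
    binomialTail (M + 1) (d + 1) y = binomialTail M (d + 1) y + binomialTail M d y := by
  simp only [binomialTail, Finset.Nat.sum_antidiagonal_succ, Nat.choose_succ_succ, Nat.cast_add,
    add_mul, Finset.sum_add_distrib, Nat.choose_zero_right]
  ring

/-- Both sides obey Pascal's rule F(m+1, α+1) = F(m+1, α) + F(m, α+1), so a double induction reduces
the identity to m = 0, where both sides are 1, and to α = 0, where it reads (1 + x + y + xy)^m =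
(1+x)^m (1+y)^m. -/
theorem sum_choose_mul_pow_eq_binomialTail (α m : ℕ) (x y : R) :
    binomialTail (m + α) m (x + y + x * y)
      = ∑ k ∈ Finset.range (m + 1), (-1) ^ k * ((α + k - 1).choose k : R) * x ^ k
          * (1 + x) ^ (m - k) * binomialTail (m + α) (m - k) y := by
  induction m generalizing α with
  | zero => simp [binomialTail_zero_right]
  | succ m ihm =>
    induction α with
    | zero =>
      -- At α = 0 the coefficient is binom(k-1, k), which is 0 for k ≥ 1; truncated subtraction
      -- gives 1 at k = 0.
      rw [Finset.sum_range_succ', Finset.sum_eq_zero (fun k _ => by simp)]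
      simp [binomialTail_self, ← mul_pow]
      ring
    | succ α ihα =>
      rw [show m + 1 + (α + 1) = (m + 1 + α) + 1 by ring, binomialTail_succ, ihα,
        show m + 1 + α = m + (α + 1) by ring, ihm (α + 1)]
      -- Pascal's rule for `binomialTail` splits every term except k = m + 1, whose tail has degree
      -- 0 and equals 1 on both sides.
      have hS : ∑ k ∈ Finset.range (m + 1 + 1), (-1) ^ k * ((α + 1 + k - 1).choose k : R) * x ^ k
            * (1 + x) ^ (m + 1 - k) * binomialTail (m + (α + 1) + 1) (m + 1 - k) y
          = ∑ k ∈ Finset.range (m + 1 + 1), (-1) ^ k * ((α + k).choose k : R) * x ^ k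
            * (1 + x) ^ (m + 1 - k) * binomialTail (m + (α + 1)) (m + 1 - k) y
          + ∑ k ∈ Finset.range (m + 1), (-1) ^ k * ((α + k).choose k : R) * x ^ k
            * (1 + x) ^ (m + 1 - k) * binomialTail (m + (α + 1)) (m - k) y := by
        have e : ∑ k ∈ Finset.range (m + 1), (-1) ^ k * ((α + 1 + k - 1).choose k : R) * x ^ k
              * (1 + x) ^ (m + 1 - k) * binomialTail (m + (α + 1) + 1) (m + 1 - k) y
            = ∑ k ∈ Finset.range (m + 1), (-1) ^ k * ((α + k).choose k : R) * x ^ k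
              * (1 + x) ^ (m + 1 - k) * binomialTail (m + (α + 1)) (m + 1 - k) y
            + ∑ k ∈ Finset.range (m + 1), (-1) ^ k * ((α + k).choose k : R) * x ^ k
              * (1 + x) ^ (m + 1 - k) * binomialTail (m + (α + 1)) (m - k) y := by
          rw [← Finset.sum_add_distrib]
          refine Finset.sum_congr rfl fun k hk => ?_
          have hk' : k ≤ m := Nat.lt_succ_iff.mp (Finset.mem_range.mp hk)
          rw [show m + 1 - k = m - k + 1 by omega, binomialTail_succ,
            show α + 1 + k - 1 = α + k by omega]
          ring
        rw [Finset.sum_range_succ _ (m + 1), Finset.sum_range_succ _ (m + 1), e, Nat.sub_self,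
          binomialTail_zero_right, binomialTail_zero_right,
          show α + 1 + (m + 1) - 1 = α + (m + 1) by omega]
        ring
      -- The remaining discrepancy cancels term by term: Pascal's rule for the coefficient at k + 1
      -- against the extra factor 1 + x in the term at k.
      have e : ∑ k ∈ Finset.range (m + 1), (-1) ^ (k + 1) * ((α + (k + 1)).choose (k + 1) : R)
            * x ^ (k + 1) * (1 + x) ^ (m + 1 - (k + 1))
            * binomialTail (m + (α + 1)) (m + 1 - (k + 1)) y
          + ∑ k ∈ Finset.range (m + 1), (-1) ^ k * ((α + k).choose k : R) * x ^ k
            * (1 + x) ^ (m + 1 - k) * binomialTail (m + (α + 1)) (m - k) y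
          = ∑ k ∈ Finset.range (m + 1), (-1) ^ (k + 1) * ((α + (k + 1) - 1).choose (k + 1) : R)
            * x ^ (k + 1) * (1 + x) ^ (m + 1 - (k + 1))
            * binomialTail (m + (α + 1)) (m + 1 - (k + 1)) y
          + ∑ k ∈ Finset.range (m + 1), (-1) ^ k * ((α + 1 + k - 1).choose k : R) * x ^ k
            * (1 + x) ^ (m - k) * binomialTail (m + (α + 1)) (m - k) y := by
        rw [← Finset.sum_add_distrib, ← Finset.sum_add_distrib]
        refine Finset.sum_congr rfl fun k hk => ?_
        have hk' : k ≤ m := Nat.lt_succ_iff.mp (Finset.mem_range.mp hk)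
        rw [show m + 1 - (k + 1) = m - k by omega, show m + 1 - k = m - k + 1 by omega,
          show α + (k + 1) = α + k + 1 by ring, Nat.choose_succ_succ,
          show α + k + 1 - 1 = α + k by omega, show α + 1 + k - 1 = α + k by omega]
        push_cast
        ring
      rw [hS, Finset.sum_range_succ' _ (m + 1), Finset.sum_range_succ' _ (m + 1)]
      simp only [Nat.choose_zero_right]
      linear_combination -e

end Binomial

/-! ### The linear functional `X ^ p ↦ s ^ p / p!` -/

open Polynomial in
/-- The linear functional `X ^ p ↦ s ^ p / p!` on polynomials. -/
noncomputable def divFactorial (A : Type*) [CommRing A] [Algebra ℝ A] (s : ℝ) : A[X] →ₗ[A] A :=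
  Polynomial.lsum fun p => algebraMap ℝ A (s ^ p / p.factorial) • LinearMap.id

theorem divFactorial_C_mul_X_pow {A : Type*} [CommRing A] [Algebra ℝ A] (s : ℝ) (a : A) (p : ℕ) :
    divFactorial A s (Polynomial.C a * Polynomial.X ^ p)
      = algebraMap ℝ A (s ^ p / p.factorial) * a := by
  rw [Polynomial.C_mul_X_pow_eq_monomial]
  simp [divFactorial, Algebra.smul_def]

open Polynomial in
/-- The linear functional `x ^ p y ^ q ↦ s ^ (p + q) / (p! q!)`. -/
noncomputable def divFactorial₂ (s : ℝ) : ℝ[X][X] →ₗ[ℝ] ℝ :=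
  divFactorial ℝ s ∘ₗ (divFactorial ℝ[X] s).restrictScalars ℝ

open Polynomial in
-- The functional is the tensor product of its one-variable versions: x is the inner variable `C X`,
-- y the outer variable `X`.
theorem divFactorial₂_C_mul_map (s : ℝ) (p q : ℝ[X]) :
    divFactorial₂ s (C p * q.map C) = divFactorial ℝ s p * divFactorial ℝ s q := by
  induction q using Polynomial.induction_on' with
  | add q r hq hr => simp only [Polynomial.map_add, mul_add, map_add, hq, hr]
  | monomial n a =>
    rw [← C_mul_X_pow_eq_monomial, Polynomial.map_mul, Polynomial.map_pow, map_X, map_C,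
      ← mul_assoc, ← C_mul, divFactorial₂, LinearMap.comp_apply, LinearMap.restrictScalars_apply,
      divFactorial_C_mul_X_pow, divFactorial_C_mul_X_pow, Polynomial.algebraMap_apply,
      Algebra.algebraMap_self_apply, mul_comm p, ← mul_assoc, ← C_mul, ← smul_eq_C_mul,
      map_smul, smul_eq_mul]
    ring

open Polynomial in
-- The x-factor in each term of the binomial identity yields the first Laguerre polynomial of the
-- product formula.
theorem divFactorial_eval_laguerre (m k : ℕ) (hk : k ≤ m) (s : ℝ) :
    divFactorial ℝ (-s) (X ^ k * (1 + X) ^ (m - k))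
      = (-1) ^ k * ((m - k).factorial / m.factorial : ℝ) * s ^ k * laguerre (m - k) k s := by
  rw [add_comm, add_pow, Finset.mul_sum, map_sum, laguerre_eq_sum, Finset.mul_sum]
  refine Finset.sum_congr rfl fun i hi => ?_
  have hi' : i ≤ m - k := Nat.lt_succ_iff.mp (Finset.mem_range.mp hi)
  rw [show X ^ k * (X ^ i * 1 ^ (m - k - i) * ((m - k).choose i : ℝ[X]))
    = C ((m - k).choose i : ℝ) * X ^ (k + i) by simp [pow_add]; ring, divFactorial_C_mul_X_pow,
    laguerreCoeff, Nat.cast_choose ℝ hi', Nat.cast_choose ℝ (by omega : k + i ≤ m - k + k),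
    show m - k + k - (k + i) = m - k - i by omega, show m - k + k = m by omega]
  simp only [Algebra.algebraMap_self_apply, neg_pow s, pow_add]
  have h1 : (i.factorial : ℝ) ≠ 0 := by positivity
  have h2 : (m.factorial : ℝ) ≠ 0 := by positivity
  have h3 : ((m - k).factorial : ℝ) ≠ 0 := by positivity
  have h4 : ((m - k - i).factorial : ℝ) ≠ 0 := by positivity
  have h5 : ((k + i).factorial : ℝ) ≠ 0 := by positivity
  field_simp

open Polynomial in
-- The y-factor yields the second Laguerre polynomial.
theorem divFactorial_binomialTail (α m k : ℕ) (hk : k ≤ m) (s : ℝ) :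
    divFactorial ℝ (-s) (binomialTail (m + α) (m - k) X) = laguerre (m - k) (α + k) s := by
  rw [binomialTail, Finset.Nat.sum_antidiagonal_eq_sum_range_succ_mk,
    ← Finset.sum_range_reflect, map_sum, laguerre_eq_sum]
  refine Finset.sum_congr rfl fun i hi => ?_
  have hi' : i ≤ m - k := Nat.lt_succ_iff.mp (Finset.mem_range.mp hi)
  simp only
  rw [show m - k - (m - k + 1 - 1 - i) = i by omega, ← C_eq_natCast, divFactorial_C_mul_X_pow,
    laguerreCoeff, ← choose_add_sub_eq _ hi', show m - k + 1 - 1 - i = m - k - i by omega,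
    show m - k + (α + k) = m + α by omega, Algebra.algebraMap_self_apply, neg_pow s]
  ring

/-- Vandermonde's convolution: comparing coefficients of s^l, the products binom(i, j) binom(i,
i+l-j) sum over j to binom(2i, i+l). -/
theorem laguerre_diagonal_eq_sum (i : ℕ) (s : ℝ) :
    laguerre i i s = ∑ j ∈ Finset.range (i + 1), (i.choose j : ℝ) * laguerre j (i - j) s := by
  have h : ∀ j ∈ Finset.range (i + 1), (i.choose j : ℝ) * laguerre j (i - j) s
      = ∑ l ∈ Finset.range (i + 1),
        ((i.choose j * i.choose (i + l - j) : ℕ) : ℝ) * ((-1) ^ l / l.factorial * s ^ l) := by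
    intro j hj
    have hj' : j ≤ i := Nat.lt_succ_iff.mp (Finset.mem_range.mp hj)
    rw [laguerre_eq_sum, Finset.mul_sum]
    refine (Finset.sum_subset (Finset.range_mono (by omega)) fun l _ hl => ?_).trans
      (Finset.sum_congr rfl fun l _ => ?_)
    · rw [laguerreCoeff_eq_zero (by simpa using hl)]; simp
    · rw [laguerreCoeff, show j + (i - j) = i by omega, show i - j + l = i + l - j by omega]
      push_cast
      ring
  rw [Finset.sum_congr rfl h, Finset.sum_comm, laguerre_eq_sum]
  refine Finset.sum_congr rfl fun l hl => ?_
  rw [← Finset.sum_mul, ← Nat.cast_sum, laguerreCoeff, Nat.add_choose_eq,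
    Finset.Nat.sum_antidiagonal_eq_sum_range_succ_mk]
  rw [← Finset.sum_subset (Finset.range_mono (by omega : i + 1 ≤ i + l + 1)) fun j _ hj => by
    simp [Nat.choose_eq_zero_of_lt (by simpa using hj : i < j)]]
  ring

open Polynomial in
-- Writing x + y + xy = x(1+y) + y and expanding binomially separates the variables; the resulting
-- sum collapses by `laguerre_diagonal_eq_sum`.
theorem divFactorial₂_pow (i : ℕ) (s : ℝ) :
    divFactorial₂ (-s) ((C X + X + C X * X) ^ i) = (-s) ^ i / i.factorial * laguerre i i s := by
  have h : ∀ j ∈ Finset.range (i + 1), divFactorial₂ (-s)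
      ((C X * (1 + X)) ^ j * X ^ (i - j) * (i.choose j : ℝ[X][X]))
      = (-s) ^ i / i.factorial * ((i.choose j : ℝ) * laguerre j (i - j) s) := by
    intro j hj
    have hj' : j ≤ i := Nat.lt_succ_iff.mp (Finset.mem_range.mp hj)
    have e : (C X * (1 + X)) ^ j * X ^ (i - j) * (i.choose j : ℝ[X][X])
        = C (C (i.choose j : ℝ) * X ^ j)
          * (X ^ (i - j) * (1 + X) ^ (i - (i - j)) : ℝ[X]).map C := by
      rw [Nat.sub_sub_self hj', Polynomial.map_mul, Polynomial.map_pow, Polynomial.map_pow,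
        Polynomial.map_add, map_X, Polynomial.map_one, C_mul, C_pow, mul_pow]
      simp only [map_natCast]
      ring
    rw [e, divFactorial₂_C_mul_map, divFactorial_C_mul_X_pow,
      divFactorial_eval_laguerre _ _ (Nat.sub_le i j), Nat.sub_sub_self hj',
      Algebra.algebraMap_self_apply]
    have h1 : (j.factorial : ℝ) ≠ 0 := by positivity
    have h2 : (i.factorial : ℝ) ≠ 0 := by positivity
    rw [← pow_mul_pow_sub (-s) hj', neg_pow s (i - j)]
    field_simp
  rw [show (C X + X + C X * X : ℝ[X][X]) = C X * (1 + X) + X by ring, add_pow, map_sum,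
    Finset.sum_congr rfl h, ← Finset.mul_sum, ← laguerre_diagonal_eq_sum]

theorem pochhammer_natCast (α k : ℕ) :
    pochhammer α k = (k.factorial : ℝ) * ((α + k - 1).choose k : ℝ) := by
  induction k with
  | zero => simp [pochhammer]
  | succ k ih =>
    rw [pochhammer, Finset.prod_range_succ, ← pochhammer, ih]
    rcases Nat.eq_zero_or_pos (α + k) with h | h
    · obtain ⟨rfl, rfl⟩ : α = 0 ∧ k = 0 := by omega
      simp
    · have h1 := Nat.add_one_mul_choose_eq (α + k - 1) k
      rw [Nat.sub_add_cancel h] at h1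
      rw [show α + (k + 1) - 1 = α + k by omega, Nat.factorial_succ]
      have h2 := congrArg (Nat.cast : ℕ → ℝ) h1
      push_cast at h2 ⊢
      linear_combination (k.factorial : ℝ) * h2

open Polynomial in
/-- The product formula for Laguerre polynomials behind the spectral expression of the Berezin
transform. -/
theorem sum_choose_mul_laguerre_diagonal (α m : ℕ) (s : ℝ) :
    (m.factorial : ℝ) * ∑ i ∈ Finset.range (m + 1),
        ((m + α).choose (m - i) : ℝ) * ((-s) ^ i / i.factorial * laguerre i i s)
      = ∑ k ∈ Finset.range (m + 1), pochhammer α k * ((m - k).factorial : ℝ) / (k.factorial : ℝ)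
          * s ^ k * laguerre (m - k) k s * laguerre (m - k) (α + k) s := by
  -- The functional is applied to the binomial identity with x = `C X` and y = `X`; the left side
  -- becomes the diagonal sum, the right side splits into products.
  have h := congrArg (divFactorial₂ (-s))
    (sum_choose_mul_pow_eq_binomialTail α m (C X : ℝ[X][X]) X)
  have hl : divFactorial₂ (-s) (binomialTail (m + α) m (C X + X + C X * X))
      = ∑ i ∈ Finset.range (m + 1),
        ((m + α).choose (m - i) : ℝ) * ((-s) ^ i / i.factorial * laguerre i i s) := by
    rw [binomialTail, Finset.Nat.sum_antidiagonal_eq_sum_range_succ_mk, ← Finset.sum_range_reflect,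
      map_sum]
    refine Finset.sum_congr rfl fun i hi => ?_
    have hi' : i ≤ m := Nat.lt_succ_iff.mp (Finset.mem_range.mp hi)
    simp only
    rw [show m - (m + 1 - 1 - i) = i by omega, show m + 1 - 1 - i = m - i by omega,
      ← nsmul_eq_mul, map_nsmul, divFactorial₂_pow, nsmul_eq_mul]
  rw [hl, map_sum] at h
  rw [h, Finset.mul_sum]
  refine Finset.sum_congr rfl fun k hk => ?_
  have hk' : k ≤ m := Nat.lt_succ_iff.mp (Finset.mem_range.mp hk)
  have e : (-1) ^ k * ((α + k - 1).choose k : ℝ[X][X]) * C X ^ k * (1 + C X) ^ (m - k)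
        * binomialTail (m + α) (m - k) X
      = ((-1) ^ k * ((α + k - 1).choose k : ℝ)) • (C (X ^ k * (1 + X) ^ (m - k))
        * (binomialTail (m + α) (m - k) (X : ℝ[X])).map C) := by
    have : (binomialTail (m + α) (m - k) (X : ℝ[X])).map C
        = (binomialTail (m + α) (m - k) X : ℝ[X][X]) := by
      simp [binomialTail, Polynomial.map_sum]
    rw [this, Algebra.smul_def]
    simp
    ring
  rw [e, map_smul, divFactorial₂_C_mul_map, divFactorial_eval_laguerre _ _ hk',
    divFactorial_binomialTail _ _ _ hk', pochhammer_natCast, smul_eq_mul]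
  have h1 : (k.factorial : ℝ) ≠ 0 := by positivity
  have h2 : (m.factorial : ℝ) ≠ 0 := by positivity
  have h3 : ((-1 : ℝ) ^ k) * (-1) ^ k = 1 := by rw [← mul_pow]; simp
  field_simp
  linear_combination (((α + k - 1).choose k : ℝ) * s ^ k *
    laguerre (m - k) k s * laguerre (m - k) (α + k) s) * h3

/-- This is where the diagonal polynomials L_i^{(i)} enter the Fourier transform of the squared
Laguerre function. -/
theorem coeff_one_sub_pow_mul_exp (i : ℕ) (s : ℝ) :
    PowerSeries.coeff i ((((1 - Polynomial.X) ^ (2 * i) : Polynomial ℝ) : PowerSeries ℝ)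
      * PowerSeries.rescale s (PowerSeries.exp ℝ)) = (-1) ^ i * laguerre i i s := by
  rw [PowerSeries.coeff_mul, Finset.Nat.sum_antidiagonal_eq_sum_range_succ_mk,
    ← Finset.sum_range_reflect, laguerre_eq_sum, Finset.mul_sum]
  refine Finset.sum_congr rfl fun l hl => ?_
  have hl' : l ≤ i := Nat.lt_succ_iff.mp (Finset.mem_range.mp hl)
  have hc : ((1 - Polynomial.X) ^ (2 * i) : Polynomial ℝ).coeff (i - l)
      = (-1) ^ (i - l) * ((2 * i).choose (i - l) : ℝ) := by
    rw [← neg_sub, (even_two_mul i).neg_pow, sub_eq_add_neg, ← Polynomial.C_1,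
      ← Polynomial.C_neg, Polynomial.coeff_X_add_C_pow,
      show 2 * i - (i - l) = i - l + 2 * l by omega, pow_add, (even_two_mul l).neg_one_pow, mul_one]
  simp only
  rw [show i + 1 - 1 - l = i - l by omega, show i - (i - l) = l by omega, Polynomial.coeff_coe, hc,
    PowerSeries.coeff_rescale, PowerSeries.coeff_exp, laguerreCoeff, ← choose_add_sub_eq _ hl',
    ← two_mul, ← pow_mul_pow_sub (-1 : ℝ) hl']
  have h3 : ((-1 : ℝ) ^ l) * (-1) ^ l = 1 := by rw [← mul_pow]; simp
  simp only [one_div, map_inv₀, map_natCast]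
  linear_combination (-(-1 : ℝ) ^ (i - l) * ((2 * i).choose (i - l)) * s ^ l
    * (l.factorial : ℝ)⁻¹) * h3

/-! ### Integrals against Laguerre polynomials -/

theorem continuous_laguerre (k α : ℕ) : Continuous (laguerre k α) := by
  simp_rw [← funext (eval_laguerrePoly k α)]
  exact (laguerrePoly k α).continuous

/-- Integrated form of the generating function of the Laguerre polynomials. -/
theorem hasSum_integral_laguerre {X : Type*} [MeasurableSpace X] {μ : Measure X} (α : ℕ)
    {r : X → ℝ} (hr : ∀ x, 0 ≤ r x) (hrm : Measurable r) {f : X → ℂ}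
    (hf : AEStronglyMeasurable f μ) {a : ℝ} (ha0 : 0 ≤ a) (ha1 : a < 1)
    (hint : Integrable (fun x => ((Real.exp (a / (1 - a) * r x) : ℝ) : ℂ) * f x) μ) :
    HasSum (fun p => ((a ^ p : ℝ) : ℂ) * ∫ x, (laguerre p α (r x) : ℂ) * f x ∂μ)
      ((((1 - a) ^ (α + 1))⁻¹ : ℝ) *
        ∫ x, ((Real.exp (-(a / (1 - a)) * r x) : ℝ) : ℂ) * f x ∂μ) := by
  have hab : |a| < 1 := by rwa [abs_of_nonneg ha0]
  have hlag : ∀ p, Measurable fun x => laguerre p α (r x) := fun p =>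
    (continuous_laguerre p α).measurable.comp hrm
  have key := hasSum_integral_of_dominated_convergence (μ := μ)
    (F := fun p x => ((a ^ p * laguerre p α (r x) : ℝ) : ℂ) * f x)
    (f := fun x => (((((1 - a) ^ (α + 1))⁻¹ * Real.exp (-(a / (1 - a)) * r x) : ℝ)) : ℂ) * f x)
    (fun p x => a ^ p * laguerre p α (-r x) * ‖f x‖)
    (fun p => (Complex.measurable_ofReal.comp
      ((hlag p).const_mul _)).aestronglyMeasurable.mul hf)
    (fun p => Filter.Eventually.of_forall fun x => by
      rw [norm_mul, Complex.norm_real, norm_mul, Real.norm_eq_abs, Real.norm_eq_abs,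
        abs_of_nonneg (pow_nonneg ha0 p)]
      have := abs_laguerre_le p α (hr x)
      gcongr)
    (Filter.Eventually.of_forall fun x =>
      ((hasSum_laguerre α (-r x) hab).mul_right ‖f x‖).summable)
    (by
      -- The majorants sum to the generating function at -r, whose growing exponential is exactly
      -- what `hint` assumes integrable.
      have : (fun x => ∑' p, a ^ p * laguerre p α (-r x) * ‖f x‖)
          = fun x => ((1 - a) ^ (α + 1))⁻¹ * ‖((Real.exp (a / (1 - a) * r x) : ℝ) : ℂ) * f x‖ := by
        funext x
        rw [((hasSum_laguerre α (-r x) hab).mul_right ‖f x‖).tsum_eq, norm_mul, Complex.norm_real,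
          Real.norm_eq_abs, abs_of_pos (Real.exp_pos _), neg_mul_neg, mul_assoc]
      rw [this]
      exact hint.norm.const_mul _)
    (Filter.Eventually.of_forall fun x => by
      have := (Complex.hasSum_ofReal.mpr (hasSum_laguerre α (r x) hab)).mul_right (f x)
      exact this)
  have e1 : ∀ p, ∫ x, ((a ^ p * laguerre p α (r x) : ℝ) : ℂ) * f x ∂μ
      = ((a ^ p : ℝ) : ℂ) * ∫ x, (laguerre p α (r x) : ℂ) * f x ∂μ := by
    intro p
    rw [← integral_const_mul]
    simp only [Complex.ofReal_mul, mul_assoc]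
  have e2 : ∫ x, (((((1 - a) ^ (α + 1))⁻¹ * Real.exp (-(a / (1 - a)) * r x) : ℝ)) : ℂ) * f x ∂μ
      = (((1 - a) ^ (α + 1))⁻¹ : ℝ) *
        ∫ x, ((Real.exp (-(a / (1 - a)) * r x) : ℝ) : ℂ) * f x ∂μ := by
    rw [← integral_const_mul]
    simp only [Complex.ofReal_mul, mul_assoc]
  rw [e2] at key
  simpa only [e1] using key

/-! ### Gaussian integrals on `ℂⁿ` -/

section Gaussian

variable {n : ℕ}

theorem finrank_real_Cn : Module.finrank ℝ (Cn n) = 2 * n := by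
  rw [finrank_real_of_complex, finrank_euclideanSpace_fin]

theorem integrable_exp_neg_mul_sq_norm {c : ℝ} (hc : 0 < c) :
    Integrable (fun x : Cn n => Real.exp (-c * ‖x‖ ^ 2)) := by
  have h := GaussianFourier.integrable_cexp_neg_mul_sq_norm_add (V := Cn n) (b := (c : ℂ))
    (by simpa using hc) 0 0
  refine h.norm.congr (Filter.Eventually.of_forall fun x => ?_)
  simp [Complex.norm_exp, ← Complex.ofReal_pow]

theorem integrable_of_norm_le_exp_neg {F : Type*} [NormedAddCommGroup F] {f : Cn n → F}
    (hf : AEStronglyMeasurable f volume)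
    {C c : ℝ} (hc : 0 < c) (h : ∀ x, ‖f x‖ ≤ C * Real.exp (-c * ‖x‖ ^ 2)) : Integrable f :=
  ((integrable_exp_neg_mul_sq_norm hc).const_mul C).mono' hf (Filter.Eventually.of_forall h)

/-- The character `x ↦ e^{-2πi (x | ξ)}`. -/
noncomputable def fourierKernel (ξ x : Cn n) : ℂ :=
  Complex.exp (((-2 * Real.pi * inner ℝ x ξ : ℝ) : ℂ) * Complex.I)

theorem norm_fourierKernel (ξ x : Cn n) : ‖fourierKernel ξ x‖ = 1 :=
  Complex.norm_exp_ofReal_mul_I _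

theorem continuous_fourierKernel (ξ : Cn n) : Continuous (fourierKernel ξ) := by
  unfold fourierKernel
  fun_prop

theorem fourier_eq_integral_fourierKernel (f : Cn n → ℂ) (ξ : Cn n) :
    𝓕 f ξ = ∫ x, f x * fourierKernel ξ x := by
  rw [Real.fourier_eq']
  refine integral_congr_ae (Filter.Eventually.of_forall fun x => ?_)
  simp only [fourierKernel, smul_eq_mul]
  rw [mul_comm]

theorem integral_gaussian_mul_fourierKernel {c : ℝ} (hc : 0 < c) (ξ : Cn n) :
    ∫ x, ((Real.exp (-c * ‖x‖ ^ 2) : ℝ) : ℂ) * fourierKernel ξ x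
      = (((Real.pi / c) ^ n * Real.exp (-(Real.pi ^ 2 * ‖ξ‖ ^ 2) / c) : ℝ) : ℂ) := by
  rw [← fourier_eq_integral_fourierKernel]
  have h := fourier_gaussian_innerProductSpace (V := Cn n) (b := (c : ℂ)) (by simpa using hc) ξ
  rw [finrank_real_Cn] at h
  push_cast at h ⊢
  rw [h, mul_div_cancel_left₀ _ (two_ne_zero), Complex.cpow_natCast]
  congr 3
  ring

theorem integrable_polynomial_mul_exp_mul_fourierKernel (p : Polynomial ℝ) {c : ℝ} (hc : 0 < c)
    (ξ : Cn n) :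
    Integrable fun x => ((p.eval (‖x‖ ^ 2) * Real.exp (-c * ‖x‖ ^ 2) : ℝ) : ℂ)
      * fourierKernel ξ x := by
  obtain ⟨C, hC, h⟩ := p.exists_abs_eval_le_exp (half_pos hc)
  have hk := continuous_fourierKernel ξ
  refine integrable_of_norm_le_exp_neg (C := C) (c := c / 2) (by fun_prop) (half_pos hc)
    fun x => ?_
  rw [norm_mul, norm_fourierKernel, mul_one, Complex.norm_real, norm_mul, Real.norm_eq_abs,
    Real.norm_eq_abs, abs_of_pos (Real.exp_pos _)]
  refine (mul_le_mul_of_nonneg_right (h _ (by positivity)) (Real.exp_pos _).le).trans ?_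
  rw [mul_assoc, ← Real.exp_add]
  apply le_of_eq
  congr 2
  ring

end Gaussian

/-! ### Fourier transform of the squared Laguerre function -/

section Transform

variable {n : ℕ}

theorem integrable_exp_mul_laguerre_mul_exp (m α : ℕ) (ξ : Cn n) {a c : ℝ} (hac : a < c) :
    Integrable fun x : Cn n => ((Real.exp (a * ‖x‖ ^ 2) : ℝ) : ℂ) *
      (((laguerre m α (‖x‖ ^ 2) * Real.exp (-c * ‖x‖ ^ 2) : ℝ) : ℂ) * fourierKernel ξ x) := by
  refine (integrable_polynomial_mul_exp_mul_fourierKernel (laguerrePoly m α)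
    (sub_pos.mpr hac) ξ).congr (Filter.Eventually.of_forall fun x => ?_)
  simp only [eval_laguerrePoly]
  rw [← mul_assoc, ← Complex.ofReal_mul, mul_left_comm, ← Real.exp_add]
  congr 5
  ring

/-- Multiplying by a^m and summing turns the left side into a Gaussian transform with parameter
a/(1-a) + 1/(1-b) = (1-ab)/((1-a)(1-b)). The result is the Laguerre generating function in the
variable ab, and coefficients of a^m are compared. -/
theorem integral_laguerre_mul_exp_mul_fourierKernel (α m : ℕ) (ξ : Cn (α + 1)) {b : ℝ}
    (hb0 : 0 < b) (hb1 : b < 1 / 4) :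
    ∫ x, (laguerre m α (‖x‖ ^ 2) : ℂ) *
        (((Real.exp (-(1 / (1 - b)) * ‖x‖ ^ 2) : ℝ) : ℂ) * fourierKernel ξ x)
      = ((Real.pi ^ (α + 1) * (1 - b) ^ (α + 1) *
          Real.exp (-(Real.pi ^ 2 * ‖ξ‖ ^ 2) * (1 - b)) *
          (b ^ m * laguerre m α (-(Real.pi ^ 2 * ‖ξ‖ ^ 2) * (1 - b) ^ 2 / b)) : ℝ) : ℂ) := by
  set S := Real.pi ^ 2 * ‖ξ‖ ^ 2 with hS
  have hb : 0 < 1 - b := by linarith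
  have hbi : 1 ≤ 1 / (1 - b) := by rw [le_div_iff₀ hb]; linarith
  refine eq_of_hasSum_pow_mul (ε := 1 / 4) (by norm_num)
    (c := fun m => ∫ x, (laguerre m α (‖x‖ ^ 2) : ℂ) *
        (((Real.exp (-(1 / (1 - b)) * ‖x‖ ^ 2) : ℝ) : ℂ) * fourierKernel ξ x))
    (d := fun m => ((Real.pi ^ (α + 1) * (1 - b) ^ (α + 1) * Real.exp (-S * (1 - b)) *
          (b ^ m * laguerre m α (-S * (1 - b) ^ 2 / b)) : ℝ) : ℂ))
    (F := fun a => ((Real.pi ^ (α + 1) * (1 - b) ^ (α + 1) * Real.exp (-S * (1 - b)) *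
      (((1 - a * b) ^ (α + 1))⁻¹ * Real.exp (-(a * b / (1 - a * b)) * (-S * (1 - b) ^ 2 / b))) : ℝ)
        : ℂ)) (fun a ha0 ha1 => ?_) (fun a ha0 ha1 => ?_) m
  · have ha : 0 < 1 - a := by linarith
    -- The bound 1/4 on a keeps the growing majorant e^{a/(1-a)|x|²} below the decay
    -- e^{-|x|²/(1-b)}.
    have hai : a / (1 - a) < 1 := by rw [div_lt_iff₀ ha]; linarith
    have hint := integrable_exp_mul_laguerre_mul_exp 0 α ξ
      (show a / (1 - a) < 1 / (1 - b) by linarith)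
    have h := hasSum_integral_laguerre (μ := volume) α (r := fun x : Cn (α + 1) => ‖x‖ ^ 2)
      (fun x => by positivity) (by fun_prop)
      (f := fun x => ((Real.exp (-(1 / (1 - b)) * ‖x‖ ^ 2) : ℝ) : ℂ) * fourierKernel ξ x)
      (by have := continuous_fourierKernel ξ; fun_prop)
      ha0.le (by linarith) (by simpa [laguerre] using hint)
    have hab : 0 < 1 - a * b := by nlinarith
    have hlam : 0 < a / (1 - a) + 1 / (1 - b) := by positivity
    have e : ∀ x : Cn (α + 1), ((Real.exp (-(a / (1 - a)) * ‖x‖ ^ 2) : ℝ) : ℂ) *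
        (((Real.exp (-(1 / (1 - b)) * ‖x‖ ^ 2) : ℝ) : ℂ) * fourierKernel ξ x)
        = ((Real.exp (-(a / (1 - a) + 1 / (1 - b)) * ‖x‖ ^ 2) : ℝ) : ℂ) * fourierKernel ξ x := by
      intro x
      rw [← mul_assoc, ← Complex.ofReal_mul, ← Real.exp_add]
      congr 4
      ring
    simp only [e] at h
    rw [integral_gaussian_mul_fourierKernel hlam, ← hS, ← Complex.ofReal_mul] at h
    convert h using 2
    have hl : a / (1 - a) + 1 / (1 - b) = (1 - a * b) / ((1 - a) * (1 - b)) := by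
      field_simp
      ring
    rw [hl, show -S / ((1 - a * b) / ((1 - a) * (1 - b)))
      = -S * (1 - b) + -(a * b / (1 - a * b)) * (-S * (1 - b) ^ 2 / b) by
        field_simp
        ring, Real.exp_add, div_pow, div_pow, mul_pow]
    field_simp
  · have hab : |a * b| < 1 := by
      rw [abs_of_nonneg (by positivity)]
      nlinarith
    have h := Complex.hasSum_ofReal.mpr ((hasSum_laguerre α (-S * (1 - b) ^ 2 / b) hab).mul_left
      (Real.pi ^ (α + 1) * (1 - b) ^ (α + 1) * Real.exp (-S * (1 - b))))
    refine h.congr_fun fun k => ?_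
    push_cast
    ring

/-- The polynomial `b ↦ b ^ m L_m (-S (1 - b) ^ 2 / b)`. -/
noncomputable def reversedLaguerre (α m : ℕ) (S : ℝ) : Polynomial ℝ :=
  ∑ i ∈ Finset.range (m + 1), Polynomial.C (((m + α).choose (m - i) : ℝ) * S ^ i / i.factorial)
    * ((1 - Polynomial.X) ^ (2 * i) * Polynomial.X ^ (m - i))

theorem eval_reversedLaguerre (α m : ℕ) (S : ℝ) {b : ℝ} (hb : b ≠ 0) :
    (reversedLaguerre α m S).eval b = b ^ m * laguerre m α (-S * (1 - b) ^ 2 / b) := by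
  rw [reversedLaguerre, Polynomial.eval_finsetSum, laguerre, Finset.mul_sum]
  refine Finset.sum_congr rfl fun i hi => ?_
  have hi' : i ≤ m := Nat.lt_succ_iff.mp (Finset.mem_range.mp hi)
  have h3 : ((-1 : ℝ) ^ i) * (-1) ^ i = 1 := by rw [← mul_pow]; simp
  simp only [Polynomial.eval_mul, Polynomial.eval_pow, Polynomial.eval_sub, Polynomial.eval_one,
    Polynomial.eval_X, Polynomial.eval_C]
  rw [div_pow, mul_pow, neg_pow S, pow_mul, ← pow_mul_pow_sub b hi']
  have : b ^ i ≠ 0 := pow_ne_zero _ hb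
  field_simp
  linear_combination (-((m + α).choose (m - i) : ℝ) * S ^ i * ((1 - b) ^ 2) ^ i) * h3

theorem coeff_reversedLaguerre_mul_exp (α m : ℕ) (S : ℝ) :
    PowerSeries.coeff m ((reversedLaguerre α m S : PowerSeries ℝ)
      * PowerSeries.rescale S (PowerSeries.exp ℝ))
    = ∑ i ∈ Finset.range (m + 1),
        ((m + α).choose (m - i) : ℝ) * ((-S) ^ i / i.factorial * laguerre i i S) := by
  rw [reversedLaguerre, ← Polynomial.coeToPowerSeries.ringHom_apply, map_sum, Finset.sum_mul,
    map_sum]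
  refine Finset.sum_congr rfl fun i hi => ?_
  have hi' : i ≤ m := Nat.lt_succ_iff.mp (Finset.mem_range.mp hi)
  rw [Polynomial.coeToPowerSeries.ringHom_apply, Polynomial.coe_mul, Polynomial.coe_C,
    Polynomial.coe_mul, Polynomial.coe_pow (φ := Polynomial.X), Polynomial.coe_X, mul_assoc,
    PowerSeries.coeff_C_mul, mul_right_comm, PowerSeries.coeff_mul_X_pow', if_pos (Nat.sub_le m i),
    Nat.sub_sub_self hi', coeff_one_sub_pow_mul_exp, neg_pow S]
  ring

/-- The Fourier transform of the square of a Laguerre function. -/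
theorem integral_laguerre_sq_mul_fourierKernel (α m : ℕ) (ξ : Cn (α + 1)) :
    ∫ x, ((Real.exp (-‖x‖ ^ 2) * laguerre m α (‖x‖ ^ 2) ^ 2 : ℝ) : ℂ) * fourierKernel ξ x
      = ((Real.pi ^ (α + 1) * Real.exp (-(Real.pi ^ 2 * ‖ξ‖ ^ 2)) *
        ∑ i ∈ Finset.range (m + 1), ((m + α).choose (m - i) : ℝ) *
          ((-(Real.pi ^ 2 * ‖ξ‖ ^ 2)) ^ i / i.factorial *
            laguerre i i (Real.pi ^ 2 * ‖ξ‖ ^ 2)) : ℝ) : ℂ) := by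
  set S := Real.pi ^ 2 * ‖ξ‖ ^ 2 with hS
  rw [← coeff_reversedLaguerre_mul_exp]
  -- One of the two factors L_m is replaced by L_q and summed against b^q. The sum is a multiple of
  -- e^{Sb} times the polynomial `reversedLaguerre` in b, and the coefficient at q = m is the wanted
  -- integral.
  have key := eq_of_hasSum_pow_mul (ε := 1 / 4) (by norm_num)
    (c := fun q => ∫ x, (laguerre q α (‖x‖ ^ 2) : ℂ) *
        (((laguerre m α (‖x‖ ^ 2) * Real.exp (-1 * ‖x‖ ^ 2) : ℝ) : ℂ) * fourierKernel ξ x))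
    (d := fun q => ((Real.pi ^ (α + 1) * Real.exp (-S) *
      PowerSeries.coeff q ((reversedLaguerre α m S : PowerSeries ℝ)
      * PowerSeries.rescale S (PowerSeries.exp ℝ)) : ℝ) : ℂ))
    (F := fun b => ((Real.pi ^ (α + 1) * Real.exp (-S) *
      ((reversedLaguerre α m S).eval b * Real.exp (S * b)) : ℝ) : ℂ))
    (fun b hb0 hb1 => ?_) (fun b hb0 hb1 => ?_) m
  · rw [← key]
    refine integral_congr_ae (Filter.Eventually.of_forall fun x => ?_)
    simp only
    push_cast
    rw [neg_one_mul]
    ring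
  · have hb : 0 < 1 - b := by linarith
    have hbi : b / (1 - b) < 1 := by rw [div_lt_iff₀ hb]; linarith
    have h := hasSum_integral_laguerre (μ := volume) α (r := fun x : Cn (α + 1) => ‖x‖ ^ 2)
      (fun x => by positivity) (by fun_prop)
      (f := fun x => ((laguerre m α (‖x‖ ^ 2) * Real.exp (-1 * ‖x‖ ^ 2) : ℝ) : ℂ)
        * fourierKernel ξ x)
      (by have := continuous_fourierKernel ξ; have := continuous_laguerre m α; fun_prop)
      hb0.le (by linarith) (integrable_exp_mul_laguerre_mul_exp m α ξ hbi)
    -- Since b/(1-b) + 1 = 1/(1-b), the exponentials merge into the Gaussian of the preceding lemma.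
    have e : ∀ x : Cn (α + 1), ((Real.exp (-(b / (1 - b)) * ‖x‖ ^ 2) : ℝ) : ℂ) *
        (((laguerre m α (‖x‖ ^ 2) * Real.exp (-1 * ‖x‖ ^ 2) : ℝ) : ℂ) * fourierKernel ξ x)
        = (laguerre m α (‖x‖ ^ 2) : ℂ) *
        (((Real.exp (-(1 / (1 - b)) * ‖x‖ ^ 2) : ℝ) : ℂ) * fourierKernel ξ x) := by
      intro x
      rw [show -(1 / (1 - b)) * ‖x‖ ^ 2 = -(b / (1 - b)) * ‖x‖ ^ 2 + -1 * ‖x‖ ^ 2 by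
        field_simp
        ring, Real.exp_add]
      push_cast
      ring
    simp only [e] at h
    rw [integral_laguerre_mul_exp_mul_fourierKernel α m ξ hb0 hb1, ← hS, ← Complex.ofReal_mul] at h
    convert h using 2
    rw [eval_reversedLaguerre α m S hb0.ne', show -S * (1 - b) = -S + S * b by ring, Real.exp_add]
    field_simp
  · have h := Complex.hasSum_ofReal.mpr ((hasSum_coeff_polynomial_mul_exp
      (reversedLaguerre α m S) S b).mul_left (Real.pi ^ (α + 1) * Real.exp (-S)))
    refine h.congr_fun fun k => ?_
    push_cast
    ring

end Transform

/-! ### The density b_m and its Fourier transform -/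

section BerezinDensity

variable {n : ℕ}

theorem pochhammer_factorial_pos (α m : ℕ) : 0 < pochhammer ((α + 1 : ℕ) : ℝ) m := by
  unfold pochhammer
  positivity

theorem continuous_berezinDensity (n m : ℕ) : Continuous (berezinDensity n m) := by
  have := continuous_laguerre m (n - 1)
  unfold berezinDensity
  fun_prop

theorem exists_norm_berezinDensity_le (n m : ℕ) :
    ∃ C, 0 ≤ C ∧ ∀ z, ‖berezinDensity n m z‖ ≤ C * Real.exp (-(1 / 2) * ‖z‖ ^ 2) := by
  obtain ⟨C, hC, h⟩ := (laguerrePoly m (n - 1) ^ 2).exists_abs_eval_le_exp (half_pos one_pos)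
  refine ⟨|(m.factorial : ℝ) / (pochhammer n m * Real.pi ^ n)| * C, by positivity, fun z => ?_⟩
  have h1 := h (‖z‖ ^ 2) (by positivity)
  rw [Polynomial.eval_pow, eval_laguerrePoly] at h1
  rw [berezinDensity, norm_mul, norm_mul, Real.norm_eq_abs, Real.norm_eq_abs, Real.norm_eq_abs,
    abs_of_pos (Real.exp_pos _), mul_assoc, mul_assoc]
  refine mul_le_mul_of_nonneg_left ?_ (abs_nonneg _)
  refine (mul_le_mul_of_nonneg_left h1 (Real.exp_pos _).le).trans (le_of_eq ?_)
  rw [mul_left_comm, ← Real.exp_add]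
  congr 2
  ring

theorem integrable_berezinDensity (n m : ℕ) :
    Integrable fun z : Cn n => (berezinDensity n m z : ℂ) := by
  obtain ⟨C, hC, h⟩ := exists_norm_berezinDensity_le n m
  have := continuous_berezinDensity n m
  refine integrable_of_norm_le_exp_neg (C := C) (c := 1 / 2) (by fun_prop) (by norm_num) fun x => ?_
  rw [Complex.norm_real]
  exact h x

/-- Makes the convolution with an L² function an inner product with a fixed vector, hence defined at
every point z. -/
theorem memLp_two_berezinDensity (n m : ℕ) (z : Cn n) :
    MemLp (fun w : Cn n => (berezinDensity n m (z - w) : ℂ)) 2 volume := by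
  obtain ⟨C, hC, h⟩ := exists_norm_berezinDensity_le n m
  have hc := continuous_berezinDensity n m
  have hi := (integrable_berezinDensity n m).comp_sub_left z
  refine (memLp_two_iff_integrable_sq_norm (by fun_prop)).mpr ?_
  refine (hi.norm.const_mul C).mono' (by fun_prop) (Filter.Eventually.of_forall fun w => ?_)
  simp only [norm_pow, norm_norm, Complex.norm_real]
  rw [sq]
  refine mul_le_mul_of_nonneg_right ((h _).trans ?_) (norm_nonneg _)
  refine mul_le_of_le_one_right hC (Real.exp_le_one_iff.mpr ?_)
  nlinarith [sq_nonneg ‖z - w‖]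

/-- The spectral function of the Berezin transform. -/
noncomputable def berezinSymbol (n m : ℕ) (t : ℝ) : ℝ :=
  1 / pochhammer n m * Real.exp (t / 4) *
    ∑ k ∈ Finset.range (m + 1),
      pochhammer ((n : ℝ) - 1) k * ((m - k).factorial : ℝ) / (k.factorial : ℝ)
        * (-t / 4) ^ k * laguerre (m - k) k (-t / 4)
        * laguerre (m - k) (n - 1 + k) (-t / 4)

theorem fourier_berezinDensity (hn : 1 ≤ n) (m : ℕ) (ξ : Cn n) :
    𝓕 (fun z : Cn n => (berezinDensity n m z : ℂ)) ξ
      = ((berezinSymbol n m (-(2 * Real.pi * ‖ξ‖) ^ 2) : ℝ) : ℂ) := by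
  obtain ⟨α, rfl⟩ : ∃ α, n = α + 1 := ⟨n - 1, by omega⟩
  rw [fourier_eq_integral_fourierKernel]
  have e : ∀ x : Cn (α + 1), (berezinDensity (α + 1) m x : ℂ) * fourierKernel ξ x
      = (((m.factorial : ℝ) / (pochhammer ((α + 1 : ℕ) : ℝ) m * Real.pi ^ (α + 1)) : ℝ) : ℂ) *
        (((Real.exp (-‖x‖ ^ 2) * laguerre m α (‖x‖ ^ 2) ^ 2 : ℝ) : ℂ) * fourierKernel ξ x) := by
    intro x
    rw [berezinDensity, Nat.add_sub_cancel, mul_assoc ((m.factorial : ℝ) / _), Complex.ofReal_mul,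
      mul_assoc]
  simp only [e]
  -- The spectral variable is t = -(2π|ξ|)², so -t/4 = π²|ξ|².
  rw [integral_const_mul, integral_laguerre_sq_mul_fourierKernel, ← Complex.ofReal_mul,
    berezinSymbol, show -(2 * Real.pi * ‖ξ‖) ^ 2 / 4 = -(Real.pi ^ 2 * ‖ξ‖ ^ 2) by ring,
    show - -(2 * Real.pi * ‖ξ‖) ^ 2 / 4 = Real.pi ^ 2 * ‖ξ‖ ^ 2 by ring]
  have h := sum_choose_mul_laguerre_diagonal α m (Real.pi ^ 2 * ‖ξ‖ ^ 2)
  rw [show ((α + 1 : ℕ) : ℝ) - 1 = α by push_cast; ring, Nat.add_sub_cancel, ← h]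
  have hp := (pochhammer_factorial_pos α m).ne'
  have := Real.pi_pos.ne'
  congr 1
  field_simp

/-- The transform at ξ = 0, where only the term i = 0 survives; it fixes the norm of the kernel. -/
theorem integral_laguerre_sq (α m : ℕ) :
    ∫ x : Cn (α + 1), Real.exp (-‖x‖ ^ 2) * laguerre m α (‖x‖ ^ 2) ^ 2
      = Real.pi ^ (α + 1) * (m + α).choose m := by
  have h := integral_laguerre_sq_mul_fourierKernel α m 0
  rw [Finset.sum_range_succ', Finset.sum_eq_zero (fun i _ => by simp)] at h
  simp only [fourierKernel, inner_zero_right, mul_zero, Complex.ofReal_zero, zero_mul,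
    Complex.exp_zero, mul_one] at h
  rw [integral_complex_ofReal, Complex.ofReal_inj] at h
  simpa [laguerre] using h

end BerezinDensity

/-! ### Temperate growth of the symbol -/

section Multiplier

/-- The profile e^{-cr} is controlled only on r ≥ 0, which contains the range of |x|²; there its
k-th derivative is at most c^k ≤ (1+c)^N. -/
theorem hasTemperateGrowth_exp_neg_mul_sq_norm {H : Type*} [NormedAddCommGroup H]
    [InnerProductSpace ℝ H] {c : ℝ} (hc : 0 ≤ c) :
    (fun x : H => Real.exp (-c * ‖x‖ ^ 2)).HasTemperateGrowth := by
  have hd : ContDiff ℝ ∞ fun r : ℝ => Real.exp (-c * r) := by fun_prop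
  refine Function.HasTemperateGrowth.comp' (g := fun r : ℝ => Real.exp (-c * r))
    (f := fun x : H => ‖x‖ ^ 2) (t := Set.Ici 0) ?_ (uniqueDiffOn_Ici 0) hd.contDiffOn
    (fun N => ⟨0, (1 + c) ^ N, by positivity, fun k hk r hr => ?_⟩)
    (Function.hasTemperateGrowth_norm_sq H)
  · rintro _ ⟨x, rfl⟩
    exact sq_nonneg ‖x‖
  · rw [norm_iteratedFDerivWithin_eq_norm_iteratedDerivWithin,
      iteratedDerivWithin_eq_iteratedDeriv (uniqueDiffOn_Ici 0)
        (hd.contDiffAt.of_le (mod_cast le_top)) hr, iteratedDeriv_exp_const_mul]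
    rw [norm_mul, norm_pow, norm_neg, Real.norm_eq_abs, Real.norm_eq_abs, abs_of_nonneg hc,
      abs_of_pos (Real.exp_pos _), pow_zero, mul_one]
    refine (mul_le_of_le_one_right (by positivity) (Real.exp_le_one_iff.mpr ?_)).trans ?_
    · have : 0 ≤ r := hr
      nlinarith
    · exact (pow_le_pow_left₀ hc (by linarith) k).trans
        (pow_le_pow_right₀ (by linarith) hk)

theorem hasTemperateGrowth_polynomial_sq_norm {H : Type*} [NormedAddCommGroup H]
    [InnerProductSpace ℝ H] (p : Polynomial ℝ) :
    (fun x : H => p.eval (‖x‖ ^ 2)).HasTemperateGrowth := by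
  simp_rw [Polynomial.eval_eq_sum_range]
  exact Function.HasTemperateGrowth.sum fun i _ =>
    (Function.HasTemperateGrowth.const _).mul ((Function.hasTemperateGrowth_norm_sq H).pow i)

/-- The explicit formula, a polynomial in |ξ|² times a Gaussian, shows that the symbol multiplies
Schwartz functions into Schwartz functions. -/
theorem hasTemperateGrowth_fourier_berezinDensity {n : ℕ} (hn : 1 ≤ n) (m : ℕ) :
    (𝓕 (fun z : Cn n => (berezinDensity n m z : ℂ))).HasTemperateGrowth := by
  have hl : ∀ k α, (fun ξ : Cn n => laguerre k α (Real.pi ^ 2 * ‖ξ‖ ^ 2)).HasTemperateGrowth := by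
    intro k α
    have := hasTemperateGrowth_polynomial_sq_norm (H := Cn n)
      ((laguerrePoly k α).comp (Polynomial.C (Real.pi ^ 2) * Polynomial.X))
    simpa [eval_laguerrePoly] using this
  have hN : (fun ξ : Cn n => ‖ξ‖ ^ 2).HasTemperateGrowth :=
    Function.hasTemperateGrowth_norm_sq _
  have e : 𝓕 (fun z : Cn n => (berezinDensity n m z : ℂ)) = fun ξ : Cn n => Complex.ofReal
      (1 / pochhammer n m * Real.exp (-Real.pi ^ 2 * ‖ξ‖ ^ 2) * ∑ k ∈ Finset.range (m + 1),
        pochhammer ((n : ℝ) - 1) k * ((m - k).factorial : ℝ) / (k.factorial : ℝ)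
        * (Real.pi ^ 2 * ‖ξ‖ ^ 2) ^ k * laguerre (m - k) k (Real.pi ^ 2 * ‖ξ‖ ^ 2)
        * laguerre (m - k) (n - 1 + k) (Real.pi ^ 2 * ‖ξ‖ ^ 2)) := by
    funext ξ
    rw [fourier_berezinDensity hn, berezinSymbol,
      show -(2 * Real.pi * ‖ξ‖) ^ 2 / 4 = -Real.pi ^ 2 * ‖ξ‖ ^ 2 by ring,
      show - -(2 * Real.pi * ‖ξ‖) ^ 2 / 4 = Real.pi ^ 2 * ‖ξ‖ ^ 2 by ring]
  rw [e]
  refine Function.HasTemperateGrowth.comp Function.Complex.hasTemperateGrowth_ofReal ?_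
  refine ((Function.HasTemperateGrowth.const _).mul
    (hasTemperateGrowth_exp_neg_mul_sq_norm (by positivity))).mul
    (Function.HasTemperateGrowth.sum fun k _ => ?_)
  exact (((Function.HasTemperateGrowth.const _).mul
    (((Function.HasTemperateGrowth.const _).mul hN).pow k)).mul (hl _ _)).mul (hl _ _)

end Multiplier

/-! ### The convolution operator on L² and the functional calculus -/

section BerezinOperator

open scoped SchwartzMap Convolution

variable {n : ℕ}

theorem norm_fourier_berezinDensity_le (n m : ℕ) (ξ : Cn n) :
    ‖𝓕 (fun z : Cn n => (berezinDensity n m z : ℂ)) ξ‖ ≤ ∫ z : Cn n, ‖(berezinDensity n m z : ℂ)‖ := by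
  rw [fourier_eq_integral_fourierKernel]
  refine (norm_integral_le_integral_norm _).trans (le_of_eq ?_)
  simp [norm_fourierKernel]

theorem memLp_top_fourier_berezinDensity (hn : 1 ≤ n) (m : ℕ) :
    MemLp (𝓕 (fun z : Cn n => (berezinDensity n m z : ℂ))) ∞ volume :=
  memLp_top_of_bound (hasTemperateGrowth_fourier_berezinDensity hn m).1.continuous.aestronglyMeasurable _
    (Filter.Eventually.of_forall (norm_fourier_berezinDensity_le n m))

/-- The Berezin transform on `L²`, as a Fourier multiplier. -/
noncomputable def berezinOperator (hn : 1 ≤ n) (m : ℕ) :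
    Lp ℂ 2 (volume : Measure (Cn n)) →L[ℂ] Lp ℂ 2 (volume : Measure (Cn n)) :=
  (Lp.fourierTransformₗᵢ (Cn n) ℂ).symm.toContinuousLinearEquiv.toContinuousLinearMap ∘L
    ((ContinuousLinearMap.mul ℂ ℂ).holderL volume ∞ 2 2
      ((memLp_top_fourier_berezinDensity hn m).toLp _)) ∘L
    (Lp.fourierTransformₗᵢ (Cn n) ℂ).toContinuousLinearEquiv.toContinuousLinearMap

theorem berezinOperator_apply (hn : 1 ≤ n) (m : ℕ) (φ : Lp ℂ 2 (volume : Measure (Cn n))) :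
    berezinOperator hn m φ = (Lp.fourierTransformₗᵢ (Cn n) ℂ).symm
      ((ContinuousLinearMap.mul ℂ ℂ).holder 2
        ((memLp_top_fourier_berezinDensity hn m).toLp _) (𝓕 φ)) := rfl

theorem coeFn_holder_fourier (hn : 1 ≤ n) (m : ℕ) (φ : Lp ℂ 2 (volume : Measure (Cn n))) :
    (ContinuousLinearMap.mul ℂ ℂ).holder 2 ((memLp_top_fourier_berezinDensity hn m).toLp _) φ
      =ᵐ[volume] fun ξ => 𝓕 (fun z : Cn n => (berezinDensity n m z : ℂ)) ξ * φ ξ := by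
  filter_upwards [(ContinuousLinearMap.mul ℂ ℂ).coeFn_holder (r := 2)
    ((memLp_top_fourier_berezinDensity hn m).toLp _) φ,
    (memLp_top_fourier_berezinDensity hn m).coeFn_toLp] with ξ h1 h2
  rw [h1, h2]
  rfl

theorem laplacianMultiplier_berezinSymbol_ae_eq (hn : 1 ≤ n) (m : ℕ)
    (φ : Lp ℂ 2 (volume : Measure (Cn n))) :
    (ContinuousLinearMap.mul ℂ ℂ).holder 2 ((memLp_top_fourier_berezinDensity hn m).toLp _) (𝓕 φ)
      =ᵐ[volume] laplacianMultiplier (berezinSymbol n m) φ := by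
  filter_upwards [coeFn_holder_fourier hn m (𝓕 φ)] with ξ h
  rw [h, fourier_berezinDensity hn]
  rfl

/-- The symbol is bounded by the L¹ norm of b_m, so the maximal domain of the function of the
Laplacian is all of L². -/
theorem toPMap_berezinOperator (hn : 1 ≤ n) (m : ℕ) :
    (berezinOperator hn m).toLinearMap.toPMap ⊤ = laplacianFunction n (berezinSymbol n m) := by
  have hmem : ∀ φ, MemLp (laplacianMultiplier (berezinSymbol n m) φ) 2 (volume : Measure (Cn n)) :=
    fun φ => (memLp_congr_ae (laplacianMultiplier_berezinSymbol_ae_eq hn m φ)).mp (Lp.memLp _)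
  refine LinearPMap.ext ?_ fun φ h1 h2 => ?_
  · ext φ
    exact ⟨fun _ => hmem φ, fun _ => trivial⟩
  · change berezinOperator hn m φ = (Lp.fourierTransformₗᵢ (Cn n) ℂ).symm
      (MemLp.toLp (laplacianMultiplier (berezinSymbol n m) φ) (hmem φ))
    rw [berezinOperator_apply]
    congr 1
    rw [Lp.ext_iff]
    exact (laplacianMultiplier_berezinSymbol_ae_eq hn m φ).trans (hmem φ).coeFn_toLp.symm

/-- The Fourier multiplier with symbol the transform of the density, on Schwartz functions. -/
noncomputable def berezinSchwartz (m : ℕ) (f : 𝓢(Cn n, ℂ)) : 𝓢(Cn n, ℂ) :=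
  SchwartzMap.smulLeftCLM ℂ (𝓕 (fun z : Cn n => (berezinDensity n m z : ℂ))) (𝓕 f)

theorem berezinSchwartz_apply (hn : 1 ≤ n) (m : ℕ) (f : 𝓢(Cn n, ℂ)) (ξ : Cn n) :
    berezinSchwartz m f ξ
      = 𝓕 (fun z : Cn n => (berezinDensity n m z : ℂ)) ξ * 𝓕 (f : Cn n → ℂ) ξ := by
  rw [berezinSchwartz, SchwartzMap.smulLeftCLM_apply_apply
    (hasTemperateGrowth_fourier_berezinDensity hn m), smul_eq_mul, SchwartzMap.fourier_coe]

theorem berezinOperator_toLp_eq (hn : 1 ≤ n) (m : ℕ) (f : 𝓢(Cn n, ℂ)) :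
    berezinOperator hn m (f.toLp 2) = (𝓕⁻ (berezinSchwartz m f)).toLp 2 := by
  rw [← SchwartzMap.toLp_fourierInv_eq, berezinOperator_apply, SchwartzMap.toLp_fourier_eq]
  refine congrArg (Lp.fourierTransformₗᵢ (Cn n) ℂ).symm (Lp.ext ?_)
  filter_upwards [coeFn_holder_fourier hn m ((𝓕 f).toLp 2), (𝓕 f).coeFn_toLp 2,
    (berezinSchwartz m f).coeFn_toLp 2] with ξ h2 h3 h4
  rw [h2, h3, h4, berezinSchwartz_apply hn, SchwartzMap.fourier_coe]

/-- Convolution theorem and Fourier inversion. Inversion is legitimate because the convolution is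
continuous and integrable and its transform, being Schwartz, is integrable. -/
theorem fourierInv_berezinSchwartz (hn : 1 ≤ n) (m : ℕ) (f : 𝓢(Cn n, ℂ)) :
    𝓕⁻ (berezinSchwartz m f : Cn n → ℂ)
      = (fun z : Cn n => (berezinDensity n m z : ℂ)) ⋆[ContinuousLinearMap.mul ℂ ℂ] f := by
  have hbi := integrable_berezinDensity n m
  have h5 : (berezinSchwartz m f : Cn n → ℂ)
      = 𝓕 ((fun z : Cn n => (berezinDensity n m z : ℂ)) ⋆[ContinuousLinearMap.mul ℂ ℂ] f) := by
    funext ξ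
    rw [Real.fourier_mul_convolution_eq hbi f.integrable, berezinSchwartz_apply hn]
  have h6 := (berezinSchwartz m f).integrable (μ := volume)
  rw [h5] at h6 ⊢
  refine Continuous.fourierInv_fourier_eq ?_ (hbi.integrable_convolution _ f.integrable) h6
  refine BddAbove.continuous_convolution_right_of_integrable _ ?_ hbi f.continuous
  obtain ⟨C, hC⟩ := f.decay 0 0
  exact ⟨C, by rintro _ ⟨x, rfl⟩; simpa using hC.2 x⟩

theorem berezinOperator_toLp (hn : 1 ≤ n) (m : ℕ) (f : 𝓢(Cn n, ℂ)) :
    berezinOperator hn m (f.toLp 2) =ᵐ[volume]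
      fun z => ∫ w, (berezinDensity n m (z - w) : ℂ) * f w := by
  rw [berezinOperator_toLp_eq]
  filter_upwards [(𝓕⁻ (berezinSchwartz m f)).coeFn_toLp 2] with z hz
  rw [hz, SchwartzMap.fourierInv_coe, fourierInv_berezinSchwartz hn, convolution_mul_swap]

theorem berezinOperator_ae_eq (hn : 1 ≤ n) (m : ℕ) (φ : Lp ℂ 2 (volume : Measure (Cn n))) :
    berezinOperator hn m φ =ᵐ[volume]
      fun z => ∫ w, (berezinDensity n m (z - w) : ℂ) * φ w := by
  have hinner : ∀ (z : Cn n) (φ : Lp ℂ 2 (volume : Measure (Cn n))),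
      ∫ w, (berezinDensity n m (z - w) : ℂ) * φ w
        = ⟪(memLp_two_berezinDensity n m z).toLp _, φ⟫ := by
    intro z φ
    rw [L2.inner_def]
    refine integral_congr_ae ?_
    filter_upwards [(memLp_two_berezinDensity n m z).coeFn_toLp] with w hw
    rw [hw]
    simp [mul_comm]
  refine DenseRange.induction_on
    (p := fun φ : Lp ℂ 2 (volume : Measure (Cn n)) => berezinOperator hn m φ =ᵐ[volume]
      fun z => ∫ w, (berezinDensity n m (z - w) : ℂ) * φ w)
    (SchwartzMap.denseRange_toLpCLM (E := Cn n) (F := ℂ) (μ := volume) (p := 2)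
      ENNReal.ofNat_ne_top) φ ?_ fun f => ?_
  -- The set where the formula holds is closed: the left side converges almost everywhere along a
  -- subsequence, the right side at every z by continuity of the inner product. Density of Schwartz
  -- functions then suffices.
  · refine IsSeqClosed.isClosed fun u φ hu hlim => ?_
    obtain ⟨ns, hns, h1⟩ := (tendstoInMeasure_of_tendsto_Lp
      (((berezinOperator hn m).continuous.tendsto φ).comp hlim)).exists_seq_tendsto_ae
    have h2 : ∀ᵐ z, ∀ k, berezinOperator hn m (u k) z
      = ∫ w, (berezinDensity n m (z - w) : ℂ) * u k w := ae_all_iff.mpr hu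
    filter_upwards [h1, h2] with z h1 h2
    refine tendsto_nhds_unique h1 ?_
    simp only [Function.comp_apply, h2, hinner]
    exact ((continuous_const.inner continuous_id).tendsto φ).comp
      (hlim.comp hns.tendsto_atTop)
  · have h := berezinOperator_toLp hn m f
    refine h.trans (Filter.Eventually.of_forall fun z => ?_)
    refine integral_congr_ae ?_
    filter_upwards [f.coeFn_toLp 2 volume] with w hw
    rw [SchwartzMap.toLpCLM_apply, hw]

end BerezinOperator

/-! ### Wirtinger calculus and the magnetic Laplacian on translated radial functions -/

section Wirtinger

variable {n : ℕ}

theorem HasFDerivAt.dZ_eq {u : Cn n → ℂ} {u' : Cn n →L[ℝ] ℂ} {w : Cn n} (h : HasFDerivAt u u' w)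
    (j : Fin n) : dZ j u w = (1 / 2 : ℂ) * (u' (EuclideanSpace.single j (1 : ℂ))
      - Complex.I * u' (EuclideanSpace.single j Complex.I)) := by
  rw [dZ, h.fderiv]

theorem HasFDerivAt.dZbar_eq {u : Cn n → ℂ} {u' : Cn n →L[ℝ] ℂ} {w : Cn n}
    (h : HasFDerivAt u u' w) (j : Fin n) :
    dZbar j u w = (1 / 2 : ℂ) * (u' (EuclideanSpace.single j (1 : ℂ))
      + Complex.I * u' (EuclideanSpace.single j Complex.I)) := by
  rw [dZbar, h.fderiv]

theorem dZ_mul {u v : Cn n → ℂ} {w : Cn n} (hu : DifferentiableAt ℝ u w)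
    (hv : DifferentiableAt ℝ v w) (j : Fin n) :
    dZ j (fun x => u x * v x) w = dZ j u w * v w + u w * dZ j v w := by
  rw [(hu.hasFDerivAt.fun_mul hv.hasFDerivAt).dZ_eq, dZ, dZ]
  simp only [add_apply, smul_apply, smul_eq_mul]
  ring

theorem dZbar_mul {u v : Cn n → ℂ} {w : Cn n} (hu : DifferentiableAt ℝ u w)
    (hv : DifferentiableAt ℝ v w) (j : Fin n) :
    dZbar j (fun x => u x * v x) w = dZbar j u w * v w + u w * dZbar j v w := by
  rw [(hu.hasFDerivAt.fun_mul hv.hasFDerivAt).dZbar_eq, dZbar, dZbar]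
  simp only [add_apply, smul_apply, smul_eq_mul]
  ring

/-- The function `w ↦ ρ(|w - a|²)`. -/
noncomputable def radial (a : Cn n) (ρ : ℝ → ℝ) (w : Cn n) : ℂ := (ρ (‖w - a‖ ^ 2) : ℂ)

theorem hasFDerivAt_radial (a : Cn n) {ρ : ℝ → ℝ} (hρ : Differentiable ℝ ρ) (w : Cn n) :
    HasFDerivAt (radial a ρ) (Complex.ofRealCLM ∘L
      (deriv ρ (‖w - a‖ ^ 2) • (2 • (innerSL ℝ (w - a))))) w := by
  have h1 : HasFDerivAt (fun w : Cn n => ‖w - a‖ ^ 2) (2 • (innerSL ℝ (w - a))) w := by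
    simpa using ((hasFDerivAt_id w).sub_const a).norm_sq
  have h2 := (hρ (‖w - a‖ ^ 2)).hasDerivAt.comp_hasFDerivAt w h1
  exact Complex.ofRealCLM.hasFDerivAt.comp w h2

theorem differentiable_radial (a : Cn n) {ρ : ℝ → ℝ} (hρ : Differentiable ℝ ρ) :
    Differentiable ℝ (radial a ρ) :=
  fun w => (hasFDerivAt_radial a hρ w).differentiableAt

theorem contDiff_radial {k : WithTop ℕ∞} (a : Cn n) {ρ : ℝ → ℝ} (hρ : ContDiff ℝ k ρ) :
    ContDiff ℝ k (radial a ρ) :=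
  Complex.ofRealCLM.contDiff.comp
    (hρ.comp ((contDiff_id.sub contDiff_const).norm_sq ℝ))

theorem real_inner_single (v : Cn n) (j : Fin n) (c : ℂ) :
    inner ℝ v (EuclideanSpace.single j c) = (c * (starRingEnd ℂ) (v j)).re := by
  rw [PiLp.inner_apply, Finset.sum_eq_single j (fun i _ hi => by simp [hi]) (by simp)]
  simp [Complex.inner]

theorem dZ_radial (a : Cn n) {ρ : ℝ → ℝ} (hρ : Differentiable ℝ ρ) (j : Fin n) (w : Cn n) :
    dZ j (radial a ρ) w = radial a (deriv ρ) w * (starRingEnd ℂ) (w j - a j) := by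
  rw [(hasFDerivAt_radial a hρ w).dZ_eq]
  simp only [ContinuousLinearMap.comp_apply, smul_apply, innerSL_apply_apply,
    real_inner_single, Complex.ofRealCLM_apply, radial]
  apply Complex.ext <;> simp <;> ring

theorem dZbar_radial (a : Cn n) {ρ : ℝ → ℝ} (hρ : Differentiable ℝ ρ) (j : Fin n) (w : Cn n) :
    dZbar j (radial a ρ) w = radial a (deriv ρ) w * (w j - a j) := by
  rw [(hasFDerivAt_radial a hρ w).dZbar_eq]
  simp only [ContinuousLinearMap.comp_apply, smul_apply, innerSL_apply_apply,
    real_inner_single, Complex.ofRealCLM_apply, radial]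
  apply Complex.ext <;> simp <;> ring

/-- The holomorphic exponential `w ↦ e^{⟨w, a⟩}`. -/
noncomputable def holExp (a w : Cn n) : ℂ := Complex.exp ⟪a, w⟫

/-- The antiholomorphic exponential `w ↦ e^{⟨a, w⟩}`. -/
noncomputable def antiExp (a w : Cn n) : ℂ := Complex.exp ⟪w, a⟫

theorem conj_holExp (a w : Cn n) : (starRingEnd ℂ) (holExp a w) = antiExp a w := by
  rw [holExp, antiExp, ← Complex.exp_conj, inner_conj_symm]

theorem hasFDerivAt_holExp (a w : Cn n) :
    HasFDerivAt (holExp a) (holExp a w • (innerSL ℂ a).restrictScalars ℝ) w :=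
  ((innerSL ℂ a).restrictScalars ℝ).hasFDerivAt.cexp

theorem contDiff_holExp {k : WithTop ℕ∞} (a : Cn n) : ContDiff ℝ k (holExp a) :=
  ((innerSL ℂ a).restrictScalars ℝ).contDiff.cexp

theorem antiExp_eq_comp (a : Cn n) : antiExp a = fun w => Complex.conjCLE (holExp a w) := by
  funext w
  exact (conj_holExp a w).symm

theorem hasFDerivAt_antiExp (a w : Cn n) :
    HasFDerivAt (antiExp a) ((Complex.conjCLE : ℂ →L[ℝ] ℂ) ∘L
      (holExp a w • (innerSL ℂ a).restrictScalars ℝ)) w := by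
  rw [antiExp_eq_comp]
  exact (Complex.conjCLE : ℂ →L[ℝ] ℂ).hasFDerivAt.comp w (hasFDerivAt_holExp a w)

theorem contDiff_antiExp {k : WithTop ℕ∞} (a : Cn n) : ContDiff ℝ k (antiExp a) := by
  rw [antiExp_eq_comp]
  exact Complex.conjCLE.contDiff.comp (contDiff_holExp a)

theorem dZ_holExp (a : Cn n) (j : Fin n) (w : Cn n) :
    dZ j (holExp a) w = holExp a w * (starRingEnd ℂ) (a j) := by
  rw [(hasFDerivAt_holExp a w).dZ_eq]
  simp [EuclideanSpace.inner_single_right]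
  linear_combination (-(1 / 2 : ℂ) * holExp a w * (starRingEnd ℂ) (a j)) * Complex.I_sq

theorem dZbar_holExp (a : Cn n) (j : Fin n) (w : Cn n) : dZbar j (holExp a) w = 0 := by
  rw [(hasFDerivAt_holExp a w).dZbar_eq]
  simp [EuclideanSpace.inner_single_right]
  linear_combination (holExp a w * (starRingEnd ℂ) (a j)) * Complex.I_sq

theorem dZ_antiExp (a : Cn n) (j : Fin n) (w : Cn n) : dZ j (antiExp a) w = 0 := by
  rw [(hasFDerivAt_antiExp a w).dZ_eq]
  simp [EuclideanSpace.inner_single_right]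
  linear_combination ((starRingEnd ℂ) (holExp a w) * (a j)) * Complex.I_sq

theorem dZbar_antiExp (a : Cn n) (j : Fin n) (w : Cn n) :
    dZbar j (antiExp a) w = antiExp a w * a j := by
  rw [(hasFDerivAt_antiExp a w).dZbar_eq, ← conj_holExp]
  simp [EuclideanSpace.inner_single_right]
  linear_combination (-(1 / 2 : ℂ) * (starRingEnd ℂ) (holExp a w) * (a j)) * Complex.I_sq

theorem hasFDerivAt_coord_sub (c : ℂ) (j : Fin n) (w : Cn n) :
    HasFDerivAt (fun w : Cn n => w j - c) ((EuclideanSpace.proj j).restrictScalars ℝ) w :=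
  ((EuclideanSpace.proj (𝕜 := ℂ) j).restrictScalars ℝ).hasFDerivAt.sub_const c

theorem hasFDerivAt_conj_coord_sub (c : ℂ) (j : Fin n) (w : Cn n) :
    HasFDerivAt (fun w : Cn n => (starRingEnd ℂ) (w j - c)) ((Complex.conjCLE : ℂ →L[ℝ] ℂ) ∘L
      (EuclideanSpace.proj j).restrictScalars ℝ) w :=
  (Complex.conjCLE : ℂ →L[ℝ] ℂ).hasFDerivAt.comp w (hasFDerivAt_coord_sub c j w)

theorem dZ_coord_sub (c : ℂ) (j : Fin n) (w : Cn n) : dZ j (fun w : Cn n => w j - c) w = 1 := by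
  rw [(hasFDerivAt_coord_sub c j w).dZ_eq]
  simp
  norm_num

theorem dZbar_conj_coord_sub (c : ℂ) (j : Fin n) (w : Cn n) :
    dZbar j (fun w : Cn n => (starRingEnd ℂ) (w j - c)) w = 1 := by
  rw [(hasFDerivAt_conj_coord_sub c j w).dZbar_eq]
  simp
  norm_num

theorem sum_conj_mul_self (v : Cn n) : ∑ j, (starRingEnd ℂ) (v j) * v j = ((‖v‖ ^ 2 : ℝ) : ℂ) := by
  rw [EuclideanSpace.norm_sq_eq]
  push_cast
  exact Finset.sum_congr rfl fun j _ => by rw [Complex.conj_mul']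

/-- The action of the magnetic Laplacian on radial profiles. -/
noncomputable def radialLaplacian (n : ℕ) (ρ : ℝ → ℝ) (r : ℝ) : ℝ :=
  (r - n) * deriv ρ r - r * deriv (deriv ρ) r

theorem dZbar_holExp_mul_radial (a : Cn n) {ρ : ℝ → ℝ} (hρ : Differentiable ℝ ρ) (j : Fin n) :
    dZbar j (fun w => holExp a w * radial a ρ w)
      = fun w => holExp a w * (radial a (deriv ρ) w * (w j - a j)) := by
  funext w
  rw [dZbar_mul (hasFDerivAt_holExp a w).differentiableAt (differentiable_radial a hρ w),
    dZbar_holExp, dZbar_radial a hρ]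
  ring

/-- The factor e^{⟨w,a⟩} is invisible to ∂/∂z̄_j, while ∂/∂z_j brings down ā_j; this turns the drift
coefficient w̄_j into w̄_j - ā_j, so only |w-a|² remains. -/
theorem magneticLaplacian_holExp_mul_radial (a : Cn n) {ρ : ℝ → ℝ} (hρ : Differentiable ℝ ρ)
    (hρ' : Differentiable ℝ (deriv ρ)) (w : Cn n) :
    magneticLaplacian (fun w => holExp a w * radial a ρ w) w
      = holExp a w * radial a (radialLaplacian n ρ) w := by
  have h : ∀ j, dZ j (fun w => holExp a w * (radial a (deriv ρ) w * (w j - a j))) w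
      = holExp a w * (starRingEnd ℂ) (a j) * (radial a (deriv ρ) w * (w j - a j))
        + holExp a w * (radial a (deriv (deriv ρ)) w * ((starRingEnd ℂ) (w j - a j) * (w j - a j))
          + radial a (deriv ρ) w) := by
    intro j
    have hd := differentiable_radial a hρ' w
    have hc := (hasFDerivAt_coord_sub (a j) j w).differentiableAt
    rw [dZ_mul (hasFDerivAt_holExp a w).differentiableAt (hd.fun_mul hc), dZ_mul hd hc,
      dZ_holExp, dZ_radial a hρ', dZ_coord_sub]
    ring
  rw [magneticLaplacian]
  simp only [dZbar_holExp_mul_radial a hρ, h]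
  have hs := sum_conj_mul_self (w - a)
  simp only [PiLp.sub_apply] at hs
  rw [← Finset.sum_neg_distrib, ← Finset.sum_add_distrib]
  have e : ∀ j, -(holExp a w * (starRingEnd ℂ) (a j) * (radial a (deriv ρ) w * (w j - a j))
        + holExp a w * (radial a (deriv (deriv ρ)) w * ((starRingEnd ℂ) (w j - a j) * (w j - a j))
          + radial a (deriv ρ) w))
      + (starRingEnd ℂ) (w j) * (holExp a w * (radial a (deriv ρ) w * (w j - a j)))
      = holExp a w * (radial a (deriv ρ) w - radial a (deriv (deriv ρ)) w)
          * ((starRingEnd ℂ) (w j - a j) * (w j - a j))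
        - holExp a w * radial a (deriv ρ) w := by
    intro j
    rw [map_sub]
    ring
  simp only [e]
  rw [Finset.sum_sub_distrib, ← Finset.mul_sum, hs]
  simp only [Finset.sum_const, Finset.card_univ, Fintype.card_fin, radialLaplacian, radial,
    nsmul_eq_mul]
  push_cast
  ring

end Wirtinger

/-! ### Integration by parts and symmetry of the magnetic Laplacian -/

section Symmetry

variable {n : ℕ}

/-- Only f is compactly supported, which allows g to be a weighted kernel function. -/
theorem integral_fderiv_mul_eq_neg {f g : Cn n → ℂ} (hf : ContDiff ℝ 1 f) (hg : ContDiff ℝ 1 g)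
    (hs : HasCompactSupport f) (v : Cn n) :
    ∫ x, fderiv ℝ f x v * g x = - ∫ x, f x * fderiv ℝ g x v := by
  have hf' : Continuous fun x => fderiv ℝ f x v := (hf.continuous_fderiv_apply one_ne_zero).comp
    (continuous_id.prodMk continuous_const)
  have hg' : Continuous fun x => fderiv ℝ g x v := (hg.continuous_fderiv_apply one_ne_zero).comp
    (continuous_id.prodMk continuous_const)
  rw [integral_mul_fderiv_eq_neg_fderiv_mul_of_integrable (v := v)
    ((hf'.mul hg.continuous).integrable_of_hasCompactSupport
      ((hs.fderiv_apply ℝ v).mul_right))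
    ((hf.continuous.mul hg').integrable_of_hasCompactSupport hs.mul_right)
    ((hf.continuous.mul hg.continuous).integrable_of_hasCompactSupport hs.mul_right)
    (fun x _ => hf.differentiable one_ne_zero x) (fun x _ => hg.differentiable one_ne_zero x),
    neg_neg]

theorem integrable_fderiv_mul {f g : Cn n → ℂ} (hf : ContDiff ℝ 1 f) (hg : Continuous g)
    (hs : HasCompactSupport f) (v : Cn n) : Integrable fun x => fderiv ℝ f x v * g x :=
  ((((hf.continuous_fderiv_apply one_ne_zero).comp
    (continuous_id.prodMk continuous_const)).mul hg)).integrable_of_hasCompactSupport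
      ((hs.fderiv_apply ℝ v).mul_right)

theorem integrable_mul_fderiv {f g : Cn n → ℂ} (hf : Continuous f) (hg : ContDiff ℝ 1 g)
    (hs : HasCompactSupport f) (v : Cn n) : Integrable fun x => f x * fderiv ℝ g x v :=
  ((hf.mul ((hg.continuous_fderiv_apply one_ne_zero).comp
    (continuous_id.prodMk continuous_const)))).integrable_of_hasCompactSupport hs.mul_right

theorem integral_dZ_mul_eq_neg {f g : Cn n → ℂ} (hf : ContDiff ℝ 1 f) (hg : ContDiff ℝ 1 g)
    (hs : HasCompactSupport f) (j : Fin n) :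
    ∫ x, dZ j f x * g x = - ∫ x, f x * dZ j g x := by
  have h1 := integral_fderiv_mul_eq_neg hf hg hs (EuclideanSpace.single j (1 : ℂ))
  have h2 := integral_fderiv_mul_eq_neg hf hg hs (EuclideanSpace.single j Complex.I)
  have i1 := integrable_fderiv_mul hf hg.continuous hs (EuclideanSpace.single j (1 : ℂ))
  have i2 := integrable_fderiv_mul hf hg.continuous hs (EuclideanSpace.single j Complex.I)
  have i3 := integrable_mul_fderiv hf.continuous hg hs (EuclideanSpace.single j (1 : ℂ))
  have i4 := integrable_mul_fderiv hf.continuous hg hs (EuclideanSpace.single j Complex.I)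
  have e1 : ∀ x, dZ j f x * g x = (1 / 2 : ℂ) * (fderiv ℝ f x (EuclideanSpace.single j (1 : ℂ)) * g x
      - Complex.I * (fderiv ℝ f x (EuclideanSpace.single j Complex.I) * g x)) := fun x => by
    rw [dZ]; ring
  have e2 : ∀ x, f x * dZ j g x = (1 / 2 : ℂ) * (f x * fderiv ℝ g x (EuclideanSpace.single j (1 : ℂ))
      - Complex.I * (f x * fderiv ℝ g x (EuclideanSpace.single j Complex.I))) := fun x => by
    rw [dZ]; ring
  simp only [e1, e2]
  rw [integral_const_mul, integral_sub i1 (i2.const_mul _), integral_const_mul, h1, h2,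
    integral_const_mul, integral_sub i3 (i4.const_mul _), integral_const_mul]
  ring

theorem integral_dZbar_mul_eq_neg {f g : Cn n → ℂ} (hf : ContDiff ℝ 1 f) (hg : ContDiff ℝ 1 g)
    (hs : HasCompactSupport f) (j : Fin n) :
    ∫ x, dZbar j f x * g x = - ∫ x, f x * dZbar j g x := by
  have h1 := integral_fderiv_mul_eq_neg hf hg hs (EuclideanSpace.single j (1 : ℂ))
  have h2 := integral_fderiv_mul_eq_neg hf hg hs (EuclideanSpace.single j Complex.I)
  have i1 := integrable_fderiv_mul hf hg.continuous hs (EuclideanSpace.single j (1 : ℂ))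
  have i2 := integrable_fderiv_mul hf hg.continuous hs (EuclideanSpace.single j Complex.I)
  have i3 := integrable_mul_fderiv hf.continuous hg hs (EuclideanSpace.single j (1 : ℂ))
  have i4 := integrable_mul_fderiv hf.continuous hg hs (EuclideanSpace.single j Complex.I)
  have e1 : ∀ x, dZbar j f x * g x
      = (1 / 2 : ℂ) * (fderiv ℝ f x (EuclideanSpace.single j (1 : ℂ)) * g x
      + Complex.I * (fderiv ℝ f x (EuclideanSpace.single j Complex.I) * g x)) := fun x => by
    rw [dZbar]; ring
  have e2 : ∀ x, f x * dZbar j g x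
      = (1 / 2 : ℂ) * (f x * fderiv ℝ g x (EuclideanSpace.single j (1 : ℂ))
      + Complex.I * (f x * fderiv ℝ g x (EuclideanSpace.single j Complex.I))) := fun x => by
    rw [dZbar]; ring
  simp only [e1, e2]
  rw [integral_const_mul, integral_add i1 (i2.const_mul _), integral_const_mul, h1, h2,
    integral_const_mul, integral_add i3 (i4.const_mul _), integral_const_mul]
  ring

theorem contDiff_dZ {k : WithTop ℕ∞} {f : Cn n → ℂ} (hf : ContDiff ℝ (k + 1) f) (j : Fin n) :
    ContDiff ℝ k (dZ j f) := by
  have h : ∀ v : Cn n, ContDiff ℝ k fun x => fderiv ℝ f x v := fun v =>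
    (hf.fderiv_right le_rfl).clm_apply contDiff_const
  exact contDiff_const.mul ((h _).sub (contDiff_const.mul (h _)))

theorem contDiff_dZbar {k : WithTop ℕ∞} {f : Cn n → ℂ} (hf : ContDiff ℝ (k + 1) f) (j : Fin n) :
    ContDiff ℝ k (dZbar j f) := by
  have h : ∀ v : Cn n, ContDiff ℝ k fun x => fderiv ℝ f x v := fun v =>
    (hf.fderiv_right le_rfl).clm_apply contDiff_const
  exact contDiff_const.mul ((h _).add (contDiff_const.mul (h _)))

theorem hasCompactSupport_dZ {f : Cn n → ℂ} (hf : HasCompactSupport f) (j : Fin n) :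
    HasCompactSupport (dZ j f) :=
  ((hf.fderiv_apply ℝ _).sub ((hf.fderiv_apply ℝ _).mul_left (f := fun _ => Complex.I))).mul_left
    (f := fun _ => (1 / 2 : ℂ))

theorem hasCompactSupport_dZbar {f : Cn n → ℂ} (hf : HasCompactSupport f) (j : Fin n) :
    HasCompactSupport (dZbar j f) :=
  ((hf.fderiv_apply ℝ _).add ((hf.fderiv_apply ℝ _).mul_left (f := fun _ => Complex.I))).mul_left
    (f := fun _ => (1 / 2 : ℂ))

theorem continuous_magneticLaplacian {f : Cn n → ℂ} (hf : ContDiff ℝ 2 f) :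
    Continuous (magneticLaplacian f) := by
  have h1 : ∀ j, ContDiff ℝ 1 (dZbar j f) := fun j => contDiff_dZbar hf j
  have h2 : ∀ j, Continuous (dZ j (dZbar j f)) := fun j =>
    (contDiff_dZ (k := 0) (by simpa using h1 j) j).continuous
  have h3 : ∀ j, Continuous (dZbar j f) := fun j => (h1 j).continuous
  unfold magneticLaplacian
  fun_prop

theorem hasCompactSupport_magneticLaplacian {f : Cn n → ℂ} (hf : HasCompactSupport f) :
    HasCompactSupport (magneticLaplacian f) := by
  refine hf.mono' fun x hx => ?_
  by_contra hx'
  refine hx ?_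
  have h1 : ∀ j, dZbar j f x = 0 := fun j => by
    rw [dZbar, image_eq_zero_of_notMem_tsupport (fun h => hx' (tsupport_fderiv_subset ℝ h))]
    simp
  have h2 : ∀ j, dZ j (dZbar j f) x = 0 := fun j => by
    have : x ∉ tsupport (dZbar j f) := fun h => hx' <| by
      refine closure_minimal (fun y hy => ?_) (isClosed_tsupport f) h
      by_contra hy'
      refine hy ?_
      rw [dZbar, image_eq_zero_of_notMem_tsupport (fun h => hy' (tsupport_fderiv_subset ℝ h))]
      simp
    rw [dZ, image_eq_zero_of_notMem_tsupport (fun h => this (tsupport_fderiv_subset ℝ h))]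
    simp
  simp [magneticLaplacian, h1, h2]

/-- The weight `e^{⟨a, w⟩ - |w|²}`. -/
noncomputable def antiWeight (a w : Cn n) : ℂ :=
  antiExp a w * radial 0 (fun r => Real.exp (-r)) w

theorem contDiff_antiWeight {k : WithTop ℕ∞} (a : Cn n) : ContDiff ℝ k (antiWeight a) :=
  (contDiff_antiExp a).mul (contDiff_radial 0 (by fun_prop))

theorem antiWeight_eq (a w : Cn n) :
    antiWeight a w = antiExp a w * ((Real.exp (-‖w‖ ^ 2) : ℝ) : ℂ) := by
  simp [antiWeight, radial]

theorem deriv_exp_neg : deriv (fun r : ℝ => Real.exp (-r)) = fun r => -Real.exp (-r) := by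
  funext r
  simpa using (((hasDerivAt_id r).neg).exp).deriv

theorem dZ_antiWeight (a : Cn n) (j : Fin n) (w : Cn n) :
    dZ j (antiWeight a) w = -(starRingEnd ℂ) (w j) * antiWeight a w := by
  have hd : Differentiable ℝ fun r : ℝ => Real.exp (-r) := by fun_prop
  unfold antiWeight
  rw [dZ_mul (hasFDerivAt_antiExp a w).differentiableAt (differentiable_radial 0 hd w),
    dZ_antiExp, dZ_radial 0 hd, deriv_exp_neg]
  simp [radial]
  ring

theorem dZbar_antiWeight (a : Cn n) (j : Fin n) (w : Cn n) :
    dZbar j (antiWeight a) w = (a j - w j) * antiWeight a w := by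
  have hd : Differentiable ℝ fun r : ℝ => Real.exp (-r) := by fun_prop
  unfold antiWeight
  rw [dZbar_mul (hasFDerivAt_antiExp a w).differentiableAt (differentiable_radial 0 hd w),
    dZbar_antiExp, dZbar_radial 0 hd, deriv_exp_neg]
  simp [radial]
  ring

/-- The magnetic Laplacian is symmetric for the Gaussian weight. -/
theorem integral_magneticLaplacian_mul {η : Cn n → ℂ} (hη : ContDiff ℝ 2 η)
    (hs : HasCompactSupport η) (a : Cn n) {ρ : ℝ → ℝ} (hρ : ContDiff ℝ 2 ρ) :
    ∫ w, magneticLaplacian η w * (antiWeight a w * radial a ρ w)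
      = ∫ w, η w * (antiWeight a w * radial a (radialLaplacian n ρ) w) := by
  have hρ1 : ContDiff ℝ 1 (deriv ρ) := hρ.deriv'
  have hd : Differentiable ℝ ρ := hρ.differentiable two_ne_zero
  have hd' : Differentiable ℝ (deriv ρ) := hρ1.differentiable one_ne_zero
  have hW : Differentiable ℝ (antiWeight a) := (contDiff_antiWeight (k := 1) a).differentiable
    one_ne_zero
  have hg : ContDiff ℝ 1 fun w => antiWeight a w * radial a ρ w :=
    (contDiff_antiWeight a).mul ((contDiff_radial a hρ).of_le one_le_two)
  have hc : ∀ j : Fin n, ContDiff ℝ 1 fun w : Cn n => (starRingEnd ℂ) (w j - a j) := fun j =>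
    Complex.conjCLE.contDiff.comp (((EuclideanSpace.proj (𝕜 := ℂ) j).restrictScalars
      ℝ).contDiff.sub contDiff_const)
  have hh : ∀ j, ContDiff ℝ 1 fun w => antiWeight a w * (radial a (deriv ρ) w *
      (starRingEnd ℂ) (w j - a j)) := fun j =>
    (contDiff_antiWeight a).mul ((contDiff_radial a hρ1).mul (hc j))
  have hη1 : ContDiff ℝ 1 η := hη.of_le one_le_two
  have hb1 : ∀ j, ContDiff ℝ 1 (dZbar j η) := fun j => contDiff_dZbar hη j
  have hbs : ∀ j, HasCompactSupport (dZbar j η) := fun j => hasCompactSupport_dZbar hs j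
  have hz0 : ∀ j, Continuous (dZ j (dZbar j η)) := fun j =>
    (contDiff_dZ (k := 0) (by simpa using hb1 j) j).continuous
  -- Differentiating the Gaussian weight produces -w̄_j, which cancels the drift term after the
  -- first integration by parts; a second one, with ∂/∂z̄_j, completes the transfer.
  have hdZ : ∀ j w, dZ j (fun w => antiWeight a w * radial a ρ w) w
      = antiWeight a w * (radial a (deriv ρ) w * (starRingEnd ℂ) (w j - a j))
        - (starRingEnd ℂ) (w j) * (antiWeight a w * radial a ρ w) := fun j w => by
    rw [dZ_mul (hW w) (differentiable_radial a hd w), dZ_antiWeight, dZ_radial a hd]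
    ring
  have hdZb : ∀ j w, dZbar j (fun w => antiWeight a w * (radial a (deriv ρ) w *
      (starRingEnd ℂ) (w j - a j))) w = antiWeight a w *
        ((radial a (deriv (deriv ρ)) w - radial a (deriv ρ) w)
          * ((starRingEnd ℂ) (w j - a j) * (w j - a j)) + radial a (deriv ρ) w) := fun j w => by
    have h1 := differentiable_radial a hd' w
    have h2 := (hasFDerivAt_conj_coord_sub (a j) j w).differentiableAt
    rw [dZbar_mul (hW w) (h1.fun_mul h2), dZbar_mul h1 h2, dZbar_antiWeight, dZbar_radial a hd',
      dZbar_conj_coord_sub]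
    ring
  have key : ∀ j, ∫ w, (-dZ j (dZbar j η) w + (starRingEnd ℂ) (w j) * dZbar j η w)
        * (antiWeight a w * radial a ρ w)
      = -∫ w, η w * dZbar j (fun w => antiWeight a w * (radial a (deriv ρ) w *
      (starRingEnd ℂ) (w j - a j))) w := by
    intro j
    have hI1 : Integrable fun w => dZ j (dZbar j η) w * (antiWeight a w * radial a ρ w) :=
      ((hz0 j).mul hg.continuous).integrable_of_hasCompactSupport
        (hasCompactSupport_dZ (hbs j) j).mul_right
    have hI2 : Integrable fun w => dZbar j η w *
        ((starRingEnd ℂ) (w j) * (antiWeight a w * radial a ρ w)) := by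
      have := hg.continuous
      exact ((hb1 j).continuous.mul (by fun_prop)).integrable_of_hasCompactSupport
        (hbs j).mul_right
    have hI3 : Integrable fun w => dZbar j η w * dZ j (fun w => antiWeight a w * radial a ρ w) w :=
      ((hb1 j).continuous.mul (contDiff_dZ (k := 0) (by simpa using hg) j).continuous
        ).integrable_of_hasCompactSupport (hbs j).mul_right
    rw [← integral_dZbar_mul_eq_neg hη1 (hh j) hs j]
    have e1 : ∀ w, (-dZ j (dZbar j η) w + (starRingEnd ℂ) (w j) * dZbar j η w)
        * (antiWeight a w * radial a ρ w) = -(dZ j (dZbar j η) w * (antiWeight a w * radial a ρ w))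
        + dZbar j η w * ((starRingEnd ℂ) (w j) * (antiWeight a w * radial a ρ w)) := fun w => by ring
    simp only [e1]
    rw [integral_add hI1.fun_neg hI2, integral_neg, integral_dZ_mul_eq_neg (hb1 j) hg (hbs j), neg_neg,
      ← integral_add hI3 hI2]
    refine integral_congr_ae (Filter.Eventually.of_forall fun w => ?_)
    simp only [hdZ]
    ring
  have hI : ∀ j, Integrable fun w => (-dZ j (dZbar j η) w + (starRingEnd ℂ) (w j) * dZbar j η w)
        * (antiWeight a w * radial a ρ w) := fun j => by
    have h1 := hz0 j
    have h2 := (hb1 j).continuous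
    have h3 := hg.continuous
    refine Continuous.integrable_of_hasCompactSupport (by fun_prop) ?_
    exact (((hasCompactSupport_dZ (hbs j) j).neg).add (hbs j).mul_left).mul_right
  have hJ : ∀ j, Integrable fun w => η w * dZbar j (fun w => antiWeight a w *
      (radial a (deriv ρ) w * (starRingEnd ℂ) (w j - a j))) w := fun j =>
    (hη.continuous.mul (contDiff_dZbar (k := 0) (by simpa using hh j) j).continuous
      ).integrable_of_hasCompactSupport hs.mul_right
  have e2 : ∀ w, magneticLaplacian η w * (antiWeight a w * radial a ρ w)
      = ∑ j, (-dZ j (dZbar j η) w + (starRingEnd ℂ) (w j) * dZbar j η w)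
        * (antiWeight a w * radial a ρ w) := fun w => by
    rw [magneticLaplacian, ← Finset.sum_neg_distrib, ← Finset.sum_add_distrib, Finset.sum_mul]
  simp only [e2]
  rw [integral_finsetSum _ fun j _ => hI j, Finset.sum_congr rfl fun j _ => key j,
    Finset.sum_neg_distrib, ← integral_finsetSum _ fun j _ => hJ j, ← integral_neg]
  refine integral_congr_ae (Filter.Eventually.of_forall fun w => ?_)
  simp only [hdZb]
  rw [← Finset.mul_sum, ← Finset.mul_sum, Finset.sum_add_distrib, ← Finset.mul_sum]
  have hs := sum_conj_mul_self (w - a)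
  simp only [PiLp.sub_apply] at hs
  rw [hs]
  simp only [Finset.sum_const, Finset.card_univ, Fintype.card_fin, radialLaplacian, radial,
    nsmul_eq_mul]
  push_cast
  ring

end Symmetry

/-! ### The Gaussian measure and growth estimates -/

section GaussianWeight

variable {n : ℕ}

theorem gaussianWeight_absolutelyContinuous : gaussianWeight n ≪ volume :=
  withDensity_absolutelyContinuous _ _

theorem absolutelyContinuous_gaussianWeight : (volume : Measure (Cn n)) ≪ gaussianWeight n :=
  withDensity_absolutelyContinuous' (by fun_prop)
    (Filter.Eventually.of_forall fun z => by simp [Real.exp_pos])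

theorem ae_gaussianWeight_iff {p : Cn n → Prop} :
    (∀ᵐ z ∂gaussianWeight n, p z) ↔ ∀ᵐ z, p z :=
  ⟨fun h => absolutelyContinuous_gaussianWeight.ae_le h,
    fun h => gaussianWeight_absolutelyContinuous.ae_le h⟩

theorem integral_gaussianWeight_eq_smul {E : Type*} [NormedAddCommGroup E] [NormedSpace ℝ E]
    (f : Cn n → E) : ∫ z, f z ∂gaussianWeight n = ∫ z, Real.exp (-‖z‖ ^ 2) • f z := by
  rw [gaussianWeight, integral_withDensity_eq_integral_toReal_smul (by fun_prop)
    (Filter.Eventually.of_forall fun z => ENNReal.ofReal_lt_top)]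
  refine integral_congr_ae (Filter.Eventually.of_forall fun z => ?_)
  simp only [ENNReal.toReal_ofReal (Real.exp_pos _).le]

theorem integral_gaussianWeight (f : Cn n → ℂ) :
    ∫ z, f z ∂gaussianWeight n = ∫ z, ((Real.exp (-‖z‖ ^ 2) : ℝ) : ℂ) * f z := by
  simp only [integral_gaussianWeight_eq_smul, Complex.real_smul]

theorem integrable_gaussianWeight_iff {E : Type*} [NormedAddCommGroup E] [NormedSpace ℝ E]
    {f : Cn n → E} :
    Integrable f (gaussianWeight n) ↔ Integrable fun z => Real.exp (-‖z‖ ^ 2) • f z := by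
  rw [gaussianWeight, integrable_withDensity_iff_integrable_smul' (by fun_prop)
    (Filter.Eventually.of_forall fun z => ENNReal.ofReal_lt_top)]
  refine integrable_congr (Filter.Eventually.of_forall fun z => ?_)
  simp only [ENNReal.toReal_ofReal (Real.exp_pos _).le]

/-- The threshold 1/2 appears because |f|² e^{-|z|²} is at most C² e^{-(1-2c)|z|²}. -/
theorem memLp_gaussianWeight_of_norm_le {f : Cn n → ℂ} (hf : AEStronglyMeasurable f volume)
    {C c : ℝ} (hc : c < 1 / 2) (h : ∀ z, ‖f z‖ ≤ C * Real.exp (c * ‖z‖ ^ 2)) :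
    MemLp f 2 (gaussianWeight n) := by
  have hf' : AEStronglyMeasurable f (gaussianWeight n) :=
    hf.mono_ac gaussianWeight_absolutelyContinuous
  rw [memLp_two_iff_integrable_sq_norm hf', integrable_gaussianWeight_iff]
  refine integrable_of_norm_le_exp_neg (C := C ^ 2) (c := 1 - 2 * c) (by fun_prop) (by linarith)
    fun z => ?_
  rw [smul_eq_mul, norm_mul, Real.norm_eq_abs, abs_of_pos (Real.exp_pos _), norm_pow, norm_norm]
  calc Real.exp (-‖z‖ ^ 2) * ‖f z‖ ^ 2
      ≤ Real.exp (-‖z‖ ^ 2) * (C * Real.exp (c * ‖z‖ ^ 2)) ^ 2 := by gcongr; exact h z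
    _ = C ^ 2 * Real.exp (-(1 - 2 * c) * ‖z‖ ^ 2) := by
      rw [mul_pow, ← Real.exp_nat_mul, mul_left_comm, ← Real.exp_add]
      congr 2
      push_cast
      ring

theorem memLp_gaussianWeight_of_hasCompactSupport {f : Cn n → ℂ} (hf : Continuous f)
    (hs : HasCompactSupport f) : MemLp f 2 (gaussianWeight n) := by
  obtain ⟨C, hC⟩ := hs.exists_bound_of_continuous hf
  exact memLp_gaussianWeight_of_norm_le hf.aestronglyMeasurable (C := C) (c := 0) (by norm_num)
    fun z => by simpa using hC z

theorem norm_holExp_le (a w : Cn n) :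
    ‖holExp a w‖ ≤ Real.exp (2 * ‖a‖ ^ 2 + 1 / 8 * ‖w‖ ^ 2) := by
  rw [holExp, Complex.norm_exp]
  refine Real.exp_le_exp.mpr (((Complex.re_le_norm _).trans (norm_inner_le_norm a w)).trans ?_)
  nlinarith [sq_nonneg (4 * ‖a‖ - ‖w‖)]

/-- A function `e^{⟨w, a⟩} F(|w - a|²)` with `F` of slow exponential growth is bounded by a
multiple of `e^{3|w|²/8}`. -/
theorem norm_holExp_mul_le {a w : Cn n} {c : ℂ} {K : ℝ}
    (h : ‖c‖ ≤ K * Real.exp (1 / 8 * ‖w - a‖ ^ 2)) :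
    ‖holExp a w * c‖ ≤ K * Real.exp (3 * ‖a‖ ^ 2) * Real.exp (3 / 8 * ‖w‖ ^ 2) := by
  have hK : 0 ≤ K := by
    by_contra hK
    have := (norm_nonneg c).trans h
    nlinarith [Real.exp_pos (1 / 8 * ‖w - a‖ ^ 2)]
  rw [norm_mul]
  calc ‖holExp a w‖ * ‖c‖
      ≤ Real.exp (2 * ‖a‖ ^ 2 + 1 / 8 * ‖w‖ ^ 2) * (K * Real.exp (1 / 8 * ‖w - a‖ ^ 2)) :=
        mul_le_mul (norm_holExp_le a w) h (norm_nonneg _) (Real.exp_pos _).le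
    _ = K * Real.exp (2 * ‖a‖ ^ 2 + 1 / 8 * ‖w‖ ^ 2 + 1 / 8 * ‖w - a‖ ^ 2) := by
        rw [mul_left_comm, ← Real.exp_add]
    _ ≤ K * Real.exp (3 * ‖a‖ ^ 2 + 3 / 8 * ‖w‖ ^ 2) := by
        refine mul_le_mul_of_nonneg_left (Real.exp_le_exp.mpr ?_) hK
        -- From |w-a|² ≤ 2|w|² + 2|a|², the exponent of |w|² is at most 1/8 + 2/8 = 3/8, below the
        -- threshold 1/2.
        have := norm_sub_le w a
        nlinarith [sq_nonneg (‖w‖ - ‖a‖), norm_nonneg (w - a), norm_nonneg w, norm_nonneg a,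
          sq_nonneg ‖a‖]
    _ = _ := by rw [Real.exp_add, mul_assoc]

theorem exists_norm_holExp_mul_radial_le (a : Cn n) (p : Polynomial ℝ) :
    ∃ C, ∀ w, ‖holExp a w * radial a (fun r => p.eval r) w‖ ≤ C * Real.exp (3 / 8 * ‖w‖ ^ 2) := by
  obtain ⟨K, hK, h⟩ := p.exists_abs_eval_le_exp (δ := 1 / 8) (by norm_num)
  refine ⟨K * Real.exp (3 * ‖a‖ ^ 2), fun w => norm_holExp_mul_le ?_⟩
  rw [radial, Complex.norm_real]
  exact h _ (by positivity)

theorem Polynomial.contDiff_eval {k : WithTop ℕ∞} (p : Polynomial ℝ) :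
    ContDiff ℝ k fun r : ℝ => p.eval r := by
  simpa using p.contDiff_aeval (R := ℝ) (𝕜 := ℝ) k

theorem memLp_holExp_mul_radial (a : Cn n) (p : Polynomial ℝ) :
    MemLp (fun w => holExp a w * radial a (fun r => p.eval r) w) 2 (gaussianWeight n) := by
  obtain ⟨C, h⟩ := exists_norm_holExp_mul_radial_le a p
  exact memLp_gaussianWeight_of_norm_le (((contDiff_holExp (k := 0) a).continuous.mul
    (contDiff_radial (k := 0) a p.contDiff_eval).continuous).aestronglyMeasurable) (by norm_num) h

end GaussianWeight

/-! ### The kernel functions as elements of the Bargmann–Fock space -/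

section BargmannFock

variable {n : ℕ}

/-- Orthogonality to the span unfolds to the weak equation because (Δ̃ - m)η is continuous with
compact support, hence itself defines a class in L². -/
theorem mem_bargmannFock_iff {m : ℕ} {ψ : Lp ℂ 2 (gaussianWeight n)} :
    ψ ∈ bargmannFock n m ↔ ∀ η : Cn n → ℂ, ContDiff ℝ ∞ η → HasCompactSupport η →
      ∫ w, (starRingEnd ℂ) (magneticLaplacian η w - m * η w) * ψ w ∂gaussianWeight n = 0 := by
  have hinner : ∀ (u : Lp ℂ 2 (gaussianWeight n)) (v : Cn n → ℂ), u =ᵐ[gaussianWeight n] v →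
      ⟪u, ψ⟫ = ∫ w, (starRingEnd ℂ) (v w) * ψ w ∂gaussianWeight n := by
    intro u v huv
    rw [L2.inner_def]
    refine integral_congr_ae ?_
    filter_upwards [huv] with w hw
    rw [hw]
    simp [mul_comm]
  rw [bargmannFock]
  constructor
  · intro h η hη hs
    have hc : Continuous fun w => magneticLaplacian η w - (m : ℂ) * η w :=
      (continuous_magneticLaplacian (contDiff_infty.mp hη 2)).sub
        (continuous_const.mul hη.continuous)
    have hcs : HasCompactSupport fun w => magneticLaplacian η w - (m : ℂ) * η w :=
      (hasCompactSupport_magneticLaplacian hs).sub hs.mul_left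
    have hm := memLp_gaussianWeight_of_hasCompactSupport hc hcs
    rw [← hinner _ _ hm.coeFn_toLp]
    exact (Submodule.mem_orthogonal _ _).mp h _
      (Submodule.subset_span ⟨η, hη, hs, hm.coeFn_toLp⟩)
  · intro h
    refine (Submodule.mem_orthogonal _ _).mpr fun u hu => ?_
    induction hu using Submodule.span_induction with
    | mem u hu =>
      obtain ⟨η, hη, hs, hu⟩ := hu
      rw [hinner _ _ hu]
      exact h η hη hs
    | zero => exact inner_zero_left _
    | add u v _ _ hu hv => rw [inner_add_left, hu, hv, add_zero]
    | smul c u _ hu => rw [inner_smul_left, hu, mul_zero]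

/-- The function `w ↦ π⁻ⁿ e^{⟨w, a⟩} L_j^{(n-1)}(|w - a|²)`. -/
noncomputable def landauKernelFun (n j : ℕ) (a w : Cn n) : ℂ :=
  (((Real.pi ^ n)⁻¹ : ℝ) : ℂ) * (holExp a w * radial a (laguerre j (n - 1)) w)

theorem laguerre_eq_eval (j α : ℕ) : laguerre j α = fun r => (laguerrePoly j α).eval r :=
  funext fun r => (eval_laguerrePoly j α r).symm

theorem memLp_landauKernelFun (n j : ℕ) (a : Cn n) :
    MemLp (landauKernelFun n j a) 2 (gaussianWeight n) := by
  have := (memLp_holExp_mul_radial a (laguerrePoly j (n - 1))).const_mul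
    (((Real.pi ^ n)⁻¹ : ℝ) : ℂ)
  rw [← laguerre_eq_eval] at this
  exact this

/-- The reproducing kernel of the Landau level `j`. -/
noncomputable def landauKernel (n j : ℕ) (a : Cn n) : Lp ℂ 2 (gaussianWeight n) :=
  (memLp_landauKernelFun n j a).toLp _

theorem coeFn_landauKernel (n j : ℕ) (a : Cn n) :
    landauKernel n j a =ᵐ[gaussianWeight n] landauKernelFun n j a :=
  (memLp_landauKernelFun n j a).coeFn_toLp

theorem radialLaplacian_laguerre (hn : 1 ≤ n) (j : ℕ) (r : ℝ) :
    radialLaplacian n (laguerre j (n - 1)) r = j * laguerre j (n - 1) r := by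
  obtain ⟨α, rfl⟩ : ∃ α, n = α + 1 := ⟨n - 1, by omega⟩
  have h := congrArg (Polynomial.eval r) (laguerrePoly_ode j α)
  simp only [Polynomial.eval_add, Polynomial.eval_mul, Polynomial.eval_X, Polynomial.eval_sub,
    Polynomial.eval_C, Polynomial.eval_zero] at h
  have hd : ∀ p : Polynomial ℝ, deriv (fun r => p.eval r) = fun r => p.derivative.eval r :=
    fun p => funext fun r => p.deriv
  rw [radialLaplacian, Nat.add_sub_cancel, laguerre_eq_eval, hd, hd]
  push_cast
  linarith

/-- Symmetry moves Δ̃ from η to the kernel function, where the Laguerre equation gives the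
eigenvalue m. -/
theorem landauKernel_mem (hn : 1 ≤ n) (m : ℕ) (a : Cn n) :
    landauKernel n m a ∈ bargmannFock n m := by
  refine mem_bargmannFock_iff.mpr fun η hη hs => ?_
  have hη2 : ContDiff ℝ 2 η := contDiff_infty.mp hη 2
  have hρ : ContDiff ℝ 2 (laguerre m (n - 1)) := by
    rw [laguerre_eq_eval]
    exact (Polynomial.contDiff_eval _)
  have hsym := integral_magneticLaplacian_mul hη2 hs a hρ
  have hr : radialLaplacian n (laguerre m (n - 1)) = fun r => (m : ℝ) * laguerre m (n - 1) r :=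
    funext (radialLaplacian_laguerre hn m)
  rw [hr] at hsym
  have hcont : Continuous fun w => antiWeight a w * radial a (laguerre m (n - 1)) w :=
    ((contDiff_antiWeight (k := 2) a).mul (contDiff_radial a hρ)).continuous
  have h0 : ∫ w, (magneticLaplacian η w - m * η w) *
      (antiWeight a w * radial a (laguerre m (n - 1)) w) = 0 := by
    simp only [sub_mul]
    rw [integral_sub, hsym, sub_eq_zero]
    · refine integral_congr_ae (Filter.Eventually.of_forall fun w => ?_)
      simp only [radial]
      push_cast
      ring
    · exact ((continuous_magneticLaplacian hη2).mul hcont).integrable_of_hasCompactSupport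
        (hasCompactSupport_magneticLaplacian hs).mul_right
    · exact ((continuous_const.mul hη.continuous).mul hcont).integrable_of_hasCompactSupport
        hs.mul_left.mul_right
  have e : ∫ w, (starRingEnd ℂ) (magneticLaplacian η w - m * η w) * landauKernel n m a w
      ∂gaussianWeight n = ∫ w, (starRingEnd ℂ) (magneticLaplacian η w - m * η w) *
        landauKernelFun n m a w ∂gaussianWeight n := by
    refine integral_congr_ae ?_
    filter_upwards [coeFn_landauKernel n m a] with w hw
    rw [hw]
  rw [e, integral_gaussianWeight]
  have e2 : ∀ w, ((Real.exp (-‖w‖ ^ 2) : ℝ) : ℂ) *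
      ((starRingEnd ℂ) (magneticLaplacian η w - m * η w) * landauKernelFun n m a w)
      = (((Real.pi ^ n)⁻¹ : ℝ) : ℂ) * (starRingEnd ℂ) ((magneticLaplacian η w - m * η w) *
      (antiWeight a w * radial a (laguerre m (n - 1)) w)) := by
    intro w
    rw [antiWeight_eq, ← conj_holExp, landauKernelFun, map_mul, map_mul, map_mul, radial,
      Complex.conj_conj, Complex.conj_ofReal, Complex.conj_ofReal]
    ring
  simp only [e2]
  rw [integral_const_mul, integral_conj, h0, map_zero, mul_zero]

end BargmannFock

/-! ### Cutoffs and orthogonality to the other Landau levels -/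

section Cutoff

variable {n : ℕ}

/-- A smooth cutoff function on the line. -/
noncomputable def lineCutoff : ContDiffBump (0 : ℝ) := ⟨1, 2, one_pos, one_lt_two⟩

theorem contDiff_lineCutoff {k : ℕ∞} : ContDiff ℝ k lineCutoff := lineCutoff.contDiff

theorem contDiff_deriv_lineCutoff {k : ℕ} : ContDiff ℝ k (deriv lineCutoff) :=
  ((contDiff_lineCutoff (k := ((k + 1 : ℕ) : ℕ∞))).of_le (by simp)).deriv'

theorem exists_bound_lineCutoff : ∃ M, ∀ x, |lineCutoff x| ≤ M ∧ |deriv lineCutoff x| ≤ M ∧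
    |deriv (deriv lineCutoff) x| ≤ M := by
  have hs : HasCompactSupport lineCutoff := lineCutoff.hasCompactSupport
  obtain ⟨M0, h0⟩ := hs.exists_bound_of_continuous (contDiff_lineCutoff (k := 0)).continuous
  obtain ⟨M1, h1⟩ := hs.deriv.exists_bound_of_continuous
    (contDiff_deriv_lineCutoff (k := 0)).continuous
  obtain ⟨M2, h2⟩ := hs.deriv.deriv.exists_bound_of_continuous
    ((contDiff_deriv_lineCutoff (k := 1)).continuous_deriv (by simp))
  exact ⟨max M0 (max M1 M2), fun x => ⟨(h0 x).trans (le_max_left _ _),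
    (h1 x).trans ((le_max_left _ _).trans (le_max_right _ _)),
    (h2 x).trans ((le_max_right _ _).trans (le_max_right _ _))⟩⟩

/-- The profile `p` cut off at distance `1 / t`. -/
noncomputable def cutoffProfile (p : Polynomial ℝ) (t r : ℝ) : ℝ := p.eval r * lineCutoff (t * r)

theorem contDiff_cutoffProfile (p : Polynomial ℝ) (t : ℝ) : ContDiff ℝ ∞ (cutoffProfile p t) :=
  p.contDiff_eval.mul ((contDiff_lineCutoff (k := ⊤)).comp (contDiff_const.mul contDiff_id))

theorem hasDerivAt_comp_const_mul {f : ℝ → ℝ} (hf : Differentiable ℝ f) (t r : ℝ) :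
    HasDerivAt (fun r => f (t * r)) (t * deriv f (t * r)) r := by
  have h1 : HasDerivAt (fun r => t * r) t r := by simpa using (hasDerivAt_id r).const_mul t
  exact ((hf (t * r)).hasDerivAt.comp r h1).congr_deriv (mul_comm _ _)

theorem deriv_cutoffProfile (p : Polynomial ℝ) (t : ℝ) :
    deriv (cutoffProfile p t) = fun r => p.derivative.eval r * lineCutoff (t * r)
      + p.eval r * (t * deriv lineCutoff (t * r)) := by
  funext r
  have h1 : HasDerivAt (fun r => lineCutoff (t * r)) (t * deriv lineCutoff (t * r)) r := by
    exact hasDerivAt_comp_const_mul ((contDiff_lineCutoff (k := 1)).differentiable (by simp)) t r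
  exact ((p.hasDerivAt r).mul h1).deriv

theorem deriv_deriv_cutoffProfile (p : Polynomial ℝ) (t : ℝ) :
    deriv (deriv (cutoffProfile p t)) = fun r =>
      p.derivative.derivative.eval r * lineCutoff (t * r)
      + 2 * (p.derivative.eval r * (t * deriv lineCutoff (t * r)))
      + p.eval r * (t ^ 2 * deriv (deriv lineCutoff) (t * r)) := by
  funext r
  have h1 : HasDerivAt (fun r => lineCutoff (t * r)) (t * deriv lineCutoff (t * r)) r := by
    exact hasDerivAt_comp_const_mul ((contDiff_lineCutoff (k := 1)).differentiable (by simp)) t r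
  have h2 : HasDerivAt (fun r => deriv lineCutoff (t * r))
      (t * deriv (deriv lineCutoff) (t * r)) r := by
    exact hasDerivAt_comp_const_mul
      ((contDiff_deriv_lineCutoff (k := 1)).differentiable (by simp)) t r
  rw [deriv_cutoffProfile]
  refine ((((p.derivative.hasDerivAt r).mul h1).add
    ((p.hasDerivAt r).mul (h2.const_mul t))).deriv).trans ?_
  ring

/-- The polynomial factors of the radial Laplacian of a profile that is cut off. -/
theorem radialLaplacian_cutoffProfile (hn : 1 ≤ n) (j : ℕ) (c t r : ℝ) :
    radialLaplacian n (cutoffProfile (laguerrePoly j (n - 1)) t) r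
        - c * cutoffProfile (laguerrePoly j (n - 1)) t r
      = (Polynomial.C ((j : ℝ) - c) * laguerrePoly j (n - 1)).eval r * lineCutoff (t * r)
        + t * ((((Polynomial.X - Polynomial.C (n : ℝ)) * laguerrePoly j (n - 1)
          - 2 * Polynomial.X * (laguerrePoly j (n - 1)).derivative).eval r)
          * deriv lineCutoff (t * r))
        + t ^ 2 * ((-Polynomial.X * laguerrePoly j (n - 1)).eval r
          * deriv (deriv lineCutoff) (t * r)) := by
  have h := radialLaplacian_laguerre hn j r
  have hd : ∀ p : Polynomial ℝ, deriv (fun r => p.eval r) = fun r => p.derivative.eval r :=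
    fun p => funext fun r => p.deriv
  rw [radialLaplacian, laguerre_eq_eval, hd, hd] at h
  rw [radialLaplacian, deriv_deriv_cutoffProfile, deriv_cutoffProfile, cutoffProfile]
  simp only [Polynomial.eval_mul, Polynomial.eval_X, Polynomial.eval_sub, Polynomial.eval_C,
    Polynomial.eval_neg, Polynomial.eval_ofNat]
  linear_combination (lineCutoff (t * r)) * h

theorem hasCompactSupport_holExp_mul_cutoff (a : Cn n) (p : Polynomial ℝ) {t : ℝ} (ht : 0 < t) :
    HasCompactSupport fun w => holExp a w * radial a (cutoffProfile p t) w := by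
  refine HasCompactSupport.mul_left (HasCompactSupport.intro
    -- The cutoff vanishes once t|w-a|² ≥ 2. The added 1 in the radius makes |w-a| > 1, so that
    -- |w-a|² ≥ |w-a| > 2/t.
    (isCompact_closedBall a (2 / t + 1)) fun w hw => ?_)
  have h1 : 2 / t + 1 < ‖w - a‖ := by simpa [dist_eq_norm] using hw
  have h2 : 0 < 2 / t := by positivity
  have h3 : lineCutoff (t * ‖w - a‖ ^ 2) = 0 := by
    refine lineCutoff.zero_of_le_dist ?_
    rw [Real.dist_eq, sub_zero, abs_of_nonneg (by positivity)]
    change (2 : ℝ) ≤ _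
    have : 2 / t ≤ ‖w - a‖ ^ 2 := by nlinarith
    rwa [div_le_iff₀' ht] at this
  simp [radial, cutoffProfile, h3]

theorem integral_cutoff_eq_zero {m : ℕ} (j : ℕ) {ψ : Lp ℂ 2 (gaussianWeight n)}
    (hψ : ψ ∈ bargmannFock n m) (a : Cn n) {t : ℝ} (ht : 0 < t) :
    ∫ w, (starRingEnd ℂ) (holExp a w * radial a (fun r =>
      radialLaplacian n (cutoffProfile (laguerrePoly j (n - 1)) t) r
        - m * cutoffProfile (laguerrePoly j (n - 1)) t r) w) * ψ w ∂gaussianWeight n = 0 := by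
  have hc := contDiff_cutoffProfile (laguerrePoly j (n - 1)) t
  have h := mem_bargmannFock_iff.mp hψ _ ((contDiff_holExp a).mul (contDiff_radial a hc))
    (hasCompactSupport_holExp_mul_cutoff a (laguerrePoly j (n - 1)) ht)
  rw [← h]
  refine integral_congr_ae (Filter.Eventually.of_forall fun w => ?_)
  have hc2 : ContDiff ℝ 2 (cutoffProfile (laguerrePoly j (n - 1)) t) := contDiff_infty.mp hc 2
  simp only
  rw [magneticLaplacian_holExp_mul_radial a (hc2.differentiable (by simp))
    ((ContDiff.deriv' (n := 1) hc2).differentiable (by simp))]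
  simp only [radial]
  push_cast
  ring_nf

/-- Uniformity in t ∈ (0, 1] holds because each derivative falling on the cutoff carries a factor t;
this is the majorant for removing the cutoff. -/
theorem exists_cutoff_bound (hn : 1 ≤ n) (j : ℕ) (c : ℝ) :
    ∃ K, ∀ t, 0 < t → t ≤ 1 → ∀ r, 0 ≤ r →
      |radialLaplacian n (cutoffProfile (laguerrePoly j (n - 1)) t) r
        - c * cutoffProfile (laguerrePoly j (n - 1)) t r| ≤ K * Real.exp (1 / 8 * r) := by
  obtain ⟨M, hM⟩ := exists_bound_lineCutoff
  have hM0 : 0 ≤ M := (abs_nonneg _).trans (hM 0).1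
  obtain ⟨K1, hK1, h1⟩ := (Polynomial.C ((j : ℝ) - c) * laguerrePoly j (n - 1)
    ).exists_abs_eval_le_exp (δ := 1 / 8) (by norm_num)
  obtain ⟨K2, hK2, h2⟩ := ((Polynomial.X - Polynomial.C (n : ℝ)) * laguerrePoly j (n - 1)
          - 2 * Polynomial.X * (laguerrePoly j (n - 1)).derivative
    ).exists_abs_eval_le_exp (δ := 1 / 8) (by norm_num)
  obtain ⟨K3, hK3, h3⟩ := (-Polynomial.X * laguerrePoly j (n - 1)
    ).exists_abs_eval_le_exp (δ := 1 / 8) (by norm_num)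
  refine ⟨(K1 + K2 + K3) * M, fun t ht0 ht1 r hr => ?_⟩
  rw [radialLaplacian_cutoffProfile hn]
  have hE := Real.exp_pos (1 / 8 * r)
  obtain ⟨m1, m2, m3⟩ := hM (t * r)
  have b1 := mul_le_mul (h1 r hr) m1 (abs_nonneg _) (by positivity)
  have b2 := mul_le_mul (h2 r hr) m2 (abs_nonneg _) (by positivity)
  have b3 := mul_le_mul (h3 r hr) m3 (abs_nonneg _) (by positivity)
  have ht2 : t ^ 2 ≤ 1 := pow_le_one₀ ht0.le ht1
  refine (abs_add_three _ _ _).trans ?_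
  rw [abs_mul, abs_mul t, abs_mul (t ^ 2), abs_of_pos ht0, abs_of_pos (pow_pos ht0 2), abs_mul,
    abs_mul (Polynomial.eval r (-Polynomial.X * laguerrePoly j (n - 1)))]
  have c2 := mul_le_of_le_one_left (mul_nonneg (abs_nonneg (Polynomial.eval r
    ((Polynomial.X - Polynomial.C (n : ℝ)) * laguerrePoly j (n - 1)
          - 2 * Polynomial.X * (laguerrePoly j (n - 1)).derivative)))
          (abs_nonneg (deriv lineCutoff (t * r)))) ht1
  have c3 := mul_le_of_le_one_left (mul_nonneg (abs_nonneg (Polynomial.eval r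
    (-Polynomial.X * laguerrePoly j (n - 1))))
          (abs_nonneg (deriv (deriv lineCutoff) (t * r)))) ht2
  nlinarith

theorem tendsto_cutoff (hn : 1 ≤ n) (j : ℕ) (c r : ℝ) :
    Filter.Tendsto (fun t => radialLaplacian n (cutoffProfile (laguerrePoly j (n - 1)) t) r
        - c * cutoffProfile (laguerrePoly j (n - 1)) t r) (nhds 0)
      (nhds (((j : ℝ) - c) * laguerre j (n - 1) r)) := by
  simp only [radialLaplacian_cutoffProfile hn]
  have h0 : Continuous lineCutoff := (contDiff_lineCutoff (k := 0)).continuous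
  have h1 : Continuous (deriv lineCutoff) := (contDiff_deriv_lineCutoff (k := 0)).continuous
  have h2 : Continuous (deriv (deriv lineCutoff)) :=
    (contDiff_deriv_lineCutoff (k := 1)).continuous_deriv (by simp)
  have hone : lineCutoff 0 = 1 := lineCutoff.one_of_mem_closedBall (by simp [lineCutoff])
  refine (Continuous.tendsto' (by fun_prop) _ _ ?_)
  simp [hone, eval_laguerrePoly]

theorem inner_landauKernel (a : Cn n) (j : ℕ) (ψ : Lp ℂ 2 (gaussianWeight n)) :
    ⟪landauKernel n j a, ψ⟫
      = ∫ w, (starRingEnd ℂ) (landauKernelFun n j a w) * ψ w ∂gaussianWeight n := by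
  rw [L2.inner_def]
  refine integral_congr_ae ?_
  filter_upwards [coeFn_landauKernel n j a] with w hw
  rw [hw]
  simp [mul_comm]

/-- The weak equation for ψ is tested on the cut-off kernel function of level j. As the cutoff is
removed, (Δ̃ - m) of it tends to (j - m) times an eigenfunction, and j - m can be divided out. -/
theorem inner_landauKernel_eq_zero (hn : 1 ≤ n) {m j : ℕ} (hjm : j ≠ m)
    {ψ : Lp ℂ 2 (gaussianWeight n)} (hψ : ψ ∈ bargmannFock n m) (a : Cn n) :
    ⟪landauKernel n j a, ψ⟫ = 0 := by
  obtain ⟨K, hK⟩ := exists_cutoff_bound hn j m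
  have hbound : MemLp (fun w : Cn n => ((K * Real.exp (3 * ‖a‖ ^ 2) *
      Real.exp (3 / 8 * ‖w‖ ^ 2) : ℝ) : ℂ)) 2 (gaussianWeight n) := by
    refine memLp_gaussianWeight_of_norm_le (C := |K * Real.exp (3 * ‖a‖ ^ 2)|) (c := 3 / 8)
      (by fun_prop) (by norm_num) fun w => ?_
    rw [Complex.norm_real, norm_mul, Real.norm_eq_abs, Real.norm_eq_abs,
      abs_of_pos (Real.exp_pos _)]
  have hlim := tendsto_integral_of_dominated_convergence (μ := gaussianWeight n)
    (F := fun (N : ℕ) w => (starRingEnd ℂ) (holExp a w * radial a (fun r =>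
      radialLaplacian n (cutoffProfile (laguerrePoly j (n - 1)) (1 / ((N : ℝ) + 1))) r
        - m * cutoffProfile (laguerrePoly j (n - 1)) (1 / ((N : ℝ) + 1)) r) w) * ψ w)
    (f := fun w => (starRingEnd ℂ) (holExp a w *
      ((((j : ℝ) - m) * laguerre j (n - 1) (‖w - a‖ ^ 2) : ℝ) : ℂ)) * ψ w)
    (fun w => ‖((K * Real.exp (3 * ‖a‖ ^ 2) * Real.exp (3 / 8 * ‖w‖ ^ 2) : ℝ) : ℂ) * ψ w‖)
    (fun N => ?_) (hbound.integrable_mul (Lp.memLp ψ)).norm (fun N => ?_) ?_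
  · have h0 := tendsto_nhds_unique (tendsto_const_nhds.congr fun N : ℕ =>
      (integral_cutoff_eq_zero j hψ a (t := 1 / ((N : ℝ) + 1)) (by positivity)).symm) hlim
    have e : ∀ w, (starRingEnd ℂ) (holExp a w *
        ((((j : ℝ) - m) * laguerre j (n - 1) (‖w - a‖ ^ 2) : ℝ) : ℂ)) * ψ w
        = (((j : ℝ) - m) * Real.pi ^ n : ℝ) *
          ((starRingEnd ℂ) (landauKernelFun n j a w) * ψ w) := by
      intro w
      have : (Real.pi : ℂ) ≠ 0 := by exact_mod_cast Real.pi_pos.ne'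
      simp only [landauKernelFun, radial, map_mul, Complex.conj_ofReal]
      push_cast
      field_simp
    simp only [e] at h0
    rw [integral_const_mul, ← inner_landauKernel] at h0
    refine (mul_eq_zero.mp h0.symm).resolve_left ?_
    have hsub : ((j : ℝ) - m) ≠ 0 := sub_ne_zero.mpr (by exact_mod_cast hjm)
    exact_mod_cast mul_ne_zero hsub (pow_pos Real.pi_pos n).ne'
  · have h1 := (contDiff_holExp (k := 0) a).continuous
    have h2 : Measurable fun r => radialLaplacian n (cutoffProfile (laguerrePoly j (n - 1))
      (1 / ((N : ℝ) + 1))) r - m * cutoffProfile (laguerrePoly j (n - 1)) (1 / ((N : ℝ) + 1)) r := by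
      have := (contDiff_cutoffProfile (laguerrePoly j (n - 1)) (1 / ((N : ℝ) + 1))).continuous
      unfold radialLaplacian
      fun_prop
    have h3 : Measurable fun w : Cn n => ‖w - a‖ ^ 2 := by fun_prop
    exact (Complex.continuous_conj.measurable.comp (h1.measurable.mul
      (Complex.measurable_ofReal.comp (h2.comp h3)))).aestronglyMeasurable.mul
      (Lp.aestronglyMeasurable ψ)
  · refine Filter.Eventually.of_forall fun w => ?_
    rw [norm_mul, norm_mul, RCLike.norm_conj, Complex.norm_real, Real.norm_eq_abs]
    refine mul_le_mul_of_nonneg_right ((norm_holExp_mul_le ?_).trans (le_abs_self _)) (norm_nonneg _)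
    rw [radial, Complex.norm_real]
    refine hK _ (by positivity) ?_ _ (by positivity)
    rw [div_le_one (by positivity)]
    have : (0 : ℝ) ≤ N := by positivity
    linarith
  · refine Filter.Eventually.of_forall fun w => ?_
    have h := (tendsto_cutoff hn j m (‖w - a‖ ^ 2)).comp
      (tendsto_one_div_add_atTop_nhds_zero_nat (𝕜 := ℝ))
    have h2 := (Complex.continuous_ofReal.tendsto _).comp h
    exact ((Complex.continuous_conj.tendsto _).comp (h2.const_mul _)).mul_const _

end Cutoff

/-! ### Generating function of the kernels (Mehler formula) -/

section Mehler

variable {n : ℕ}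

/-- Completing the square; this is the source of the translation invariance that makes the Berezin
transform a convolution. -/
theorem norm_holExp_sq_mul_exp (a w : Cn n) :
    Real.exp (-‖w‖ ^ 2) * ‖holExp a w‖ ^ 2 = Real.exp (‖a‖ ^ 2) * Real.exp (-‖w - a‖ ^ 2) := by
  rw [holExp, Complex.norm_exp, ← Real.exp_nat_mul, ← Real.exp_add, ← Real.exp_add]
  congr 1
  have h := norm_sub_sq (𝕜 := ℂ) w a
  rw [inner_re_symm] at h
  simp only [RCLike.re_to_complex] at h
  push_cast
  linarith

theorem integral_norm_sq_landauKernelFun (hn : 1 ≤ n) (j : ℕ) (a : Cn n) :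
    ∫ w, ‖landauKernelFun n j a w‖ ^ 2 ∂gaussianWeight n
      = (Real.pi ^ n)⁻¹ * Real.exp (‖a‖ ^ 2) * (j + (n - 1)).choose j := by
  obtain ⟨α, rfl⟩ : ∃ α, n = α + 1 := ⟨n - 1, by omega⟩
  rw [integral_gaussianWeight_eq_smul, Nat.add_sub_cancel]
  have e : ∀ w : Cn (α + 1), Real.exp (-‖w‖ ^ 2) • ‖landauKernelFun (α + 1) j a w‖ ^ 2
      = ((Real.pi ^ (α + 1))⁻¹) ^ 2 * Real.exp (‖a‖ ^ 2) *
        (Real.exp (-‖w - a‖ ^ 2) * laguerre j α (‖w - a‖ ^ 2) ^ 2) := by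
    intro w
    have h := norm_holExp_sq_mul_exp a w
    rw [landauKernelFun, norm_mul, norm_mul, radial, Complex.norm_real, Complex.norm_real,
      Real.norm_eq_abs, Real.norm_eq_abs, abs_of_pos (by positivity), mul_pow, mul_pow, sq_abs,
      smul_eq_mul, Nat.add_sub_cancel]
    linear_combination ((Real.pi ^ (α + 1))⁻¹) ^ 2 * laguerre j α (‖w - a‖ ^ 2) ^ 2 * h
  simp only [e]
  rw [integral_const_mul, integral_sub_right_eq_self
    (fun w : Cn (α + 1) => Real.exp (-‖w‖ ^ 2) * laguerre j α (‖w‖ ^ 2) ^ 2),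
    integral_laguerre_sq]
  have := Real.pi_pos.ne'
  field_simp

theorem integrable_conj_landauKernelFun_mul (j : ℕ) (a : Cn n) (ψ : Lp ℂ 2 (gaussianWeight n)) :
    Integrable (fun w => (starRingEnd ℂ) (landauKernelFun n j a w) * ψ w) (gaussianWeight n) :=
  (memLp_landauKernelFun n j a).star.integrable_mul (Lp.memLp ψ)

/-- Each product is at most |k|² + |ψ|², and the squared norm of the level-j kernel grows only like
binom(j+n-1, j), so t^j wins. -/
theorem summable_integral_norm_landau (hn : 1 ≤ n) (a : Cn n) (ψ : Lp ℂ 2 (gaussianWeight n))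
    {t : ℝ} (ht0 : 0 ≤ t) (ht1 : t < 1) :
    Summable fun j : ℕ => ∫ w, ‖((t ^ j : ℝ) : ℂ) *
      ((starRingEnd ℂ) (landauKernelFun n j a w) * ψ w)‖ ∂gaussianWeight n := by
  have hk : ∀ j, Integrable (fun w => ‖landauKernelFun n j a w‖ ^ 2) (gaussianWeight n) :=
    fun j => (memLp_two_iff_integrable_sq_norm (memLp_landauKernelFun n j a).1).mp
      (memLp_landauKernelFun n j a)
  have hψ : Integrable (fun w => ‖ψ w‖ ^ 2) (gaussianWeight n) :=
    (memLp_two_iff_integrable_sq_norm (Lp.memLp ψ).1).mp (Lp.memLp ψ)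
  set P := ∫ w, ‖ψ w‖ ^ 2 ∂gaussianWeight n
  have hs1 := (summable_choose_mul_geometric_of_norm_lt_one (n - 1) (r := t)
    (by rwa [Real.norm_eq_abs, abs_of_nonneg ht0])).mul_left
    ((Real.pi ^ n)⁻¹ * Real.exp (‖a‖ ^ 2))
  have hs2 := (summable_geometric_of_lt_one ht0 ht1).mul_right P
  refine Summable.of_nonneg_of_le (fun j => integral_nonneg fun w => norm_nonneg _) (fun j => ?_)
    (hs1.add hs2)
  have hle : ∀ w, ‖((t ^ j : ℝ) : ℂ) * ((starRingEnd ℂ) (landauKernelFun n j a w) * ψ w)‖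
      ≤ t ^ j * (‖landauKernelFun n j a w‖ ^ 2 + ‖ψ w‖ ^ 2) := by
    intro w
    rw [norm_mul, norm_mul, RCLike.norm_conj, Complex.norm_real, Real.norm_eq_abs,
      abs_of_nonneg (pow_nonneg ht0 j)]
    refine mul_le_mul_of_nonneg_left ?_ (pow_nonneg ht0 j)
    nlinarith [sq_nonneg (‖landauKernelFun n j a w‖ - ‖ψ w‖),
      sq_nonneg ‖landauKernelFun n j a w‖, sq_nonneg ‖ψ w‖]
  refine (integral_mono ((integrable_conj_landauKernelFun_mul j a ψ).const_mul _).norm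
    (((hk j).add hψ).const_mul _) hle).trans (le_of_eq ?_)
  rw [integral_const_mul]
  simp only [Pi.add_apply]
  rw [integral_add (hk j) hψ, integral_norm_sq_landauKernelFun hn]
  rw [Nat.choose_symm_add]
  ring

/-- The generating function is integrated term by term against ψ; orthogonality leaves only the
level m. -/
theorem integral_mehler (hn : 1 ≤ n) {m : ℕ} {ψ : Lp ℂ 2 (gaussianWeight n)}
    (hψ : ψ ∈ bargmannFock n m) (a : Cn n) {t : ℝ} (ht0 : 0 ≤ t) (ht1 : t < 1) :
    ∫ w, (((Real.pi ^ n)⁻¹ * (((1 - t) ^ n)⁻¹ * Real.exp (-(t / (1 - t)) * ‖w - a‖ ^ 2)) : ℝ) : ℂ)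
      * (antiExp a w * ψ w) ∂gaussianWeight n = ((t ^ m : ℝ) : ℂ) * ⟪landauKernel n m a, ψ⟫ := by
  obtain ⟨α, rfl⟩ : ∃ α, n = α + 1 := ⟨n - 1, by omega⟩
  have h := hasSum_integral_of_summable_integral_norm
    (fun j => (integrable_conj_landauKernelFun_mul j a ψ).const_mul ((t ^ j : ℝ) : ℂ))
    (summable_integral_norm_landau hn a ψ ht0 ht1)
  have h2 : ∀ j, ∫ w, ((t ^ j : ℝ) : ℂ) * ((starRingEnd ℂ) (landauKernelFun (α + 1) j a w) * ψ w)
      ∂gaussianWeight (α + 1) = ((t ^ j : ℝ) : ℂ) * ⟪landauKernel (α + 1) j a, ψ⟫ := fun j => by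
    rw [integral_const_mul, inner_landauKernel]
  have h3 : HasSum (fun j => ((t ^ j : ℝ) : ℂ) * ⟪landauKernel (α + 1) j a, ψ⟫)
      (((t ^ m : ℝ) : ℂ) * ⟪landauKernel (α + 1) m a, ψ⟫) :=
    hasSum_single m fun j hj => by rw [inner_landauKernel_eq_zero hn hj hψ, mul_zero]
  simp only [h2] at h
  rw [h3.unique h]
  refine integral_congr_ae (Filter.Eventually.of_forall fun w => ?_)
  have hab : |t| < 1 := by rwa [abs_of_nonneg ht0]
  have h4 := ((Complex.hasSum_ofReal.mpr ((hasSum_laguerre α (‖w - a‖ ^ 2) hab).mul_left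
    (Real.pi ^ (α + 1))⁻¹)).mul_right (antiExp a w * ψ w)).tsum_eq
  simp only
  rw [← h4]
  refine tsum_congr fun j => ?_
  rw [landauKernelFun, map_mul, map_mul, conj_holExp, radial, Complex.conj_ofReal,
    Complex.conj_ofReal, Nat.add_sub_cancel]
  push_cast
  ring

/-- The normalized Gaussian on `ℂⁿ`. -/
noncomputable def normalizedGaussian (n : ℕ) (c : ℝ) (v : Cn n) : ℝ :=
  (Real.pi * c) ^ n * Real.exp (-(Real.pi ^ 2 * c) * ‖v‖ ^ 2)

theorem normalizedGaussian_nonneg {c : ℝ} (hc : 0 < c) (v : Cn n) :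
    0 ≤ normalizedGaussian n c v := by
  have := Real.pi_pos
  unfold normalizedGaussian
  positivity

theorem continuous_normalizedGaussian (n : ℕ) (c : ℝ) : Continuous (normalizedGaussian n c) := by
  unfold normalizedGaussian
  fun_prop

theorem integrable_normalizedGaussian {c : ℝ} (hc : 0 < c) :
    Integrable (normalizedGaussian n c) :=
  (integrable_exp_neg_mul_sq_norm (by have := Real.pi_pos; positivity)).const_mul _

theorem integral_normalizedGaussian {c : ℝ} (hc : 0 < c) :
    ∫ v, normalizedGaussian n c v = 1 := by
  have hp := Real.pi_pos
  have h := integral_gaussian_mul_fourierKernel (n := n) (c := Real.pi ^ 2 * c) (by positivity) 0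
  simp only [fourierKernel, inner_zero_right, mul_zero, Complex.ofReal_zero, zero_mul,
    Complex.exp_zero, mul_one, norm_zero] at h
  rw [integral_complex_ofReal, Complex.ofReal_inj] at h
  simp only [normalizedGaussian]
  rw [integral_const_mul, h, ← mul_assoc, ← mul_pow]
  have : Real.pi * c * (Real.pi / (Real.pi ^ 2 * c)) = 1 := by field_simp
  rw [this]
  simp

theorem tendsto_integral_normalizedGaussian_mul {f : Cn n → ℂ} (hf : Integrable f) {v : Cn n}
    (hv : ContinuousAt f v) :
    Filter.Tendsto (fun c : ℝ => ∫ a, (normalizedGaussian n c (v - a) : ℂ) * f a) Filter.atTop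
      (nhds (f v)) := by
  refine (Real.tendsto_integral_gaussian_smul' hf hv).congr fun c => ?_
  refine integral_congr_ae (Filter.Eventually.of_forall fun a => ?_)
  simp only [normalizedGaussian, smul_eq_mul]
  rw [finrank_real_Cn]
  push_cast
  rw [mul_div_cancel_left₀ _ (two_ne_zero), Complex.cpow_natCast]
  congr 3
  ring

/-- Mehler's formula with t solving t/(1-t) = π²c. Normalizing the Gaussian to mass 1 costs the
extra factor t^n, and c → ∞ corresponds to t → 1. -/
theorem integral_normalizedGaussian_mul (hn : 1 ≤ n) {m : ℕ} {ψ : Lp ℂ 2 (gaussianWeight n)}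
    (hψ : ψ ∈ bargmannFock n m) (a : Cn n) {c : ℝ} (hc : 0 < c) :
    ∫ w, (normalizedGaussian n c (w - a) : ℂ) * (antiExp a w * ψ w) ∂gaussianWeight n
      = (((Real.pi ^ 2 * c / (1 + Real.pi ^ 2 * c)) ^ (m + n) : ℝ) : ℂ)
        * ⟪landauKernel n m a, ψ⟫ := by
  have hp := Real.pi_pos
  set t := Real.pi ^ 2 * c / (1 + Real.pi ^ 2 * c) with ht
  have ht0 : 0 < t := by positivity
  have ht1 : t < 1 := by rw [ht, div_lt_one (by positivity)]; linarith
  have h1t : 1 - t = 1 / (1 + Real.pi ^ 2 * c) := by rw [ht]; field_simp; ring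
  have htt : t / (1 - t) = Real.pi ^ 2 * c := by rw [h1t, ht]; field_simp
  have hg : ∀ v : Cn n, normalizedGaussian n c v = t ^ n *
      ((Real.pi ^ n)⁻¹ * (((1 - t) ^ n)⁻¹ * Real.exp (-(t / (1 - t)) * ‖v‖ ^ 2))) := by
    intro v
    rw [htt, normalizedGaussian, ← mul_assoc, ← mul_assoc, ← inv_pow, ← inv_pow, ← mul_pow,
      ← mul_pow]
    congr 2
    rw [h1t, ht]
    field_simp
  rw [pow_add, mul_comm (t ^ m), Complex.ofReal_mul, mul_assoc,
    ← integral_mehler hn hψ a ht0.le ht1, ← integral_const_mul]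
  refine integral_congr_ae (Filter.Eventually.of_forall fun w => ?_)
  simp only [hg]
  push_cast
  ring

end Mehler

/-! ### The reproducing property -/

section Reproducing

variable {n : ℕ}

instance sFinite_gaussianWeight : SFinite (gaussianWeight n) := by
  unfold gaussianWeight
  infer_instance

theorem memLp_exp_mul_sq_norm {c : ℝ} (hc : c < 1 / 2) :
    MemLp (fun w : Cn n => ((Real.exp (c * ‖w‖ ^ 2) : ℝ) : ℂ)) 2 (gaussianWeight n) := by
  refine memLp_gaussianWeight_of_norm_le (C := 1) (by fun_prop) hc fun w => ?_
  rw [Complex.norm_real, Real.norm_eq_abs, abs_of_pos (Real.exp_pos _), one_mul]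

theorem integrable_exp_mul_norm {c : ℝ} (hc : c < 1 / 2) (ψ : Lp ℂ 2 (gaussianWeight n)) :
    Integrable (fun w => Real.exp (c * ‖w‖ ^ 2) * ‖ψ w‖) (gaussianWeight n) := by
  refine ((memLp_exp_mul_sq_norm hc).integrable_mul (Lp.memLp ψ)).norm.congr
    (Filter.Eventually.of_forall fun w => ?_)
  simp only [Pi.mul_apply]
  rw [norm_mul, Complex.norm_real, Real.norm_eq_abs, abs_of_pos (Real.exp_pos _)]

theorem locallyIntegrable_of_Lp_gaussianWeight (ψ : Lp ℂ 2 (gaussianWeight n)) :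
    LocallyIntegrable ψ volume := by
  have h1 : Integrable ψ (gaussianWeight n) := by
    have h := (memLp_exp_mul_sq_norm (n := n) (c := 0) (by norm_num)).integrable_mul (Lp.memLp ψ)
    refine h.congr (Filter.Eventually.of_forall fun w => ?_)
    simp
  have h2 := (integrable_gaussianWeight_iff.mp h1).locallyIntegrable
  have h3 : Continuous fun w : Cn n => Real.exp (‖w‖ ^ 2) := by fun_prop
  have h4 := (locallyIntegrableOn_univ.mpr h2).continuousOn_smul isClosed_univ.isLocallyClosed
    h3.continuousOn
  refine (locallyIntegrableOn_univ.mp h4).congr (Filter.Eventually.of_forall fun w => ?_)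
  simp only
  rw [smul_smul, ← Real.exp_add]
  simp

/-- Dominated convergence, with the growth bound made uniform over the unit ball around a₀. This is
the continuous representative of ψ. -/
theorem continuous_inner_landauKernel (m : ℕ) (ψ : Lp ℂ 2 (gaussianWeight n)) :
    Continuous fun a => ⟪landauKernel n m a, ψ⟫ := by
  obtain ⟨K, hK, h⟩ := (laguerrePoly m (n - 1)).exists_abs_eval_le_exp (δ := 1 / 8) (by norm_num)
  simp only [inner_landauKernel]
  refine continuous_iff_continuousAt.mpr fun a₀ => ?_
  refine continuousAt_of_dominated (bound := fun w => ((Real.pi ^ n)⁻¹ * (K *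
    Real.exp (3 * (‖a₀‖ + 1) ^ 2))) * (Real.exp (3 / 8 * ‖w‖ ^ 2) * ‖ψ w‖))
    (Filter.Eventually.of_forall fun a => (integrable_conj_landauKernelFun_mul m a ψ).1) ?_
    ((integrable_exp_mul_norm (by norm_num) ψ).const_mul _) ?_
  · filter_upwards [Metric.ball_mem_nhds a₀ one_pos] with a ha
    have ha' : ‖a‖ ≤ ‖a₀‖ + 1 := by
      have h1 := norm_add_le (a - a₀) a₀
      rw [sub_add_cancel] at h1
      rw [mem_ball_iff_norm] at ha
      linarith
    refine Filter.Eventually.of_forall fun w => ?_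
    have h1 : ‖radial a (laguerre m (n - 1)) w‖ ≤ K * Real.exp (1 / 8 * ‖w - a‖ ^ 2) := by
      rw [radial, Complex.norm_real, laguerre_eq_eval]
      exact h _ (by positivity)
    have h2 : Real.exp (3 * ‖a‖ ^ 2) ≤ Real.exp (3 * (‖a₀‖ + 1) ^ 2) := by gcongr
    rw [norm_mul, RCLike.norm_conj, landauKernelFun, norm_mul, Complex.norm_real,
      Real.norm_eq_abs, abs_of_pos (by have := Real.pi_pos; positivity), mul_assoc, mul_assoc,
      ← mul_assoc _ (Real.exp (3 / 8 * _))]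
    refine mul_le_mul_of_nonneg_left ?_ (by have := Real.pi_pos; positivity)
    refine mul_le_mul_of_nonneg_right ((norm_holExp_mul_le h1).trans ?_) (norm_nonneg _)
    gcongr
  · refine Filter.Eventually.of_forall fun w => Continuous.continuousAt ?_
    refine (Complex.continuous_conj.comp ?_).mul continuous_const
    have h2 : Continuous (laguerre m (n - 1)) := by
      rw [laguerre_eq_eval]
      exact Polynomial.continuous _
    unfold landauKernelFun holExp radial
    fun_prop

theorem norm_antiExp_le (a w : Cn n) :
    ‖antiExp a w‖ ≤ Real.exp (2 * ‖a‖ ^ 2) * Real.exp (1 / 8 * ‖w‖ ^ 2) := by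
  rw [← conj_holExp, RCLike.norm_conj, ← Real.exp_add]
  exact norm_holExp_le a w

theorem antiExp_self (a : Cn n) : antiExp a a = ((Real.exp (‖a‖ ^ 2) : ℝ) : ℂ) := by
  rw [antiExp, inner_self_eq_norm_sq_to_K]
  simp

theorem continuous_uncurry_antiExp : Continuous fun p : Cn n × Cn n => antiExp p.1 p.2 := by
  unfold antiExp
  fun_prop

theorem integrable_prod_normalizedGaussian {η : Cn n → ℝ} (hη : Continuous η)
    (hs : HasCompactSupport η) (ψ : Lp ℂ 2 (gaussianWeight n)) {c : ℝ} (hc : 0 < c) :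
    Integrable (Function.uncurry fun a w : Cn n => (η a : ℂ) *
      ((normalizedGaussian n c (w - a) : ℂ) * (antiExp a w * ψ w)))
      (volume.prod (gaussianWeight n)) := by
  have h1 : Integrable fun a : Cn n => ‖η a‖ * Real.exp (2 * ‖a‖ ^ 2) * (Real.pi * c) ^ n :=
    Continuous.integrable_of_hasCompactSupport (by fun_prop) hs.norm.mul_right.mul_right
  refine (h1.mul_prod (integrable_exp_mul_norm (c := 1 / 8) (by norm_num) ψ)).mono' ?_
    (Filter.Eventually.of_forall fun p => ?_)
  · have hg := continuous_normalizedGaussian n c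
    have hA := continuous_uncurry_antiExp (n := n)
    have hψ : AEStronglyMeasurable (fun p : Cn n × Cn n => ψ p.2)
        (volume.prod (gaussianWeight n)) := (Lp.aestronglyMeasurable ψ).comp_snd
    have e : (Function.uncurry fun a w : Cn n => (η a : ℂ) *
      ((normalizedGaussian n c (w - a) : ℂ) * (antiExp a w * ψ w))) = fun p =>
      ((η p.1 : ℂ) * ((normalizedGaussian n c (p.2 - p.1) : ℂ) * antiExp p.1 p.2)) * ψ p.2 := by
      funext p
      simp only [Function.uncurry]
      ring
    rw [e]
    exact (Continuous.aestronglyMeasurable (by fun_prop)).mul hψ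
  · have h2 : normalizedGaussian n c (p.2 - p.1) ≤ (Real.pi * c) ^ n := by
      have := Real.pi_pos
      refine mul_le_of_le_one_right (by positivity) (Real.exp_le_one_iff.mpr ?_)
      have : 0 ≤ Real.pi ^ 2 * c * ‖p.2 - p.1‖ ^ 2 := by positivity
      linarith
    simp only [Function.uncurry]
    rw [norm_mul, norm_mul, norm_mul, Complex.norm_real, Complex.norm_real,
      Real.norm_of_nonneg (normalizedGaussian_nonneg hc _)]
    have h3 := mul_le_mul h2 (norm_antiExp_le p.1 p.2) (norm_nonneg _) (by
      have := Real.pi_pos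
      positivity)
    have h4 := mul_le_mul_of_nonneg_left h3 (mul_nonneg (norm_nonneg (η p.1)) (norm_nonneg (ψ p.2)))
    linarith

/-- Since ψ has no pointwise values, the approximate identity is tested against η in the variable a.
After Fubini it acts on the continuous function η(a) e^{⟨a,w⟩}, with limit η(w) e^{|w|²}, and the
weight cancels the exponential. -/
theorem integral_mul_inner_landauKernel (hn : 1 ≤ n) {m : ℕ} {ψ : Lp ℂ 2 (gaussianWeight n)}
    (hψ : ψ ∈ bargmannFock n m) {η : Cn n → ℝ} (hη : Continuous η) (hs : HasCompactSupport η) :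
    ∫ a, (η a : ℂ) * ⟪landauKernel n m a, ψ⟫ = ∫ w, (η w : ℂ) * ψ w := by
  have hη1 : Continuous fun a : Cn n => (η a : ℂ) := by fun_prop
  have hsc : HasCompactSupport fun a : Cn n => (η a : ℂ) := hs.comp_left Complex.ofReal_zero
  have hA := continuous_uncurry_antiExp (n := n)
  have hfc : ∀ w, Continuous fun a => (η a : ℂ) * antiExp a w := fun w => by
    have : Continuous fun a => antiExp a w := hA.comp (Continuous.prodMk_left w)
    fun_prop
  have hfi : ∀ w, Integrable fun a => (η a : ℂ) * antiExp a w := fun w =>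
    (hfc w).integrable_of_hasCompactSupport hsc.mul_right
  have hG := continuous_normalizedGaussian n
  have key : ∀ c : ℝ, 0 < c →
      ∫ w, (∫ a, (normalizedGaussian n c (w - a) : ℂ) * ((η a : ℂ) * antiExp a w)) * ψ w
        ∂gaussianWeight n
      = (((Real.pi ^ 2 * c / (1 + Real.pi ^ 2 * c)) ^ (m + n) : ℝ) : ℂ) *
        ∫ a, (η a : ℂ) * ⟪landauKernel n m a, ψ⟫ := by
    intro c hc
    have h := integral_integral_swap (integrable_prod_normalizedGaussian hη hs ψ hc)
    have e1 : ∀ a, ∫ w, (η a : ℂ) * ((normalizedGaussian n c (w - a) : ℂ) * (antiExp a w * ψ w))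
        ∂gaussianWeight n = (((Real.pi ^ 2 * c / (1 + Real.pi ^ 2 * c)) ^ (m + n) : ℝ) : ℂ) *
        ((η a : ℂ) * ⟪landauKernel n m a, ψ⟫) := fun a => by
      rw [integral_const_mul, integral_normalizedGaussian_mul hn hψ a hc, mul_left_comm]
    simp only [e1] at h
    rw [integral_const_mul] at h
    rw [h]
    refine integral_congr_ae (Filter.Eventually.of_forall fun w => ?_)
    simp only
    rw [← integral_mul_const]
    refine integral_congr_ae (Filter.Eventually.of_forall fun a => ?_)
    simp only
    ring
  -- M absorbs the a-dependent factor of the bound in `norm_antiExp_le`; as the Gaussian has mass 1,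
  -- the majorant is independent of c.
  obtain ⟨M, hM⟩ := (hs.norm.mul_right (f' := fun a : Cn n => Real.exp (2 * ‖a‖ ^ 2))
    ).exists_bound_of_continuous (by fun_prop)
  have hlim := tendsto_integral_filter_of_dominated_convergence (μ := gaussianWeight n)
    (l := Filter.atTop)
    (F := fun (c : ℝ) w =>
      (∫ a, (normalizedGaussian n c (w - a) : ℂ) * ((η a : ℂ) * antiExp a w)) * ψ w)
    (f := fun w => ((η w : ℂ) * antiExp w w) * ψ w)
    (fun w => M * (Real.exp (1 / 8 * ‖w‖ ^ 2) * ‖ψ w‖)) ?_ ?_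
    ((integrable_exp_mul_norm (by norm_num) ψ).const_mul _) ?_
  · have ht : Filter.Tendsto (fun c : ℝ =>
        (((Real.pi ^ 2 * c / (1 + Real.pi ^ 2 * c)) ^ (m + n) : ℝ) : ℂ) *
        ∫ a, (η a : ℂ) * ⟪landauKernel n m a, ψ⟫) Filter.atTop
        (nhds (∫ a, (η a : ℂ) * ⟪landauKernel n m a, ψ⟫)) := by
      have hp := Real.pi_pos
      have h1 : Filter.Tendsto (fun c : ℝ => 1 + Real.pi ^ 2 * c) Filter.atTop Filter.atTop :=
        Filter.tendsto_atTop_add_const_left _ _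
          (Filter.tendsto_id.const_mul_atTop (by positivity))
      have h2 : Filter.Tendsto (fun c : ℝ => 1 - (1 + Real.pi ^ 2 * c)⁻¹) Filter.atTop
          (nhds (1 - 0)) := tendsto_const_nhds.sub h1.inv_tendsto_atTop
      have h3 := (Complex.continuous_ofReal.tendsto _).comp (h2.pow (m + n))
      have h4 := h3.mul_const (∫ a, (η a : ℂ) * ⟪landauKernel n m a, ψ⟫)
      simp only [sub_zero, one_pow, Complex.ofReal_one, one_mul] at h4
      refine h4.congr' ?_
      filter_upwards [Filter.eventually_gt_atTop 0] with c hc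
      simp only [Function.comp]
      congr 3
      field_simp
      ring
    have hu := tendsto_nhds_unique ht (hlim.congr' (by
      filter_upwards [Filter.eventually_gt_atTop 0] with c hc using key c hc))
    rw [hu, integral_gaussianWeight]
    refine integral_congr_ae (Filter.Eventually.of_forall fun w => ?_)
    simp only
    rw [antiExp_self, mul_comm (η w : ℂ), mul_assoc, ← mul_assoc, ← Complex.ofReal_mul,
      ← Real.exp_add]
    simp
  · filter_upwards [Filter.eventually_gt_atTop 0] with c hc
    have h := ((integrable_prod_normalizedGaussian hη hs ψ hc).swap).integral_prod_left.1
    refine h.congr (Filter.Eventually.of_forall fun w => ?_)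
    simp only [Function.comp, Prod.swap, Function.uncurry]
    rw [← integral_mul_const]
    refine integral_congr_ae (Filter.Eventually.of_forall fun a => ?_)
    simp only
    ring
  · filter_upwards [Filter.eventually_gt_atTop 0] with c hc
    refine Filter.Eventually.of_forall fun w => ?_
    rw [norm_mul, ← mul_assoc]
    refine mul_le_mul_of_nonneg_right ?_ (norm_nonneg _)
    have hGi : Integrable fun a => normalizedGaussian n c (w - a) :=
      (integrable_normalizedGaussian hc).comp_sub_left w
    refine (norm_integral_le_of_norm_le (hGi.mul_const (M * Real.exp (1 / 8 * ‖w‖ ^ 2)))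
      (Filter.Eventually.of_forall fun a => ?_)).trans (le_of_eq ?_)
    · rw [norm_mul, norm_mul, Complex.norm_real, Complex.norm_real,
        Real.norm_of_nonneg (normalizedGaussian_nonneg hc _)]
      refine mul_le_mul_of_nonneg_left ?_ (normalizedGaussian_nonneg hc _)
      have h1 := mul_le_mul_of_nonneg_left (norm_antiExp_le a w) (norm_nonneg (η a))
      have h2 := (le_abs_self _).trans (hM a)
      have h3 := mul_le_mul_of_nonneg_right h2 (Real.exp_pos (1 / 8 * ‖w‖ ^ 2)).le
      simp only [Pi.mul_apply] at h3
      linarith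
    · rw [integral_mul_const, integral_sub_left_eq_self (normalizedGaussian n c),
        integral_normalizedGaussian hc, one_mul]
  · exact Filter.Eventually.of_forall fun w =>
      (tendsto_integral_normalizedGaussian_mul (hfi w) (hfc w).continuousAt).mul_const _

theorem ae_eq_inner_landauKernel (hn : 1 ≤ n) {m : ℕ} {ψ : Lp ℂ 2 (gaussianWeight n)}
    (hψ : ψ ∈ bargmannFock n m) :
    ψ =ᵐ[gaussianWeight n] fun a => ⟪landauKernel n m a, ψ⟫ := by
  refine ae_gaussianWeight_iff.mpr (ae_eq_of_integral_contDiff_smul_eq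
    (locallyIntegrable_of_Lp_gaussianWeight ψ)
    (continuous_inner_landauKernel m ψ).locallyIntegrable fun g hg hs => ?_)
  simp only [Complex.real_smul]
  exact (integral_mul_inner_landauKernel hn hψ hg.continuous hs).symm

theorem isReproducingKernel_landauKernel (hn : 1 ≤ n) (m : ℕ) :
    IsReproducingKernel (bargmannFock n m) (landauKernel n m) where
  mem := landauKernel_mem hn m
  reproducing ψ hψ := ⟨_, continuous_inner_landauKernel m ψ, ae_eq_inner_landauKernel hn hψ,
    fun _ => rfl⟩

end Reproducing

/-- Two continuous representatives of k z - k' z agree everywhere, since the measure charges open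
sets. Evaluating at z shows that k z - k' z is orthogonal to itself. -/
theorem IsReproducingKernel.unique {X : Type*} [TopologicalSpace X] [MeasurableSpace X]
    {ν : Measure X} [ν.IsOpenPosMeasure] {H : Submodule ℂ (Lp ℂ 2 ν)} {k k' : X → Lp ℂ 2 ν}
    (hk : IsReproducingKernel H k) (hk' : IsReproducingKernel H k') : k = k' := by
  funext z
  have hmem : k z - k' z ∈ H := H.sub_mem (hk.mem z) (hk'.mem z)
  obtain ⟨g, hg, hψ, hgz⟩ := hk.reproducing _ hmem
  obtain ⟨g', hg', hψ', hgz'⟩ := hk'.reproducing _ hmem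
  have hgg : g = g' := (hg.ae_eq_iff_eq ν hg').mp (hψ.symm.trans hψ')
  rw [← sub_eq_zero, ← inner_self_eq_zero (𝕜 := ℂ), inner_sub_left, ← hgz, ← hgz', hgg, sub_self]

/-! ### The Berezin transform as a convolution -/

section BerezinTransform

variable {n : ℕ}

instance isOpenPosMeasure_gaussianWeight : (gaussianWeight n).IsOpenPosMeasure :=
  absolutelyContinuous_gaussianWeight.isOpenPosMeasure

theorem norm_sq_landauKernel (hn : 1 ≤ n) (m : ℕ) (z : Cn n) :
    ‖landauKernel n m z‖ ^ 2
      = (Real.pi ^ n)⁻¹ * Real.exp (‖z‖ ^ 2) * (m + (n - 1)).choose m := by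
  have h : ((‖landauKernel n m z‖ ^ 2 : ℝ) : ℂ)
      = ((∫ w, ‖landauKernelFun n m z w‖ ^ 2 ∂gaussianWeight n : ℝ) : ℂ) := by
    push_cast
    have h := inner_self_eq_norm_sq_to_K (𝕜 := ℂ) (landauKernel n m z)
    rw [inner_landauKernel] at h
    rw [← integral_complex_ofReal]
    refine h.symm.trans ?_
    refine integral_congr_ae ?_
    filter_upwards [coeFn_landauKernel n m z] with w hw
    rw [hw, Complex.conj_mul']
    push_cast
    rfl
  rw [Complex.ofReal_inj.mp h, integral_norm_sq_landauKernelFun hn]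

/-- The factor e^{|z|²} cancels in the normalization, and binom(m+n-1, m) = (n)_m/m! supplies the
constant of b_m. -/
theorem exp_mul_norm_sq_landauKernelFun (hn : 1 ≤ n) (m : ℕ) (z w : Cn n) :
    Real.exp (-‖w‖ ^ 2) * ((‖landauKernel n m z‖ ^ 2)⁻¹ * ‖landauKernelFun n m z w‖ ^ 2)
      = berezinDensity n m (z - w) := by
  have hp := Real.pi_pos
  have h := norm_holExp_sq_mul_exp z w
  have hC : (0 : ℝ) < (m + (n - 1)).choose m := by
    exact_mod_cast Nat.choose_pos (by omega)
  have hm : (0 : ℝ) < m.factorial := by exact_mod_cast m.factorial_pos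
  rw [norm_sq_landauKernel hn, berezinDensity, pochhammer_natCast, norm_sub_rev z w,
    show n + m - 1 = m + (n - 1) by omega, landauKernelFun, norm_mul, norm_mul, radial,
    Complex.norm_real, Complex.norm_real, Real.norm_eq_abs, Real.norm_eq_abs,
    abs_of_pos (by positivity : (0 : ℝ) < (Real.pi ^ n)⁻¹), mul_pow, mul_pow, sq_abs]
  have hz := (Real.exp_pos (‖z‖ ^ 2)).ne'
  field_simp
  linear_combination laguerre m (n - 1) (‖w - z‖ ^ 2) ^ 2 * h

theorem integrable_berezinDensity_mul (m : ℕ) (φ : Lp ℂ ∞ (gaussianWeight n)) (z : Cn n) :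
    Integrable (fun w => (berezinDensity n m (z - w) : ℂ) * φ w) volume := by
  have hφ : MemLp φ ∞ volume :=
    ⟨(Lp.aestronglyMeasurable φ).mono_ac absolutelyContinuous_gaussianWeight, by
      refine lt_of_le_of_lt ?_ (Lp.memLp φ).2
      simp only [eLpNorm_exponent_top]
      exact eLpNormEssSup_mono_measure _ absolutelyContinuous_gaussianWeight⟩
  exact ((integrable_berezinDensity n m).comp_sub_left z).mul_of_top_left hφ

theorem berezinTransform_landauKernel (hn : 1 ≤ n) (m : ℕ) (φ : Lp ℂ ∞ (gaussianWeight n))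
    (z : Cn n) :
    berezinTransform (bargmannFock n m) (landauKernel n m) φ z
      = ∫ w, (berezinDensity n m (z - w) : ℂ) * φ w := by
  have hmem : normalizedKernel (landauKernel n m) z ∈ bargmannFock n m :=
    Submodule.smul_mem _ _ (landauKernel_mem hn m z)
  -- The projection may be dropped because the normalized kernel already lies in the subspace.
  have hP : ⟪normalizedKernel (landauKernel n m) z,
      toeplitz (bargmannFock n m) φ (normalizedKernel (landauKernel n m) z)⟫
      = ⟪normalizedKernel (landauKernel n m) z,
        (φ • normalizedKernel (landauKernel n m) z : Lp ℂ 2 (gaussianWeight n))⟫ := by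
    have h := (bargmannFock n m).starProjection_inner_eq_zero
      (φ • normalizedKernel (landauKernel n m) z : Lp ℂ 2 (gaussianWeight n)) _ hmem
    rw [inner_eq_zero_symm, inner_sub_right, sub_eq_zero] at h
    exact h.symm
  rw [berezinTransform, hP, L2.inner_def]
  have e : ∀ᵐ w ∂gaussianWeight n, ⟪normalizedKernel (landauKernel n m) z w,
      (φ • normalizedKernel (landauKernel n m) z : Lp ℂ 2 (gaussianWeight n)) w⟫
      = (((‖landauKernel n m z‖ ^ 2)⁻¹ * ‖landauKernelFun n m z w‖ ^ 2 : ℝ) : ℂ) * φ w := by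
    filter_upwards [Lp.coeFn_lpSMul (r := 2) φ (normalizedKernel (landauKernel n m) z),
      Lp.coeFn_smul ((‖landauKernel n m z‖⁻¹ : ℝ) : ℂ) (landauKernel n m z),
      coeFn_landauKernel n m z] with w h1 h2 h3
    rw [h1, Pi.smul_apply', normalizedKernel, h2, Pi.smul_apply, h3]
    simp only [smul_eq_mul, RCLike.inner_apply, map_mul, Complex.conj_ofReal]
    push_cast
    rw [← Complex.conj_mul', ← inv_pow]
    ring
  rw [integral_congr_ae e, integral_gaussianWeight]
  refine integral_congr_ae (Filter.Eventually.of_forall fun w => ?_)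
  simp only
  rw [← mul_assoc, ← Complex.ofReal_mul, exp_mul_norm_sq_landauKernelFun hn]

end BerezinTransform

/-! ### The case n = 1 and the main theorem -/

theorem berezinSymbol_one (m : ℕ) :
    berezinSymbol 1 m = fun t => Real.exp (t / 4) * laguerre m 0 (-t / 4) ^ 2 := by
  funext t
  have hm : (m.factorial : ℝ) ≠ 0 := by exact_mod_cast m.factorial_ne_zero
  have h1 : pochhammer ((1 : ℕ) : ℝ) m = m.factorial := by
    rw [pochhammer_natCast, Nat.add_sub_cancel_left, Nat.choose_self, Nat.cast_one, mul_one]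
  -- For n = 1 the symbol (0)_k contains the factor 0 as soon as k ≥ 1, so only k = 0 contributes.
  have h0 : ∀ k, pochhammer (((1 : ℕ) : ℝ) - 1) (k + 1) = 0 := fun k =>
    Finset.prod_eq_zero (Finset.mem_range.mpr k.succ_pos) (by simp)
  rw [berezinSymbol, Finset.sum_range_succ', Finset.sum_eq_zero fun k _ => by rw [h0]; ring, h1]
  simp [pochhammer]
  field_simp

theorem mainTheorem1 (n m : ℕ) (hn : 1 ≤ n) :
    -- the generalized Bargmann–Fock space has a reproducing kernel, and its Berezin transform
    -- is the convolution with the density `b_m`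
    (∃ k : Cn n → Lp ℂ 2 (gaussianWeight n), IsReproducingKernel (bargmannFock n m) k) ∧
    (∀ k : Cn n → Lp ℂ 2 (gaussianWeight n), IsReproducingKernel (bargmannFock n m) k →
      ∀ (φ : Lp ℂ ∞ (gaussianWeight n)) (z : Cn n),
        Integrable (fun w => (berezinDensity n m (z - w) : ℂ) * φ w) volume ∧
        berezinTransform (bargmannFock n m) k φ z
          = ∫ w, (berezinDensity n m (z - w) : ℂ) * φ w) ∧
    -- the convolution with `b_m` is a bounded operator on `L²(ℂⁿ, dμ)`, and it is the asserted
    -- function of the Laplacian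
    ∃ B : Lp ℂ 2 (volume : Measure (Cn n)) →L[ℂ] Lp ℂ 2 (volume : Measure (Cn n)),
      (∀ φ : Lp ℂ 2 (volume : Measure (Cn n)),
        (∀ z, Integrable (fun w => (berezinDensity n m (z - w) : ℂ) * φ w) volume) ∧
        B φ =ᵐ[volume] fun z => ∫ w, (berezinDensity n m (z - w) : ℂ) * φ w) ∧
      B.toLinearMap.toPMap ⊤ = laplacianFunction n (fun t =>
        1 / pochhammer n m * Real.exp (t / 4) *
          ∑ k ∈ Finset.range (m + 1),
            pochhammer ((n : ℝ) - 1) k * ((m - k).factorial : ℝ) / (k.factorial : ℝ)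
              * (-t / 4) ^ k * laguerre (m - k) k (-t / 4)
              * laguerre (m - k) (n - 1 + k) (-t / 4)) ∧
      (n = 1 → B.toLinearMap.toPMap ⊤
        = laplacianFunction n (fun t => Real.exp (t / 4) * laguerre m 0 (-t / 4) ^ 2)) := by
  refine ⟨⟨_, isReproducingKernel_landauKernel hn m⟩, fun k hk φ z => ?_,
    berezinOperator hn m, fun φ => ⟨fun z => ?_, berezinOperator_ae_eq hn m φ⟩,
    toPMap_berezinOperator hn m, ?_⟩
  -- An arbitrary reproducing kernel coincides with the explicit one.
  · rw [hk.unique (isReproducingKernel_landauKernel hn m)]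
    exact ⟨integrable_berezinDensity_mul m φ z, berezinTransform_landauKernel hn m φ z⟩
  · exact (memLp_two_berezinDensity n m z).integrable_mul (Lp.memLp φ)
  · rintro rfl
    rw [← berezinSymbol_one]
    exact toPMap_berezinOperator hn m
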